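/- Let $d\ge 1$ and let $\Omega\subset[-1,1]^d$ be a non-empty open set. All expectations $\mathbb E$, and the norm $\Vert u\Vert_{L^2(\Omega)}=(\mathbb E\,u^2)^{1/2}$, are taken with respect to the uniform probability distribution $\rho$ on $\Omega$ (that is, Lebesgue measure if $|\Omega|=1$, e.g. for the unit cube). Let $y:\Omega\to\mathbb R$ be measurable with $|y|\le Y$ for some $Y>0$, and let $$L^{TV}(u)=\mathbb E\big(u^2-2uy\big)+\frac{|Du|(\Omega)}{|\Omega|}=\mathbb E\big(u^2-2uy+|\nabla u|\big),\qquad u\in BV(\Omega),$$ where $|Du|(\Omega)$ is the total variation (and $L^{TV}(u)=+\infty$ if $u\notin L^2(\Omega)$). For points $x_1,\dots,x_N\in\Omega$, $N\ge1$, let $$L^{TV}_N(\phi)=\frac1N\sum_{i=1}^N\big(\phi(x_i)^2-2\phi(x_i)y(x_i)+|\nabla\phi(x_i)|\big).$$ For $\tau>0$ let $\mathrm{SP}_\tau(z)=\frac1\tau\log(1+e^{\tau z})$, and let $\mathcal F^m_{\mathrm{SP}_\tau}(B)$ be the set of networks $\phi(x)=c+\frac1m\sum_{k=1}^m a_k\,\mathrm{SP}_\tau(\omega_k\cdot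 x+b_k)$ with $|c|\le 2B$, $|a_k|\le16B$, $|\omega_k|_1=1$, $|b_k|\le1$. The Barron space $\mathcal B(\Omega)$ consists of the real functions $f$ on $\Omega$ such that $f(x)=\int_{\mathbb R^d}e^{i\omega\cdot x}\tilde f(\omega)\,d\omega$ for all $x\in\Omega$, for some $\tilde f:\mathbb R^d\to\mathbb C$ with $\int_{\mathbb R^d}(1+|\omega|_1)^2|\tilde f(\omega)|\,d\omega<\infty$; its norm $\Vert f\Vert_{\mathcal B(\Omega)}$ is the infimum of the latter integral over all such $\tilde f$. There are constants $Z_1=Z_1(B,d,Y)$, $Z_2=Z_2(B,d)$ and $M_1=M_1(B,Y)$, depending only on the quantities displayed, such that the following holds. Let $\hat u=\arg\min_{u\in BV(\Omega)}L^{TV}(u)$, suppose that $\hat u\in\mathcal B(\Omega)$, and let $B>\Vert\hat u\Vert_{\mathcal B(\Omega)}$, $m\ge1$, $\tau=\sqrt m$ and $0<\epsilon<1$. Let $x_1,\dots,x_N$ be i.i.d. with law $\rho$. Then, with probability at least $1-\epsilon$ over the choice of $(x_1,\dots,x_N)$, every $\delta$-minimizer $\hat\phi^N$ of $L^{TV}_N$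 over $\mathcal F^m_{\mathrm{SP}_\tau}(B)$ (that is, every $\hat\phi^N\in\mathcal F^m_{\mathrm{SP}_\tau}(B)$ with $L^{TV}_N(\hat\phi^N)\le\inf_{\mathcal F^m_{\mathrm{SP}_\tau}(B)}L^{TV}_N+\delta$) satisfies $$\begin{aligned}L^{TV}(\hat\phi^N)-L^{TV}(\hat u)\le{}&\big(2Y+49B+\Vert\hat u\Vert_{L^2(\Omega)}+1\big)\frac{\Vert\hat u\Vert_{\mathcal B(\Omega)}}{\sqrt m}\big(24\log(m)+65\big)\\&+4\frac{\sqrt m}{\sqrt N}\big(Z_1+Z_2\sqrt{\log(m)}\big)+2M_1\frac{\sqrt{-2\log(\epsilon)}}{\sqrt N}+2\delta .\end{aligned}$$ -/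

import Mathlib

open MeasureTheory

noncomputable section

/-- The `ℓ¹` norm of a vector of `ℝᵈ`. -/
def l1Norm {d : ℕ} (w : EuclideanSpace ℝ (Fin d)) : ℝ := ∑ i, |w i|

/-- The uniform probability distribution on `Ω` (normalized Lebesgue measure). -/
def uniformMeasure {d : ℕ} (Ω : Set (EuclideanSpace ℝ (Fin d))) :
    Measure (EuclideanSpace ℝ (Fin d)) :=
  ProbabilityTheory.cond volume Ω

/-- The divergence of a vector field on `ℝᵈ`. -/
def divergence {d : ℕ} (p : EuclideanSpace ℝ (Fin d) → EuclideanSpace ℝ (Fin d))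
    (x : EuclideanSpace ℝ (Fin d)) : ℝ :=
  ∑ i, (fderiv ℝ p x (EuclideanSpace.single i 1)) i

/-- Admissible fields in the definition of the total variation on `Ω`: continuously
differentiable, compactly supported in `Ω`, of Euclidean length at most one everywhere. -/
structure IsTVTestField {d : ℕ} (Ω : Set (EuclideanSpace ℝ (Fin d)))
    (p : EuclideanSpace ℝ (Fin d) → EuclideanSpace ℝ (Fin d)) : Prop where
  contDiff : ContDiff ℝ 1 p
  hasCompactSupport : HasCompactSupport p
  tsupport_subset : tsupport p ⊆ Ω
  norm_le_one : ∀ x, ‖p x‖ ≤ 1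

/-- The total variation `|Du|(Ω)` of `u` on the open set `Ω`, that is, the supremum of
`∫_Ω u div p` over the admissible fields `p`. -/
def totalVariation {d : ℕ} (Ω : Set (EuclideanSpace ℝ (Fin d)))
    (u : EuclideanSpace ℝ (Fin d) → ℝ) : ENNReal :=
  ⨆ (p : EuclideanSpace ℝ (Fin d) → EuclideanSpace ℝ (Fin d)) (_ : IsTVTestField Ω p),
    ENNReal.ofReal (∫ x in Ω, u x * divergence p x)

/-- `u` (restricted to `Ω`) belongs to `BV(Ω)`. -/
def IsBV {d : ℕ} (Ω : Set (EuclideanSpace ℝ (Fin d)))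
    (u : EuclideanSpace ℝ (Fin d) → ℝ) : Prop :=
  IntegrableOn u Ω ∧ totalVariation Ω u ≠ ⊤

/-- The expected loss `L^{TV}(u) = E (u² - 2 u y + |∇u|)` for the uniform distribution on `Ω`;
the gradient is distributional, so that `E |∇u|` is `|Du|(Ω) / |Ω|`. The value is the intended
one for `u` in `BV(Ω) ∩ L²(Ω)` and bounded `y`. -/
def tvLoss {d : ℕ} (Ω : Set (EuclideanSpace ℝ (Fin d)))
    (y u : EuclideanSpace ℝ (Fin d) → ℝ) : ℝ :=
  (∫ x, (u x ^ 2 - 2 * u x * y x) ∂(uniformMeasure Ω))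
    + (totalVariation Ω u).toReal / (volume Ω).toReal

/-- `u` minimizes `L^{TV}` over `BV(Ω)`. For bounded `y`, the loss of a function of `BV(Ω)` that
is not square-integrable on `Ω` is `+∞`; hence the minimizer lies in `L²(Ω)` and only
square-integrable competitors matter. -/
structure IsTVMinimizer {d : ℕ} (Ω : Set (EuclideanSpace ℝ (Fin d)))
    (y u : EuclideanSpace ℝ (Fin d) → ℝ) : Prop where
  isBV : IsBV Ω u
  memLp : MemLp u 2 (uniformMeasure Ω)
  le : ∀ v : EuclideanSpace ℝ (Fin d) → ℝ, IsBV Ω v → MemLp v 2 (uniformMeasure Ω) →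
    tvLoss Ω y u ≤ tvLoss Ω y v

/-- The `L²(Ω)` norm, with respect to the uniform distribution on `Ω`. -/
def l2Norm {d : ℕ} (Ω : Set (EuclideanSpace ℝ (Fin d)))
    (u : EuclideanSpace ℝ (Fin d) → ℝ) : ℝ :=
  Real.sqrt (∫ x, u x ^ 2 ∂(uniformMeasure Ω))

/-- `F` is the Fourier transform of an extension of `f|_Ω` to `ℝᵈ`, with finite `s`-th moment. -/
structure IsBarronRep {d : ℕ} (s : ℝ) (Ω : Set (EuclideanSpace ℝ (Fin d)))
    (f : EuclideanSpace ℝ (Fin d) → ℝ) (F : EuclideanSpace ℝ (Fin d) → ℂ) : Prop where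
  aestronglyMeasurable : AEStronglyMeasurable F volume
  integrable : Integrable (fun w => (1 + l1Norm w) ^ s * ‖F w‖) volume
  eq_integral : ∀ x ∈ Ω,
    (f x : ℂ) = ∫ w, Complex.exp (Complex.I * ((inner ℝ w x : ℝ) : ℂ)) * F w

/-- `f` (restricted to `Ω`) belongs to the Barron space `𝓑ˢ(Ω)`. -/
def IsBarron {d : ℕ} (s : ℝ) (Ω : Set (EuclideanSpace ℝ (Fin d)))
    (f : EuclideanSpace ℝ (Fin d) → ℝ) : Prop :=
  ∃ F : EuclideanSpace ℝ (Fin d) → ℂ, IsBarronRep s Ω f F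

/-- The Barron norm of a function of `𝓑ˢ(Ω)`. -/
def barronNorm {d : ℕ} (s : ℝ) (Ω : Set (EuclideanSpace ℝ (Fin d)))
    (f : EuclideanSpace ℝ (Fin d) → ℝ) : ℝ :=
  sInf {r : ℝ | ∃ F : EuclideanSpace ℝ (Fin d) → ℂ, IsBarronRep s Ω f F ∧
    r = ∫ w, (1 + l1Norm w) ^ s * ‖F w‖}

/-- The softplus activation `SP_τ`. -/
def softplus (τ z : ℝ) : ℝ := 1 / τ * Real.log (1 + Real.exp (τ * z))

/-- The set `𝓕^m_σ(B)` of two-layer networks of width `m` with bounded parameters. -/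
def twoLayerNets (d : ℕ) (σ : ℝ → ℝ) (m : ℕ) (B : ℝ) :
    Set (EuclideanSpace ℝ (Fin d) → ℝ) :=
  {φ | ∃ (c : ℝ) (a : Fin m → ℝ) (w : Fin m → EuclideanSpace ℝ (Fin d)) (b : Fin m → ℝ),
    |c| ≤ 2 * B ∧ (∀ k, |a k| ≤ 16 * B ∧ l1Norm (w k) = 1 ∧ |b k| ≤ 1) ∧
    φ = fun x => c + 1 / (m : ℝ) * ∑ k, a k * σ (inner ℝ (w k) x + b k)}

/-- The empirical loss `L^{TV}_N` at the sample points `x₁, …, x_N`. -/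
def tvEmpLoss {d N : ℕ} (y : EuclideanSpace ℝ (Fin d) → ℝ)
    (x : Fin N → EuclideanSpace ℝ (Fin d)) (φ : EuclideanSpace ℝ (Fin d) → ℝ) : ℝ :=
  1 / (N : ℝ) * ∑ i, (φ (x i) ^ 2 - 2 * φ (x i) * y (x i) + ‖gradient φ (x i)‖)

/-- `φ ∈ V` is a `δ`-minimizer of `L` over `V`, i.e. `L φ ≤ inf_V L + δ`. -/
def IsDeltaMinimizer {α : Type*} (V : Set α) (L : α → ℝ) (δ : ℝ) (φ : α) : Prop :=
  φ ∈ V ∧ ∀ ψ ∈ V, L φ ≤ L ψ + δ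

end

/-! The excess loss is bounded by `δ`, an approximation error of order `r / √m`, where `r` is the
second moment of a Fourier representation of `u`, and twice a uniform deviation of order `√m / √N`
over all networks.

Approximation. Normalizing the weight `(1 + |w|₁)² ‖F w‖` to a probability law `Λ` makes `u`, on
`Ω`, equal to `r` times a mean of ridge functions whose profiles are bounded by one together with
their first two derivatives (`IsBarronRep.exists_eq_barronExt`). Taylor's formula at `-1` writes a
profile as an affine function plus a superposition of `(t - s)₊` with density `g'' s`. Replacing `(t
- s)₊` by softplus costs `2 / τ` in the value. It also costs only `2 / τ` in the derivative: the
sigmoid is not uniformly close to the Heaviside function, but it is close in `L¹` of the threshold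
`s`. Hence `u` and its gradient are within `2 r / τ` of the mean of a random neuron and of its
gradient (`abs_neuron_average_sub_le`, `norm_neuron_gradient_average_sub_le`). For `m` independent
neurons the mean of the quadratic part of the loss exceeds its value at the mean neuron by at most a
variance of order `1 / m`, and the mean norm of the gradient by at most order `1 / √m`; by Fubini
some draw is at least as good as the average (`exists_net_integral_le`). With `τ = √m` every error
is `O(1 / √m)`. The integral of the norm of the gradient is compared with the total variation from
above for the network and from below for the smooth extension of `u` (`totalVariation_le`,
`setIntegral_norm_gradient_le`).

Deviation. For finitely many networks, McDiarmid's inequality and symmetrization reduce the supremum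
of the deviations to an average over random signs (`measure_finite_deviation_le`). Contraction
removes the nonlinearities in layers: the loss is Lipschitz in the value and the partial derivatives
of the network; a network is an offset plus a bounded combination of neurons, so the supremum is
controlled by single signed neurons whatever the width; and the coordinates of a neuron are
`O(τ)`-Lipschitz in its sign, bias and preactivation and in a weight, all linear in `d + 2` numbers
of modulus at most one. There the sign average is `O(√N)`, and the factor `τ` becomes `√m`.
Increasing unions and density of a sequence of parameters then reach all networks
(`exists_deviation_event`).

The constant `K` in the final estimate does not depend on the representation, so the bound passes to
the infimum of `r`, the Barron norm. No logarithm of `m` arises on the way: `Z₂ = 0` suffices. -/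

noncomputable section

/-! ### Averages over random signs -/

/-- The average of `Φ (A ± h₁ ± ⋯ ± hₙ)` over all choices of signs. -/
def signAvg {V : Type*} [AddCommGroup V] (Φ : V → ℝ) : List V → V → ℝ
  | [], A => Φ A
  | h :: l, A => (signAvg Φ l (A + h) + signAvg Φ l (A - h)) / 2

/-- The largest entry of a vector indexed by a finite type. -/
def vecSup {ι : Type*} (A : ι → ℝ) : ℝ := ⨆ t, A t

section signAvg

variable {V : Type*} [AddCommGroup V] {Φ : V → ℝ}

/-- Signs are attached to vectors independently, so the order is immaterial. This lets any vector of
a list be brought to the front, where a one-step estimate applies. -/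
lemma signAvg_perm {l l' : List V} (h : l.Perm l') (A : V) :
    signAvg Φ l A = signAvg Φ l' A := by
  induction h generalizing A with
  | nil => rfl
  | cons x _ ih => simp only [signAvg, ih]
  | swap x y l =>
    simp only [signAvg]
    rw [show A + y + x = A + x + y by abel, show A + y - x = A - x + y by abel,
      show A - y + x = A + x - y by abel, show A - y - x = A - x - y by abel]
    ring
  | trans _ _ ih₁ ih₂ => rw [ih₁, ih₂]

/-- If one step with `h` is dominated by the average of steps with `g j`, then the step can be
replaced in front of any list. -/
lemma signAvg_cons_le_of_step {κ : Type*} [Fintype κ] {h : V} {g : κ → V}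
    (hstep : ∀ A, signAvg Φ [h] A ≤ (1 / (Fintype.card κ : ℝ)) * ∑ j, signAvg Φ [g j] A)
    (l : List V) (A : V) :
    signAvg Φ (h :: l) A ≤ (1 / (Fintype.card κ : ℝ)) * ∑ j, signAvg Φ (g j :: l) A := by
  induction l generalizing A with
  | nil => exact hstep A
  | cons k l ih =>
    -- Taking the sign of `k` first leaves two lists headed by `x` at the base points `A ± k`, to
    -- which the induction hypothesis applies.
    have e : ∀ x : V, signAvg Φ (x :: k :: l) A
        = (signAvg Φ (x :: l) (A + k) + signAvg Φ (x :: l) (A - k)) / 2 := fun x => by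
      rw [signAvg_perm (List.Perm.swap k x l)]; rfl
    simp only [e]
    rw [← Finset.sum_div, Finset.sum_add_distrib]
    have := ih (A + k)
    have := ih (A - k)
    linarith

/-- Replacement of all the vectors of a list, one after the other. -/
lemma signAvg_le_of_replace {κ : Type*} [Fintype κ] [Nonempty κ] {H G : Set V} {C : ℝ} {n : ℕ}
    {A : V}
    (hrep : ∀ h ∈ H, ∃ g : κ → V, (∀ j, g j ∈ G) ∧
      ∀ A, signAvg Φ [h] A ≤ (1 / (Fintype.card κ : ℝ)) * ∑ j, signAvg Φ [g j] A)
    (hG : ∀ l : List V, l.length = n → (∀ x ∈ l, x ∈ G) → signAvg Φ l A ≤ C)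
    (l : List V) (hl : l.length = n) (hH : ∀ x ∈ l, x ∈ H) : signAvg Φ l A ≤ C := by
  -- Hybrid argument: `l₁` holds the vectors still to be replaced and `l₂` those already replaced.
  suffices h : ∀ l₁ l₂ : List V, (l₁ ++ l₂).length = n → (∀ x ∈ l₁, x ∈ H) → (∀ x ∈ l₂, x ∈ G) →
      signAvg Φ (l₁ ++ l₂) A ≤ C by
    simpa using h l [] (by simpa using hl) hH (by simp)
  intro l₁
  induction l₁ with
  | nil => intro l₂ h₁ _ h₃; exact hG _ h₁ h₃
  | cons h l₁ ih =>
    intro l₂ h₁ h₂ h₃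
    obtain ⟨g, hg, hs⟩ := hrep h (h₂ h (by simp))
    refine (signAvg_cons_le_of_step hs (l₁ ++ l₂) A).trans ?_
    have hj : ∀ j, signAvg Φ (g j :: (l₁ ++ l₂)) A ≤ C := by
      intro j
      rw [signAvg_perm (List.perm_middle (a := g j) (l₁ := l₁) (l₂ := l₂)).symm]
      refine ih (g j :: l₂) (by simp at h₁ ⊢; omega) (fun x hx => h₂ x (by simp [hx])) ?_
      intro x hx
      rcases List.mem_cons.1 hx with rfl | hx
      · exact hg j
      · exact h₃ x hx
    calc _ ≤ (1 / (Fintype.card κ : ℝ)) * ∑ _j : κ, C := by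
            gcongr with j; exact hj j
      _ = C := by
        have : (Fintype.card κ : ℝ) ≠ 0 := by exact_mod_cast Fintype.card_ne_zero
        simp only [Finset.sum_const, Finset.card_univ, nsmul_eq_mul]
        field_simp

end signAvg

/-! ### Suprema over finite index sets: contraction and sign averages -/

section vecSup

lemma vecSup_le {ι : Type*} [Nonempty ι] {A : ι → ℝ} {c : ℝ} (h : ∀ t, A t ≤ c) :
    vecSup A ≤ c :=
  ciSup_le h

variable {ι : Type*} [Finite ι]

lemma le_vecSup (A : ι → ℝ) (t : ι) : A t ≤ vecSup A :=
  le_ciSup (Set.finite_range A).bddAbove t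

lemma exists_vecSup_eq [Nonempty ι] (A : ι → ℝ) : ∃ t, vecSup A = A t := by
  obtain ⟨t, ht⟩ := exists_eq_ciSup_of_finite (f := A)
  exact ⟨t, ht.symm⟩

/-- The contraction principle for a function that is Lipschitz in several coordinates. -/
lemma signAvg_vecSup_contract [Nonempty ι] {κ : Type*} [Fintype κ] [Nonempty κ] {h : ι → ℝ}
    {g : κ → ι → ℝ} (hg : ∀ t s, |h t - h s| ≤ ∑ j, |g j t - g j s|) (A : ι → ℝ) :
    signAvg vecSup [h] A
      ≤ (1 / (Fintype.card κ : ℝ)) * ∑ j, signAvg vecSup [(Fintype.card κ : ℝ) • g j] A := by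
  set n : ℝ := (Fintype.card κ : ℝ)
  have hn : 0 < n := by simp only [n]; exact_mod_cast Fintype.card_pos
  obtain ⟨t, ht⟩ := exists_vecSup_eq (A + h)
  obtain ⟨s, hs⟩ := exists_vecSup_eq (A - h)
  simp only [signAvg, ht, hs]
  -- The two suprema are evaluated at `t` and `s`, in the order dictated by the sign of `g j t - g j
  -- s`; this produces the absolute value. The factor `n` in front of `g j` pays for averaging over
  -- `j` instead of summing.
  have hj : ∀ j, (A t + A s + n * |g j t - g j s|) / 2
      ≤ (vecSup (A + n • g j) + vecSup (A - n • g j)) / 2 := by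
    intro j
    have h1 := le_vecSup (A + n • g j) t
    have h2 := le_vecSup (A + n • g j) s
    have h3 := le_vecSup (A - n • g j) t
    have h4 := le_vecSup (A - n • g j) s
    simp only [Pi.add_apply, Pi.sub_apply, Pi.smul_apply, smul_eq_mul] at h1 h2 h3 h4
    rcases abs_cases (g j t - g j s) with ⟨e, _⟩ | ⟨e, _⟩ <;> rw [e] <;> nlinarith
  have h0 := (le_abs_self _).trans (hg t s)
  calc ((A + h) t + (A - h) s) / 2 ≤ (A t + A s + ∑ j, |g j t - g j s|) / 2 := by
        simp only [Pi.add_apply, Pi.sub_apply]; linarith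
    _ = (1 / n) * ∑ j, (A t + A s + n * |g j t - g j s|) / 2 := by
        rw [← Finset.sum_div, Finset.sum_add_distrib, ← Finset.mul_sum, Finset.sum_const,
          Finset.card_univ, nsmul_eq_mul]
        change _ = 1 / n * ((n * _ + _) / 2)
        field_simp
    _ ≤ _ := by
        exact mul_le_mul_of_nonneg_left (Finset.sum_le_sum fun j _ => hj j) (by positivity)

/-- Bounding the random signs average of a family of functions that are Lipschitz in coordinates
belonging to another family. -/
lemma signAvg_vecSup_le_of_lipschitz [Nonempty ι] (κ : Type*) [Fintype κ] [Nonempty κ]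
    {H G : Set (ι → ℝ)} {C : ℝ} {n : ℕ} {A : ι → ℝ}
    (hrep : ∀ h ∈ H, ∃ g : κ → ι → ℝ, (∀ j, (Fintype.card κ : ℝ) • g j ∈ G) ∧
      ∀ t s, |h t - h s| ≤ ∑ j, |g j t - g j s|)
    (hG : ∀ l : List (ι → ℝ), l.length = n → (∀ x ∈ l, x ∈ G) → signAvg vecSup l A ≤ C)
    (l : List (ι → ℝ)) (hl : l.length = n) (hH : ∀ x ∈ l, x ∈ H) : signAvg vecSup l A ≤ C := by
  refine signAvg_le_of_replace (κ := κ) (H := H) (G := G) (fun h hh => ?_) hG l hl hH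
  obtain ⟨g, hg, hL⟩ := hrep h hh
  exact ⟨fun j => (Fintype.card κ : ℝ) • g j, hg, signAvg_vecSup_contract hL⟩

/-- Concavity of the square root: the mean of the two radicands is `a ^ 2 + v ^ 2 + s`. This is the
induction step of the bound of a mean absolute sign sum by a root of a sum of squares. -/
lemma sqrt_add_sqrt_le {a v s : ℝ} (hs : 0 ≤ s) :
    (√((a + v) ^ 2 + s) + √((a - v) ^ 2 + s)) / 2 ≤ √(a ^ 2 + (v ^ 2 + s)) := by
  apply Real.le_sqrt_of_sq_le
  have h1 := Real.sq_sqrt (show 0 ≤ (a + v) ^ 2 + s by positivity)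
  have h2 := Real.sq_sqrt (show 0 ≤ (a - v) ^ 2 + s by positivity)
  nlinarith [sq_nonneg (√((a + v) ^ 2 + s) - √((a - v) ^ 2 + s))]

omit [Finite ι] in
/-- Random signs average of linear functions on a cube. -/
lemma signAvg_linear_le [Nonempty ι] {L : Type*} [Fintype L] {z : ι → L → ℝ}
    (hz : ∀ t i, |z t i| ≤ 1) (l : List (L → ℝ)) (α : L → ℝ) :
    signAvg vecSup (l.map fun v t => ∑ i, v i * z t i) (fun t => ∑ i, α i * z t i)
      ≤ ∑ i, √(α i ^ 2 + (l.map fun v => v i ^ 2).sum) := by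
  induction l generalizing α with
  | nil =>
    simp only [List.map_nil, List.sum_nil, add_zero, Real.sqrt_sq_eq_abs, signAvg]
    -- A linear form with coefficients `α` is at most the `ℓ¹` norm of `α` on the cube, which
    -- decouples the coordinates before the signs are averaged.
    refine vecSup_le fun t => Finset.sum_le_sum fun i _ => ?_
    calc α i * z t i ≤ |α i * z t i| := le_abs_self _
      _ = |α i| * |z t i| := abs_mul _ _
      _ ≤ |α i| * 1 := by gcongr; exact hz t i
      _ = |α i| := mul_one _
  | cons v l ih =>
    simp only [List.map_cons, signAvg, List.sum_cons]
    have e1 : ((fun t => ∑ i, α i * z t i) + fun t => ∑ i, v i * z t i)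
        = fun t => ∑ i, (α + v) i * z t i := by
      ext t; simp [add_mul, Finset.sum_add_distrib]
    have e2 : ((fun t => ∑ i, α i * z t i) - fun t => ∑ i, v i * z t i)
        = fun t => ∑ i, (α - v) i * z t i := by
      ext t; simp [sub_mul, Finset.sum_sub_distrib]
    rw [e1, e2]
    calc _ ≤ ((∑ i, √((α + v) i ^ 2 + (l.map fun v => v i ^ 2).sum))
          + ∑ i, √((α - v) i ^ 2 + (l.map fun v => v i ^ 2).sum)) / 2 := by
            gcongr <;> exact ih _
      _ = ∑ i, (√((α + v) i ^ 2 + (l.map fun v => v i ^ 2).sum)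
          + √((α - v) i ^ 2 + (l.map fun v => v i ^ 2).sum)) / 2 := by
            rw [← Finset.sum_add_distrib, Finset.sum_div]
      _ ≤ _ := by
        refine Finset.sum_le_sum fun i _ => ?_
        refine sqrt_add_sqrt_le (List.sum_nonneg ?_)
        simp only [List.mem_map]
        rintro _ ⟨v, _, rfl⟩
        positivity

omit [Finite ι] in
lemma signAvg_linear_zero_le [Nonempty ι] {L : Type*} [Fintype L] {z : ι → L → ℝ}
    (hz : ∀ t i, |z t i| ≤ 1) {R : ℝ} (hR : 0 ≤ R) (l : List (L → ℝ))
    (hl : ∀ v ∈ l, ∀ i, |v i| ≤ R) :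
    signAvg vecSup (l.map fun v t => ∑ i, v i * z t i) 0
      ≤ Fintype.card L * (R * √l.length) := by
  have h := signAvg_linear_le hz l 0
  have e : (fun t => ∑ i, (0 : L → ℝ) i * z t i) = (0 : ι → ℝ) := by ext; simp
  rw [e] at h
  refine h.trans ?_
  calc _ ≤ ∑ _i : L, R * √l.length := by
        refine Finset.sum_le_sum fun i _ => ?_
        rw [← Real.sqrt_sq hR, ← Real.sqrt_mul (by positivity)]
        apply Real.sqrt_le_sqrt
        have : (l.map fun v => v i ^ 2).sum ≤ (l.map fun v => v i ^ 2).length • R ^ 2 := by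
          refine List.sum_le_card_nsmul _ _ ?_
          simp only [List.mem_map]
          rintro _ ⟨v, hv, rfl⟩
          exact sq_le_sq' (abs_le.1 (hl v hv i)).1 (abs_le.1 (hl v hv i)).2
        simp only [Pi.zero_apply, List.length_map, nsmul_eq_mul] at this ⊢
        linarith
    _ = _ := by simp

/-- Random signs average over combinations `α c + m⁻¹ ∑ₖ aₖ ψₖ` of functions with bounded
coefficients. -/
lemma signAvg_combination_le [Nonempty ι] {m : ℕ} (hm : 0 < m) {c : ι → ℝ} {a : ι → Fin m → ℝ}
    {K₁ K₂ : ℝ} (hc : ∀ t, |c t| ≤ K₁) (ha : ∀ t k, |a t k| ≤ K₂)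
    (l : List (ℝ × (ι → Fin m → ℝ))) (p : ℝ × (ι → Fin m → ℝ)) :
    signAvg vecSup (l.map fun q t => q.1 * c t + 1 / (m : ℝ) * ∑ k, a t k * q.2 t k)
        (fun t => p.1 * c t + 1 / (m : ℝ) * ∑ k, a t k * p.2 t k)
      ≤ K₁ * √(p.1 ^ 2 + (l.map fun q => q.1 ^ 2).sum)
        + K₂ * signAvg (vecSup (ι := (ι × Fin m) × Bool))
            (l.map fun q t => (if t.2 then 1 else -1) * q.2 t.1.1 t.1.2)
            (fun t => (if t.2 then 1 else -1) * p.2 t.1.1 t.1.2) := by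
  have : Nonempty (Fin m) := ⟨⟨0, hm⟩⟩
  have hK₁ : 0 ≤ K₁ := (abs_nonneg _).trans (hc (Classical.arbitrary ι))
  have hK₂ : 0 ≤ K₂ := (abs_nonneg _).trans (ha (Classical.arbitrary ι) (Classical.arbitrary _))
  induction l generalizing p with
  | nil =>
    simp only [List.map_nil, List.sum_nil, add_zero, Real.sqrt_sq_eq_abs, signAvg]
    refine vecSup_le fun t => ?_
    -- The Boolean index makes `S` a supremum of absolute values over all single neurons. An average
    -- of `m` terms of size at most `K₂ * S` is again at most `K₂ * S`, so the width drops out.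
    set S := vecSup fun t : (ι × Fin m) × Bool => (if t.2 then 1 else -1) * p.2 t.1.1 t.1.2
    have h1 : ∀ k, |p.2 t k| ≤ S := by
      intro k
      have h1 := le_vecSup (fun t : (ι × Fin m) × Bool =>
        (if t.2 then (1 : ℝ) else -1) * p.2 t.1.1 t.1.2) ((t, k), true)
      have h2 := le_vecSup (fun t : (ι × Fin m) × Bool =>
        (if t.2 then (1 : ℝ) else -1) * p.2 t.1.1 t.1.2) ((t, k), false)
      simp only [if_true, one_mul] at h1
      simp only [Bool.false_eq_true, if_false, neg_mul, one_mul] at h2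
      exact abs_le.2 ⟨by linarith, h1⟩
    have h2 : p.1 * c t ≤ K₁ * |p.1| := by
      calc _ ≤ |p.1 * c t| := le_abs_self _
        _ = |p.1| * |c t| := abs_mul _ _
        _ ≤ |p.1| * K₁ := by gcongr; exact hc t
        _ = _ := mul_comm _ _
    have h3 : 1 / (m : ℝ) * ∑ k, a t k * p.2 t k ≤ K₂ * S := by
      have : ∑ k, a t k * p.2 t k ≤ ∑ _k : Fin m, K₂ * S := by
        refine Finset.sum_le_sum fun k _ => ?_
        calc _ ≤ |a t k * p.2 t k| := le_abs_self _
          _ = |a t k| * |p.2 t k| := abs_mul _ _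
          _ ≤ _ := by gcongr; exacts [ha t k, h1 k]
      simp only [Finset.sum_const, Finset.card_univ, Fintype.card_fin, nsmul_eq_mul] at this
      have hm' : (0 : ℝ) < m := by exact_mod_cast hm
      rw [one_div, inv_mul_le_iff₀ hm']
      exact this
    linarith
  | cons q l ih =>
    simp only [List.map_cons, signAvg, List.sum_cons]
    have e1 : ((fun t => p.1 * c t + 1 / (m : ℝ) * ∑ k, a t k * p.2 t k)
        + fun t => q.1 * c t + 1 / (m : ℝ) * ∑ k, a t k * q.2 t k)
        = fun t => (p + q).1 * c t + 1 / (m : ℝ) * ∑ k, a t k * (p + q).2 t k := by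
      ext t; simp [add_mul, mul_add, Finset.sum_add_distrib]; ring
    have e2 : ((fun t => p.1 * c t + 1 / (m : ℝ) * ∑ k, a t k * p.2 t k)
        - fun t => q.1 * c t + 1 / (m : ℝ) * ∑ k, a t k * q.2 t k)
        = fun t => (p - q).1 * c t + 1 / (m : ℝ) * ∑ k, a t k * (p - q).2 t k := by
      ext t; simp [sub_mul, mul_sub, Finset.sum_sub_distrib]; ring
    have e3 : ((fun t : (ι × Fin m) × Bool => (if t.2 then 1 else -1) * p.2 t.1.1 t.1.2)
        + fun t => (if t.2 then 1 else -1) * q.2 t.1.1 t.1.2)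
        = fun t => (if t.2 then 1 else -1) * (p + q).2 t.1.1 t.1.2 := by
      ext t; simp [mul_add]
    have e4 : ((fun t : (ι × Fin m) × Bool => (if t.2 then 1 else -1) * p.2 t.1.1 t.1.2)
        - fun t => (if t.2 then 1 else -1) * q.2 t.1.1 t.1.2)
        = fun t => (if t.2 then 1 else -1) * (p - q).2 t.1.1 t.1.2 := by
      ext t; simp [mul_sub]
    rw [e1, e2, e3, e4]
    have h1 := ih (p + q)
    have h2 := ih (p - q)
    have h3 := sqrt_add_sqrt_le (a := p.1) (v := q.1) (s := (l.map fun q => q.1 ^ 2).sum) (by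
      refine List.sum_nonneg ?_
      simp only [List.mem_map]
      rintro _ ⟨v, _, rfl⟩
      positivity)
    have h4 := mul_le_mul_of_nonneg_left h3 hK₁
    change K₁ * ((√((p + q).1 ^ 2 + _) + √((p - q).1 ^ 2 + _)) / 2) ≤ _ at h4
    linarith

end vecSup

/-! ### Concentration and symmetrization -/

section Concentration

variable {X V : Type*} [MeasurableSpace X] [NormedAddCommGroup V] [NormedSpace ℝ V]
  [CompleteSpace V] [MeasurableSpace V] [BorelSpace V] [SecondCountableTopology V]

/-- The average of `Φ` over the translations of its argument by the centred random vector
`𝔼 f - f x`. -/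
def centredAvg (ρ : Measure X) (f : X → V) (Φ : V → ℝ) (A : V) : ℝ :=
  ∫ x, Φ (A + ((∫ x', f x' ∂ρ) - f x)) ∂ρ

variable {ρ : Measure X} [IsProbabilityMeasure ρ] {f : X → V} {M : ℝ} {Φ : V → ℝ}

omit [NormedSpace ℝ V] [CompleteSpace V] [SecondCountableTopology V] in
lemma integrable_lipschitz_comp {Y : Type*} [MeasurableSpace Y] {μ : Measure Y} [IsFiniteMeasure μ]
    (hΦ : LipschitzWith 1 Φ) {g : Y → V} (hg : Measurable g) {K : ℝ} (hK : ∀ x, ‖g x‖ ≤ K) :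
    Integrable (fun x => Φ (g x)) μ := by
  refine Integrable.of_bound (hΦ.continuous.measurable.comp hg).aestronglyMeasurable
    (|Φ 0| + K) (Filter.Eventually.of_forall fun x => ?_)
  have h := hΦ.dist_le_mul (g x) 0
  simp only [NNReal.coe_one, one_mul, dist_zero_right, Real.dist_eq] at h
  have h2 := abs_sub_abs_le_abs_sub (Φ (g x)) (Φ 0)
  rw [Real.norm_eq_abs]
  linarith [hK x]

omit [CompleteSpace V] [NormedSpace ℝ V] in
lemma integrable_of_norm_le (hf : Measurable f) (hM : ∀ x, ‖f x‖ ≤ M) : Integrable f ρ :=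
  Integrable.of_bound hf.aestronglyMeasurable M (Filter.Eventually.of_forall hM)

omit [MeasurableSpace X] [NormedSpace ℝ V] [CompleteSpace V] [MeasurableSpace V] [BorelSpace V]
  [SecondCountableTopology V] in
lemma norm_shift_le (hM : ∀ x, ‖f x‖ ≤ M) (A v : V) (x : X) :
    ‖A + (v - f x)‖ ≤ ‖A‖ + (‖v‖ + M) :=
  (norm_add_le _ _).trans (by gcongr; exact (norm_sub_le _ _).trans (by gcongr; exact hM x))

omit [NormedSpace ℝ V] [CompleteSpace V] [SecondCountableTopology V] in
lemma integrable_shift (hΦ : LipschitzWith 1 Φ) (hf : Measurable f) (hM : ∀ x, ‖f x‖ ≤ M)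
    (A v : V) : Integrable (fun x => Φ (A + (v - f x))) ρ :=
  integrable_lipschitz_comp hΦ (by fun_prop) (norm_shift_le hM A v)

omit [CompleteSpace V] [SecondCountableTopology V] in
lemma lipschitz_centredAvg (hΦ : LipschitzWith 1 Φ) (hf : Measurable f) (hM : ∀ x, ‖f x‖ ≤ M) :
    LipschitzWith 1 (centredAvg ρ f Φ) := by
  refine LipschitzWith.of_dist_le_mul fun A B => ?_
  simp only [NNReal.coe_one, one_mul]
  rw [Real.dist_eq, centredAvg, centredAvg,
    ← integral_sub (integrable_shift hΦ hf hM _ _) (integrable_shift hΦ hf hM _ _),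
    ← Real.norm_eq_abs]
  refine (norm_integral_le_of_norm_le_const (C := dist A B)
    (Filter.Eventually.of_forall fun x => ?_)).trans (by simp)
  have h := hΦ.dist_le_mul (A + ((∫ x', f x' ∂ρ) - f x)) (B + ((∫ x', f x' ∂ρ) - f x))
  simpa [Real.dist_eq] using h

omit [CompleteSpace V] [SecondCountableTopology V] in
-- Together with `lipschitz_centredAvg`, this keeps the hypotheses of one-variable symmetrization
-- valid when `centredAvg` is iterated, one iteration per sample point.
lemma convexOn_centredAvg (hΦ : LipschitzWith 1 Φ) (hc : ConvexOn ℝ Set.univ Φ)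
    (hf : Measurable f) (hM : ∀ x, ‖f x‖ ≤ M) :
    ConvexOn ℝ Set.univ (centredAvg ρ f Φ) := by
  refine ⟨convex_univ, fun A _ B _ a b ha hb hab => ?_⟩
  simp only [centredAvg, smul_eq_mul]
  rw [← integral_const_mul, ← integral_const_mul, ← integral_add
    ((integrable_shift hΦ hf hM _ _).const_mul _) ((integrable_shift hΦ hf hM _ _).const_mul _)]
  refine integral_mono (integrable_shift hΦ hf hM _ _)
    (((integrable_shift hΦ hf hM _ _).const_mul _).add
      ((integrable_shift hΦ hf hM _ _).const_mul _)) fun x => ?_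
  set w := (∫ x', f x' ∂ρ) - f x
  have e : a • A + b • B + w = a • (A + w) + b • (B + w) := by
    rw [smul_add, smul_add, add_add_add_comm, ← add_smul, hab, one_smul]
  have := hc.2 (Set.mem_univ (A + w)) (Set.mem_univ (B + w)) ha hb hab
  simp only [smul_eq_mul] at this
  simpa only [e] using this

omit [NormedSpace ℝ V] [CompleteSpace V] [MeasurableSpace V] [BorelSpace V]
  [SecondCountableTopology V] in
lemma lipschitz_signAvg (hΦ : LipschitzWith 1 Φ) (l : List V) :
    LipschitzWith 1 (signAvg Φ l) := by
  induction l with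
  | nil => exact hΦ
  | cons h l ih =>
    refine LipschitzWith.of_dist_le_mul fun A B => ?_
    have h1 := ih.dist_le_mul (A + h) (B + h)
    have h2 := ih.dist_le_mul (A - h) (B - h)
    simp only [NNReal.coe_one, one_mul, Real.dist_eq, dist_add_right, dist_sub_right, signAvg]
      at h1 h2 ⊢
    rw [abs_le] at *
    constructor <;> linarith

omit [CompleteSpace V] [MeasurableSpace V] [BorelSpace V] [SecondCountableTopology V] in
lemma convexOn_signAvg (hc : ConvexOn ℝ Set.univ Φ) (l : List V) :
    ConvexOn ℝ Set.univ (signAvg Φ l) := by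
  induction l with
  | nil => exact hc
  | cons h l ih =>
    refine ⟨convex_univ, fun A _ B _ a b ha hb hab => ?_⟩
    have e : ∀ w, a • A + b • B + w = a • (A + w) + b • (B + w) := fun w => by
      rw [smul_add, smul_add, add_add_add_comm, ← add_smul, hab, one_smul]
    have h1 := ih.2 (Set.mem_univ (A + h)) (Set.mem_univ (B + h)) ha hb hab
    have h2 := ih.2 (Set.mem_univ (A + -h)) (Set.mem_univ (B + -h)) ha hb hab
    rw [← e] at h1 h2
    simp only [signAvg, smul_eq_mul, sub_eq_add_neg] at h1 h2 ⊢
    linarith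

omit [CompleteSpace V] [SecondCountableTopology V] in
-- Both operations average over translations of the argument, hence they commute. Integrability is
-- all that has to be checked.
lemma signAvg_centredAvg (hΦ : LipschitzWith 1 Φ) (hf : Measurable f) (hM : ∀ x, ‖f x‖ ≤ M)
    (l : List V) (A : V) :
    signAvg (centredAvg ρ f Φ) l A = centredAvg ρ f (signAvg Φ l) A := by
  induction l generalizing A with
  | nil => rfl
  | cons h l ih =>
    have hl := lipschitz_signAvg hΦ l
    simp only [signAvg, ih, centredAvg]
    rw [← integral_add (integrable_shift hl hf hM _ _) (integrable_shift hl hf hM _ _),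
      ← integral_div]
    refine integral_congr_ae (Filter.Eventually.of_forall fun x => ?_)
    abel_nf

/-- Symmetrization of one variable. -/
lemma centredAvg_le (hΦ : LipschitzWith 1 Φ) (hc : ConvexOn ℝ Set.univ Φ)
    (hf : Measurable f) (hM : ∀ x, ‖f x‖ ≤ M) {A : V} {C : ℝ}
    (hC : ∀ x x', signAvg Φ [f x - f x'] A ≤ C) : centredAvg ρ f Φ A ≤ C := by
  have hfi : Integrable f ρ := integrable_of_norm_le hf hM
  have hb : ∀ p : X × X, ‖A + (f p.2 - f p.1)‖ ≤ ‖A‖ + (M + M) := fun p =>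
    (norm_shift_le hM A (f p.2) p.1).trans (by gcongr; exact hM _)
  have hb' : ∀ p : X × X, ‖A + (f p.1 - f p.2)‖ ≤ ‖A‖ + (M + M) := fun p =>
    (norm_shift_le hM A (f p.1) p.2).trans (by gcongr; exact hM _)
  have hI : Integrable (fun p : X × X => Φ (A + (f p.2 - f p.1))) (ρ.prod ρ) :=
    integrable_lipschitz_comp hΦ (by fun_prop) hb
  have hI' : Integrable (fun p : X × X => Φ (A + (f p.1 - f p.2))) (ρ.prod ρ) :=
    integrable_lipschitz_comp hΦ (by fun_prop) hb'
  -- Jensen's inequality replaces the mean of `f` by its value at an independent copy of the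
  -- variable.
  have h1 : centredAvg ρ f Φ A ≤ ∫ p : X × X, Φ (A + (f p.2 - f p.1)) ∂(ρ.prod ρ) := by
    rw [integral_prod _ hI]
    refine integral_mono (integrable_shift hΦ hf hM _ _) hI.integral_prod_left fun x => ?_
    have hg : Integrable (fun x' => A + (f x' - f x)) ρ :=
      (integrable_const A).add (hfi.sub (integrable_const _))
    have := hc.map_integral_le (μ := ρ) (f := fun x' => A + (f x' - f x))
      hΦ.continuous.continuousOn isClosed_univ (Filter.Eventually.of_forall fun _ => Set.mem_univ _)
      hg (integrable_lipschitz_comp hΦ (by fun_prop) fun x' => hb (x, x'))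
    have e : ∫ x', (A + (f x' - f x)) ∂ρ = A + ((∫ x', f x' ∂ρ) - f x) := by
      rw [integral_add (f := fun _ => A) (g := fun x' => f x' - f x) (integrable_const A)
        (hfi.sub (integrable_const _)), integral_sub hfi (integrable_const _)]
      simp
    rw [e] at this
    exact this
  -- Exchanging the two copies flips the sign of the difference, so the integral equals that of the
  -- average over the sign, which `hC` bounds pointwise.
  have h2 : ∫ p : X × X, Φ (A + (f p.2 - f p.1)) ∂(ρ.prod ρ)
      = ∫ p : X × X, Φ (A + (f p.1 - f p.2)) ∂(ρ.prod ρ) := by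
    rw [← integral_prod_swap]; rfl
  have h3 : ∫ p : X × X, (Φ (A + (f p.1 - f p.2)) + Φ (A + (f p.2 - f p.1))) / 2 ∂(ρ.prod ρ)
      ≤ C := by
    calc _ ≤ ∫ _p : X × X, C ∂(ρ.prod ρ) := by
          refine integral_mono ((hI'.add hI).div_const 2) (integrable_const C) fun p => ?_
          have := hC p.1 p.2
          simp only [signAvg] at this
          rwa [show A - (f p.1 - f p.2) = A + (f p.2 - f p.1) by abel] at this
      _ = C := by simp
  rw [integral_div, integral_add hI' hI] at h3
  linarith

/-- Symmetrization. -/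
lemma centredAvg_iterate_le (hf : Measurable f) (hM : ∀ x, ‖f x‖ ≤ M) (n : ℕ) {Φ : V → ℝ}
    (hΦ : LipschitzWith 1 Φ) (hc : ConvexOn ℝ Set.univ Φ) {A : V} {C : ℝ}
    (hC : ∀ l : List V, l.length = n → (∀ h ∈ l, ∃ x x', h = f x - f x') → signAvg Φ l A ≤ C) :
    (centredAvg ρ f)^[n] Φ A ≤ C := by
  induction n generalizing Φ with
  | zero => exact hC [] rfl (by simp)
  | succ n ih =>
    rw [Function.iterate_succ_apply]
    refine ih (lipschitz_centredAvg hΦ hf hM) (convexOn_centredAvg hΦ hc hf hM) fun l hl hh => ?_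
    -- The induction hypothesis, applied to `centredAvg ρ f Φ`, has introduced `n` signs. The
    -- remaining average is moved outside them and symmetrized, since `signAvg Φ l` is again
    -- Lipschitz and convex.
    rw [signAvg_centredAvg hΦ hf hM]
    refine centredAvg_le (lipschitz_signAvg hΦ l) (convexOn_signAvg hc l) hf hM fun x x' => ?_
    have := hC ((f x - f x') :: l) (by simp [hl]) (by
      intro h hm
      rcases List.mem_cons.1 hm with rfl | hm
      · exact ⟨x, x', rfl⟩
      · exact hh h hm)
    simpa [signAvg] using this

omit [CompleteSpace V] [SecondCountableTopology V] in
lemma lipschitz_centredAvg_iterate (hΦ : LipschitzWith 1 Φ) (hf : Measurable f)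
    (hM : ∀ x, ‖f x‖ ≤ M) (n : ℕ) : LipschitzWith 1 ((centredAvg ρ f)^[n] Φ) := by
  induction n with
  | zero => exact hΦ
  | succ n ih =>
    rw [Function.iterate_succ_apply']
    exact lipschitz_centredAvg ih hf hM

omit [CompleteSpace V] [SecondCountableTopology V] in
/-- Hoeffding's lemma for a Lipschitz function of a bounded random vector. -/
lemma integral_exp_lipschitz_le (hΦ : LipschitzWith 1 Φ) (hf : Measurable f)
    (hM : ∀ x, ‖f x‖ ≤ M) (A : V) (s : ℝ) :
    ∫ x, Real.exp (s * Φ (A + ((∫ x', f x' ∂ρ) - f x))) ∂ρ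
      ≤ Real.exp (s * centredAvg ρ f Φ A + M ^ 2 * s ^ 2 / 2) := by
  set v := ∫ x', f x' ∂ρ
  set Z := Φ (A + v)
  have hx0 : Nonempty X := ρ.nonempty_of_neZero
  have hM0 : 0 ≤ M := (norm_nonneg _).trans (hM hx0.some)
  have hm : AEMeasurable (fun x => Φ (A + (v - f x))) ρ :=
    (hΦ.continuous.measurable.comp (by fun_prop)).aemeasurable
  -- Dropping `f x` from the argument changes `Φ` by at most `M`. The values thus lie in an interval
  -- of length `2 * M`, with variance proxy `M ^ 2`.
  have h := ProbabilityTheory.hasSubgaussianMGF_of_mem_Icc (a := Z - M) (b := Z + M) hm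
    (Filter.Eventually.of_forall fun x => by
      have h := hΦ.dist_le_mul (A + (v - f x)) (A + v)
      have e : A + (v - f x) - (A + v) = - f x := by abel
      simp only [NNReal.coe_one, one_mul, dist_eq_norm, e, norm_neg] at h
      have := abs_le.1 (h.trans (hM x))
      constructor <;> linarith)
  have h2 := h.mgf_le s
  have e : (((‖Z + M - (Z - M)‖₊ / 2) ^ 2 : NNReal) : ℝ) = M ^ 2 := by
    have : Z + M - (Z - M) = 2 * M := by ring
    simp only [this, NNReal.coe_pow, NNReal.coe_div, coe_nnnorm, Real.norm_eq_abs, NNReal.coe_ofNat]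
    rw [abs_of_nonneg (by positivity)]
    ring
  rw [e, ProbabilityTheory.mgf] at h2
  have e2 : ∀ x, Real.exp (s * Φ (A + (v - f x)))
      = Real.exp (s * centredAvg ρ f Φ A)
        * Real.exp (s * (Φ (A + (v - f x)) - ∫ x, Φ (A + (v - f x)) ∂ρ)) := by
    intro x
    rw [← Real.exp_add]
    congr 1
    simp only [centredAvg]
    ring
  simp_rw [e2]
  rw [integral_const_mul, Real.exp_add]
  gcongr

omit [NormedSpace ℝ V] [CompleteSpace V] [SecondCountableTopology V] in
lemma integrable_exp_lipschitz_comp {Y : Type*} [MeasurableSpace Y] {μ : Measure Y}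
    [IsFiniteMeasure μ]
    (hΦ : LipschitzWith 1 Φ) {g : Y → V} (hg : Measurable g) {K : ℝ} (hK : ∀ x, ‖g x‖ ≤ K) (s : ℝ) :
    Integrable (fun x => Real.exp (s * Φ (g x))) μ := by
  refine Integrable.of_bound (Real.measurable_exp.comp
    ((hΦ.continuous.measurable.comp hg).const_mul s)).aestronglyMeasurable
    (Real.exp (|s| * (|Φ 0| + K))) (Filter.Eventually.of_forall fun x => ?_)
  have h := hΦ.dist_le_mul (g x) 0
  simp only [NNReal.coe_one, one_mul, dist_zero_right, Real.dist_eq] at h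
  have h2 := abs_sub_abs_le_abs_sub (Φ (g x)) (Φ 0)
  rw [Real.norm_eq_abs, Real.abs_exp]
  apply Real.exp_le_exp.2
  calc s * Φ (g x) ≤ |s * Φ (g x)| := le_abs_self _
    _ = |s| * |Φ (g x)| := abs_mul _ _
    _ ≤ _ := by gcongr; linarith [hK x]

omit [CompleteSpace V] [MeasurableSpace V] [BorelSpace V] [SecondCountableTopology V]
  [MeasurableSpace X] [NormedSpace ℝ V] in
lemma norm_sum_shift_le (hM : ∀ x, ‖f x‖ ≤ M) {n : ℕ} (A v : V) (x : Fin n → X) :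
    ‖A + ∑ i, (v - f (x i))‖ ≤ ‖A‖ + n * (‖v‖ + M) := by
  refine (norm_add_le _ _).trans ?_
  gcongr
  refine (norm_sum_le _ _).trans ?_
  calc _ ≤ ∑ _i : Fin n, (‖v‖ + M) := by
        gcongr with i
        exact (norm_sub_le _ _).trans (by gcongr; exact hM _)
    _ = _ := by simp [mul_add]

omit [CompleteSpace V] in
/-- The moment generating function in McDiarmid's inequality. -/
lemma integral_exp_pi_le (hΦ : LipschitzWith 1 Φ) (hf : Measurable f) (hM : ∀ x, ‖f x‖ ≤ M)
    (n : ℕ) (A : V) (s : ℝ) :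
    ∫ x : Fin n → X, Real.exp (s * Φ (A + ∑ i, ((∫ x', f x' ∂ρ) - f (x i))))
        ∂(Measure.pi fun _ => ρ)
      ≤ Real.exp (s * (centredAvg ρ f)^[n] Φ A + n * M ^ 2 * s ^ 2 / 2) := by
  induction n generalizing A with
  | zero => simp
  | succ n ih =>
    set v := ∫ x', f x' ∂ρ
    -- The first variable is split off. The induction hypothesis handles the others at the shifted
    -- base point `A + (v - f x)`, and Hoeffding's lemma is then applied to the iterated average as
    -- a Lipschitz function.
    have hmp := (measurePreserving_piFinSuccAbove (fun _ : Fin (n + 1) => ρ) 0).symm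
    rw [← hmp.integral_comp']
    have hint : Integrable (fun p : X × (Fin n → X) =>
        Real.exp (s * Φ (A + (v - f p.1) + ∑ i, (v - f (p.2 i)))))
        (ρ.prod (Measure.pi fun _ => ρ)) := by
      refine integrable_exp_lipschitz_comp hΦ (by fun_prop)
        (K := (‖A‖ + (‖v‖ + M)) + n * (‖v‖ + M)) (fun p => ?_) s
      refine (norm_sum_shift_le hM _ v p.2).trans ?_
      gcongr
      exact norm_shift_le hM A v p.1
    have e : ∀ p : X × (Fin n → X),
        Real.exp (s * Φ (A + ∑ i, (v - f ((MeasurableEquiv.piFinSuccAbove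
          (fun _ : Fin (n + 1) => X) 0).symm p i))))
        = Real.exp (s * Φ (A + (v - f p.1) + ∑ i, (v - f (p.2 i)))) := by
      intro p
      rw [Fin.sum_univ_succ, ← add_assoc]
      simp [MeasurableEquiv.piFinSuccAbove]
    simp_rw [e]
    change ∫ p : X × (Fin n → X), _ ∂(ρ.prod (Measure.pi fun _ => ρ)) ≤ _
    rw [integral_prod _ hint]
    have hL := lipschitz_centredAvg_iterate (ρ := ρ) hΦ hf hM n
    calc _ ≤ ∫ x, Real.exp (s * (centredAvg ρ f)^[n] Φ (A + (v - f x)))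
              * Real.exp (n * M ^ 2 * s ^ 2 / 2) ∂ρ := by
          refine integral_mono hint.integral_prod_left
            ((integrable_exp_lipschitz_comp hL (by fun_prop) (norm_shift_le hM A v) s).mul_const _)
            fun x => ?_
          rw [← Real.exp_add]
          exact ih (A + (v - f x))
      _ ≤ Real.exp (s * centredAvg ρ f ((centredAvg ρ f)^[n] Φ) A + M ^ 2 * s ^ 2 / 2)
            * Real.exp (n * M ^ 2 * s ^ 2 / 2) := by
          rw [integral_mul_const]
          gcongr
          exact integral_exp_lipschitz_le hL hf hM A s
      _ = _ := by
          rw [← Real.exp_add, Function.iterate_succ_apply']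
          congr 1
          push_cast
          ring

omit [CompleteSpace V] in
/-- McDiarmid's inequality for a Lipschitz function of a sum of bounded random vectors. -/
lemma measure_lipschitz_ge_le (hΦ : LipschitzWith 1 Φ) (hf : Measurable f) (hM : ∀ x, ‖f x‖ ≤ M)
    {n : ℕ} {C s : ℝ} (hC : (centredAvg ρ f)^[n] Φ 0 ≤ C) (hs : 0 ≤ s) :
    (Measure.pi fun _ : Fin n => ρ).real
        {x | C + s ≤ Φ (∑ i, ((∫ x', f x' ∂ρ) - f (x i)))}
      ≤ Real.exp (-s ^ 2 / (2 * (n * M ^ 2))) := by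
  set v := ∫ x', f x' ∂ρ
  set W := (centredAvg ρ f)^[n] Φ 0
  have h : ProbabilityTheory.HasSubgaussianMGF
      (fun x : Fin n → X => Φ (∑ i, (v - f (x i))) - W) (n * ‖M‖₊ ^ 2)
      (Measure.pi fun _ : Fin n => ρ) := by
    have e : ∀ (t : ℝ) (x : Fin n → X), Real.exp (t * (Φ (∑ i, (v - f (x i))) - W))
        = Real.exp (t * Φ (0 + ∑ i, (v - f (x i)))) * Real.exp (-(t * W)) := by
      intro t x
      rw [← Real.exp_add, zero_add]
      congr 1; ring
    constructor
    · intro t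
      simp_rw [e]
      exact (integrable_exp_lipschitz_comp hΦ (by fun_prop)
        (norm_sum_shift_le hM 0 v) t).mul_const _
    · intro t
      rw [ProbabilityTheory.mgf]
      simp_rw [e]
      rw [integral_mul_const]
      have := integral_exp_pi_le (ρ := ρ) hΦ hf hM n 0 t
      calc _ ≤ Real.exp (t * W + n * M ^ 2 * t ^ 2 / 2) * Real.exp (-(t * W)) := by gcongr
        _ = _ := by
          rw [← Real.exp_add]
          congr 1
          simp
  have h2 := h.measure_ge_le hs
  have e3 : ((n * ‖M‖₊ ^ 2 : NNReal) : ℝ) = n * M ^ 2 := by simp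
  rw [e3] at h2
  refine (measureReal_mono ?_).trans h2
  intro x hx
  simp only [Set.mem_ofPred_eq] at hx ⊢
  linarith

end Concentration

/-! ### Uniform deviations for finite families of functions -/

section vecSup

variable {ι : Type*} [Fintype ι] [Nonempty ι]

lemma lipschitz_vecSup : LipschitzWith 1 (vecSup : (ι → ℝ) → ℝ) := by
  have key : ∀ A B : ι → ℝ, vecSup A ≤ vecSup B + dist A B := by
    intro A B
    refine vecSup_le fun t => ?_
    have h1 := le_vecSup B t
    have h2 := dist_le_pi_dist A B t
    rw [Real.dist_eq] at h2
    linarith [le_abs_self (A t - B t)]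
  refine LipschitzWith.of_dist_le_mul fun A B => ?_
  simp only [NNReal.coe_one, one_mul]
  rw [Real.dist_eq, abs_le]
  constructor
  · have := key B A
    rw [dist_comm] at this
    linarith
  · linarith [key A B]

lemma convexOn_vecSup : ConvexOn ℝ Set.univ (vecSup : (ι → ℝ) → ℝ) := by
  refine ⟨convex_univ, fun A _ B _ a b ha hb _ => vecSup_le fun t => ?_⟩
  simp only [Pi.add_apply, Pi.smul_apply, smul_eq_mul]
  gcongr <;> exact le_vecSup _ t

/-- One-sided uniform deviation inequality for a finite family of bounded functions. -/
lemma measure_finite_deviation_le {X : Type*} [MeasurableSpace X] {ρ : Measure X}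
    [IsProbabilityMeasure ρ] {f : X → ι → ℝ} (hf : Measurable f) {M : ℝ} (hM : ∀ x t, |f x t| ≤ M)
    {n : ℕ} {C s : ℝ} (hs : 0 ≤ s)
    (hC : ∀ l : List (ι → ℝ), l.length = n → (∀ h ∈ l, ∃ x x', h = f x - f x') →
      signAvg vecSup l 0 ≤ C) :
    (Measure.pi fun _ : Fin n => ρ).real
        {x | ∃ t, C + s ≤ ∑ i, ((∫ x', f x' t ∂ρ) - f (x i) t)}
      ≤ Real.exp (-s ^ 2 / (2 * (n * M ^ 2))) := by
  have hM' : ∀ x, ‖f x‖ ≤ M := by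
    intro x
    have hM0 : 0 ≤ M := (abs_nonneg _).trans (hM x (Classical.arbitrary ι))
    exact (pi_norm_le_iff_of_nonneg hM0).2 fun t => hM x t
  have h := measure_lipschitz_ge_le (ρ := ρ) lipschitz_vecSup hf hM'
    (centredAvg_iterate_le (ρ := ρ) hf hM' n lipschitz_vecSup convexOn_vecSup hC) hs
  refine (measureReal_mono ?_).trans h
  rintro x ⟨t, ht⟩
  refine ht.trans ?_
  have h1 := le_vecSup (∑ i, ((∫ x', f x' ∂ρ) - f (x i))) t
  have h2 : (∫ x', f x' ∂ρ) t = ∫ x', f x' t ∂ρ :=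
    eval_integral (fun i => (integrable_of_norm_le hf hM').eval i) t
  simpa [Finset.sum_apply, h2] using h1

end vecSup

/-! ### The softplus function -/

lemma hasDerivAt_softplus {τ : ℝ} (hτ : 0 < τ) (z : ℝ) :
    HasDerivAt (softplus τ) (Real.sigmoid (τ * z)) z := by
  have h1 : HasDerivAt (fun z => 1 + Real.exp (τ * z)) (Real.exp (τ * z) * (τ * 1)) z :=
    (((hasDerivAt_id z).const_mul τ).exp).const_add 1
  have h2 := (h1.log (by positivity)).const_mul (1 / τ)
  refine h2.congr_deriv ?_
  rw [Real.sigmoid_def, Real.exp_neg]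
  have := Real.exp_pos (τ * z)
  field_simp
  ring

lemma continuous_softplus {τ : ℝ} (hτ : 0 < τ) : Continuous (softplus τ) :=
  continuous_iff_continuousAt.2 fun z => (hasDerivAt_softplus hτ z).continuousAt

/-- Two neurons of opposite directions thus reproduce a linear function exactly, which accounts for
the affine part of Taylor's formula without error. The identity also yields the comparison of
softplus with the positive part. -/
lemma softplus_sub_softplus_neg {τ : ℝ} (hτ : 0 < τ) (z : ℝ) :
    softplus τ z - softplus τ (-z) = z := by
  have h : 1 + Real.exp (τ * z) = Real.exp (τ * z) * (1 + Real.exp (τ * -z)) := by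
    rw [mul_add, ← Real.exp_add]; simp; ring
  simp only [softplus, h]
  rw [Real.log_mul (by positivity) (by positivity), Real.log_exp]
  field_simp
  ring

lemma softplus_nonneg {τ : ℝ} (hτ : 0 < τ) (z : ℝ) : 0 ≤ softplus τ z := by
  have : 0 ≤ Real.log (1 + Real.exp (τ * z)) := Real.log_nonneg (by linarith [Real.exp_pos (τ * z)])
  unfold softplus
  positivity

lemma le_softplus {τ : ℝ} (hτ : 0 < τ) (z : ℝ) : z ≤ softplus τ z := by
  have h1 := softplus_sub_softplus_neg hτ z
  have h2 := softplus_nonneg hτ (-z)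
  linarith

lemma softplus_zero (τ : ℝ) : softplus τ 0 = Real.log 2 / τ := by
  simp only [softplus, mul_zero, Real.exp_zero]
  norm_num
  ring

lemma softplus_mono {τ : ℝ} (hτ : 0 < τ) : Monotone (softplus τ) :=
  monotone_of_deriv_nonneg (fun z => (hasDerivAt_softplus hτ z).differentiableAt) fun z => by
    rw [(hasDerivAt_softplus hτ z).deriv]; exact Real.sigmoid_nonneg _

lemma softplus_le {τ : ℝ} (hτ : 0 < τ) (z : ℝ) : softplus τ z ≤ max z 0 + Real.log 2 / τ := by
  rw [← softplus_zero]
  rcases le_total z 0 with h | h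
  · rw [max_eq_right h, zero_add]
    exact softplus_mono hτ h
  · rw [max_eq_left h]
    have h1 := softplus_sub_softplus_neg hτ z
    have h2 : softplus τ (-z) ≤ softplus τ 0 := softplus_mono hτ (by linarith)
    linarith

lemma abs_softplus_le_three {τ : ℝ} (hτ : 1 ≤ τ) {z : ℝ} (hz : |z| ≤ 2) : |softplus τ z| ≤ 3 := by
  have hτ' : 0 < τ := by linarith
  rw [abs_of_nonneg (softplus_nonneg hτ' z)]
  have h1 := softplus_le hτ' z
  have h2 : max z 0 ≤ 2 := max_le (abs_le.1 hz).2 (by norm_num)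
  have h3 : Real.log 2 / τ ≤ 1 := by
    rw [div_le_one hτ']
    linarith [Real.log_two_lt_d9]
  linarith

lemma abs_softplus_sub_le {τ : ℝ} (hτ : 0 < τ) (p q : ℝ) :
    |softplus τ p - softplus τ q| ≤ |p - q| := by
  have := convex_univ.norm_image_sub_le_of_norm_hasDerivWithin_le (f := softplus τ)
    (f' := fun z => Real.sigmoid (τ * z)) (C := 1) (x := q) (y := p)
    (fun z _ => (hasDerivAt_softplus hτ z).hasDerivWithinAt) (fun z _ => by
      rw [Real.norm_eq_abs, abs_of_nonneg (Real.sigmoid_nonneg _)]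
      exact Real.sigmoid_le_one _) (Set.mem_univ _) (Set.mem_univ _)
  simpa using this

lemma abs_sigmoid_sub_le (p q : ℝ) : |Real.sigmoid p - Real.sigmoid q| ≤ |p - q| := by
  have := convex_univ.norm_image_sub_le_of_norm_hasDerivWithin_le (f := Real.sigmoid)
    (f' := fun z => Real.sigmoid z * (1 - Real.sigmoid z)) (C := 1) (x := q) (y := p)
    (fun z _ => (Real.hasDerivAt_sigmoid z).hasDerivWithinAt) (fun z _ => by
      have h1 := Real.sigmoid_nonneg z
      have h2 := Real.sigmoid_le_one z
      rw [Real.norm_eq_abs, abs_of_nonneg (by nlinarith)]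
      nlinarith) (Set.mem_univ _) (Set.mem_univ _)
  simpa using this

lemma abs_sigmoid_le_one (z : ℝ) : |Real.sigmoid z| ≤ 1 := by
  rw [abs_of_nonneg (Real.sigmoid_nonneg _)]; exact Real.sigmoid_le_one _

/-! ### The `ℓ¹` norm -/

section l1Norm

variable {d : ℕ}

lemma l1Norm_nonneg (w : EuclideanSpace ℝ (Fin d)) : 0 ≤ l1Norm w :=
  Finset.sum_nonneg fun _ _ => abs_nonneg _

lemma abs_apply_le_l1Norm (w : EuclideanSpace ℝ (Fin d)) (i : Fin d) : |w i| ≤ l1Norm w :=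
  Finset.single_le_sum (f := fun i => |w i|) (fun _ _ => abs_nonneg _) (Finset.mem_univ i)

lemma norm_le_l1Norm (w : EuclideanSpace ℝ (Fin d)) : ‖w‖ ≤ l1Norm w := by
  rw [EuclideanSpace.norm_eq]
  apply Real.sqrt_le_iff.2
  refine ⟨l1Norm_nonneg w, ?_⟩
  rw [sq, l1Norm, Finset.sum_mul]
  refine Finset.sum_le_sum fun i _ => ?_
  rw [Real.norm_eq_abs, sq]
  gcongr
  exact abs_apply_le_l1Norm w i

lemma abs_inner_le_l1Norm (w : EuclideanSpace ℝ (Fin d)) {x : EuclideanSpace ℝ (Fin d)}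
    (hx : ∀ i, |x i| ≤ 1) : |inner ℝ w x| ≤ l1Norm w := by
  rw [PiLp.inner_apply]
  refine (Finset.abs_sum_le_sum_abs _ _).trans (Finset.sum_le_sum fun i _ => ?_)
  simp only [RCLike.inner_apply, conj_trivial, abs_mul]
  calc |x i| * |w i| ≤ 1 * |w i| := by gcongr; exact hx i
    _ = |w i| := one_mul _

lemma continuous_l1Norm : Continuous (l1Norm : EuclideanSpace ℝ (Fin d) → ℝ) := by
  unfold l1Norm
  fun_prop

end l1Norm

/-! ### Two-layer networks -/

section Nets

variable {d m : ℕ}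

/-- Parameters `(c, a, w, b)` of a two-layer network of width `m`. -/
abbrev NetParam (d m : ℕ) : Type :=
  ℝ × (Fin m → ℝ) × (Fin m → EuclideanSpace ℝ (Fin d)) × (Fin m → ℝ)

/-- The admissible parameters. -/
def netParams (d m : ℕ) (B : ℝ) : Set (NetParam d m) :=
  {p | |p.1| ≤ 2 * B ∧
    ∀ k, |p.2.1 k| ≤ 16 * B ∧ l1Norm (p.2.2.1 k) = 1 ∧ |p.2.2.2 k| ≤ 1}

/-- The softplus network with the given parameters. -/
def net (τ : ℝ) (p : NetParam d m) (x : EuclideanSpace ℝ (Fin d)) : ℝ :=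
  p.1 + 1 / (m : ℝ) * ∑ k, p.2.1 k * softplus τ (inner ℝ (p.2.2.1 k) x + p.2.2.2 k)

/-- The gradient of the softplus network with the given parameters. -/
def netGrad (τ : ℝ) (p : NetParam d m) (x : EuclideanSpace ℝ (Fin d)) :
    EuclideanSpace ℝ (Fin d) :=
  (1 / (m : ℝ)) • ∑ k, (p.2.1 k * Real.sigmoid (τ * (inner ℝ (p.2.2.1 k) x + p.2.2.2 k))) •
    p.2.2.1 k

lemma mem_twoLayerNets_iff {τ B : ℝ} {φ : EuclideanSpace ℝ (Fin d) → ℝ} :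
    φ ∈ twoLayerNets d (softplus τ) m B ↔ ∃ p ∈ netParams d m B, φ = net τ p := by
  constructor
  · rintro ⟨c, a, w, b, hc, hk, rfl⟩
    exact ⟨(c, a, w, b), ⟨hc, hk⟩, rfl⟩
  · rintro ⟨⟨c, a, w, b⟩, ⟨hc, hk⟩, rfl⟩
    exact ⟨c, a, w, b, hc, hk, rfl⟩

lemma hasGradientAt_net {τ : ℝ} (hτ : 0 < τ) (p : NetParam d m) (x : EuclideanSpace ℝ (Fin d)) :
    HasGradientAt (net τ p) (netGrad τ p x) x := by
  rw [hasGradientAt_iff_hasFDerivAt]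
  have h1 : ∀ k, HasFDerivAt (fun x => inner ℝ (p.2.2.1 k) x + p.2.2.2 k)
      (innerSL ℝ (p.2.2.1 k)) x := fun k =>
    ((innerSL ℝ (p.2.2.1 k)).hasFDerivAt (x := x)).add_const _
  have h2 : ∀ k, HasFDerivAt
      (fun x => p.2.1 k * softplus τ (inner ℝ (p.2.2.1 k) x + p.2.2.2 k)) _ x := fun k =>
    ((hasDerivAt_softplus hτ _).comp_hasFDerivAt x (h1 k)).const_mul (p.2.1 k)
  have h3 := ((HasFDerivAt.fun_sum (u := Finset.univ) fun k _ => h2 k).const_mul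
    (1 / (m : ℝ))).const_add p.1
  refine h3.congr_fderiv ?_
  ext v
  simp [netGrad, mul_assoc]

lemma gradient_net {τ : ℝ} (hτ : 0 < τ) (p : NetParam d m) (x : EuclideanSpace ℝ (Fin d)) :
    gradient (net τ p) x = netGrad τ p x :=
  (hasGradientAt_net hτ p x).gradient

lemma continuous_net {τ : ℝ} (hτ : 0 < τ) :
    Continuous fun q : NetParam d m × EuclideanSpace ℝ (Fin d) => net τ q.1 q.2 := by
  have := continuous_softplus hτ
  unfold net
  fun_prop

lemma continuous_netGrad (τ : ℝ) :
    Continuous fun q : NetParam d m × EuclideanSpace ℝ (Fin d) => netGrad τ q.1 q.2 := by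
  have := continuous_sigmoid
  unfold netGrad
  fun_prop

variable {τ B : ℝ} {p : NetParam d m} {x : EuclideanSpace ℝ (Fin d)}

lemma abs_preactivation_le {w : EuclideanSpace ℝ (Fin d)} {b : ℝ} (hw : l1Norm w = 1)
    (hb : |b| ≤ 1) (hx : ∀ i, |x i| ≤ 1) : |inner ℝ w x + b| ≤ 2 := by
  have := abs_inner_le_l1Norm w hx
  have := abs_add_le (inner ℝ w x) b
  linarith

lemma one_div_mul_sum_le (hm : 0 < m) {g : Fin m → ℝ} {K : ℝ} (hg : ∀ k, g k ≤ K) :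
    1 / (m : ℝ) * ∑ k, g k ≤ K := by
  have hm' : (0 : ℝ) < m := by exact_mod_cast hm
  rw [one_div, inv_mul_le_iff₀ hm']
  calc _ ≤ ∑ _k : Fin m, K := Finset.sum_le_sum fun k _ => hg k
    _ = _ := by simp

/-- The constant is `50 = 2 + 16 * 3`: the offset, plus outer weights times the bound of softplus on
preactivations in `[-2, 2]`. -/
lemma abs_net_le (hm : 0 < m) (hτ : 1 ≤ τ) (hp : p ∈ netParams d m B) (hx : ∀ i, |x i| ≤ 1) :
    |net τ p x| ≤ 50 * B := by
  have hB : 0 ≤ B := by linarith [(abs_nonneg _).trans hp.1]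
  have h : |1 / (m : ℝ) * ∑ k, p.2.1 k * softplus τ (inner ℝ (p.2.2.1 k) x + p.2.2.2 k)|
      ≤ 16 * B * 3 := by
    rw [abs_mul, abs_of_nonneg (by positivity : (0 : ℝ) ≤ 1 / m)]
    refine (mul_le_mul_of_nonneg_left (Finset.abs_sum_le_sum_abs _ _) (by positivity)).trans ?_
    refine one_div_mul_sum_le hm fun k => ?_
    rw [abs_mul]
    obtain ⟨h1, h2, h3⟩ := hp.2 k
    gcongr
    exact abs_softplus_le_three hτ (abs_preactivation_le h2 h3 hx)
  have := abs_add_le p.1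
    (1 / (m : ℝ) * ∑ k, p.2.1 k * softplus τ (inner ℝ (p.2.2.1 k) x + p.2.2.2 k))
  unfold net
  linarith [hp.1]

lemma norm_netGrad_le (hm : 0 < m) (hp : p ∈ netParams d m B) : ‖netGrad τ p x‖ ≤ 16 * B := by
  have hB : 0 ≤ B := by linarith [(abs_nonneg _).trans hp.1]
  rw [netGrad, norm_smul, Real.norm_of_nonneg (by positivity : (0 : ℝ) ≤ 1 / m)]
  refine (mul_le_mul_of_nonneg_left (norm_sum_le _ _) (by positivity)).trans ?_
  refine one_div_mul_sum_le hm fun k => ?_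
  obtain ⟨h1, h2, h3⟩ := hp.2 k
  rw [norm_smul, norm_mul, Real.norm_eq_abs, Real.norm_eq_abs]
  have h4 := norm_le_l1Norm (p.2.2.1 k)
  rw [h2] at h4
  calc _ ≤ 16 * B * 1 * 1 := by
        gcongr
        exact abs_sigmoid_le_one _
    _ = _ := by ring

/-- The integrand of the loss at a network. -/
def netLoss (τ : ℝ) (y : EuclideanSpace ℝ (Fin d) → ℝ) (p : NetParam d m)
    (x : EuclideanSpace ℝ (Fin d)) : ℝ :=
  net τ p x ^ 2 - 2 * net τ p x * y x + ‖netGrad τ p x‖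

/-- A bound for the integrand of the loss. -/
def lossBound (B Y : ℝ) : ℝ := (50 * B) ^ 2 + 2 * (50 * B) * Y + 16 * B

lemma abs_netLoss_le {y : EuclideanSpace ℝ (Fin d) → ℝ} {Y : ℝ} (hm : 0 < m) (hτ : 1 ≤ τ)
    (hp : p ∈ netParams d m B) (hx : ∀ i, |x i| ≤ 1) (hy : |y x| ≤ Y) :
    |netLoss τ y p x| ≤ lossBound B Y := by
  have h1 := abs_net_le hm hτ hp hx
  have h2 := norm_netGrad_le (τ := τ) (x := x) hm hp
  have h3 := norm_nonneg (netGrad τ p x)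
  unfold netLoss lossBound
  have h4 : |net τ p x ^ 2| ≤ (50 * B) ^ 2 := by rw [abs_pow]; gcongr
  have h5 : |2 * net τ p x * y x| ≤ 2 * (50 * B) * Y := by
    rw [abs_mul, abs_mul, abs_two]
    have := (abs_nonneg _).trans h1
    gcongr
  rw [abs_le] at *
  constructor <;> linarith

/-- The coordinates of a network in which the loss is Lipschitz: its value and the components of
its gradient. -/
def netCoord (τ : ℝ) (p : NetParam d m) (q : EuclideanSpace ℝ (Fin d) × Option (Fin d)) : ℝ :=
  match q.2 with
  | none => net τ p q.1
  | some j => netGrad τ p q.1 j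

/-- The difference of the quadratic parts factors, with one factor at most `50 B + 50 B + 2 Y`. The
Euclidean norm is 1-Lipschitz for the `ℓ¹` norm, which adds the `1`. The factor is kept inside the
absolute values to match the form required by contraction. -/
lemma abs_netLoss_sub_le {y : EuclideanSpace ℝ (Fin d) → ℝ} {Y : ℝ} (hm : 0 < m) (hτ : 1 ≤ τ)
    {p' : NetParam d m} (hp : p ∈ netParams d m B) (hp' : p' ∈ netParams d m B)
    (hx : ∀ i, |x i| ≤ 1) (hy : |y x| ≤ Y) :
    |netLoss τ y p x - netLoss τ y p' x|
      ≤ ∑ e, |(100 * B + 2 * Y + 1) * netCoord τ p (x, e)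
        - (100 * B + 2 * Y + 1) * netCoord τ p' (x, e)| := by
  have hB : 0 ≤ B := by linarith [(abs_nonneg _).trans hp.1]
  have hY : 0 ≤ Y := (abs_nonneg _).trans hy
  have h1 := abs_net_le hm hτ hp hx
  have h2 := abs_net_le hm hτ hp' hx
  have e : ∀ e : Option (Fin d), |(100 * B + 2 * Y + 1) * netCoord τ p (x, e)
        - (100 * B + 2 * Y + 1) * netCoord τ p' (x, e)|
      = (100 * B + 2 * Y + 1) * |netCoord τ p (x, e) - netCoord τ p' (x, e)| := fun e => by
    rw [← mul_sub, abs_mul, abs_of_nonneg (by positivity)]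
  simp_rw [e]
  rw [← Finset.mul_sum, Fintype.sum_option]
  simp only [netCoord]
  have h3 : |(net τ p x ^ 2 - 2 * net τ p x * y x) - (net τ p' x ^ 2 - 2 * net τ p' x * y x)|
      ≤ (100 * B + 2 * Y) * |net τ p x - net τ p' x| := by
    rw [show (net τ p x ^ 2 - 2 * net τ p x * y x) - (net τ p' x ^ 2 - 2 * net τ p' x * y x)
      = (net τ p x + net τ p' x - 2 * y x) * (net τ p x - net τ p' x) by ring, abs_mul]
    gcongr
    rw [abs_le] at *
    constructor <;> linarith
  have h4 : |‖netGrad τ p x‖ - ‖netGrad τ p' x‖| ≤ ∑ j, |netGrad τ p x j - netGrad τ p' x j| := by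
    refine (abs_norm_sub_norm_le _ _).trans ((norm_le_l1Norm _).trans ?_)
    simp [l1Norm]
  have h5 : 0 ≤ ∑ j, |netGrad τ p x j - netGrad τ p' x j| :=
    Finset.sum_nonneg fun _ _ => abs_nonneg _
  have h6 := abs_nonneg (net τ p x - net τ p' x)
  unfold netLoss
  have h7 := abs_add_le
    ((net τ p x ^ 2 - 2 * net τ p x * y x) - (net τ p' x ^ 2 - 2 * net τ p' x * y x))
    (‖netGrad τ p x‖ - ‖netGrad τ p' x‖)
  rw [show (net τ p x ^ 2 - 2 * net τ p x * y x) - (net τ p' x ^ 2 - 2 * net τ p' x * y x)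
    + (‖netGrad τ p x‖ - ‖netGrad τ p' x‖) = net τ p x ^ 2 - 2 * net τ p x * y x + ‖netGrad τ p x‖
    - (net τ p' x ^ 2 - 2 * net τ p' x * y x + ‖netGrad τ p' x‖) by ring] at h7
  have h8 : 0 ≤ (100 * B + 2 * Y) * ∑ j, |netGrad τ p x j - netGrad τ p' x j| := by positivity
  linarith

/-- The contribution of a single neuron to the coordinates of a network. -/
def neuronCoord (τ : ℝ) (w : EuclideanSpace ℝ (Fin d)) (b : ℝ)
    (q : EuclideanSpace ℝ (Fin d) × Option (Fin d)) : ℝ :=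
  match q.2 with
  | none => softplus τ (inner ℝ w q.1 + b)
  | some j => Real.sigmoid (τ * (inner ℝ w q.1 + b)) * w j

lemma netCoord_eq (τ : ℝ) (p : NetParam d m) (q : EuclideanSpace ℝ (Fin d) × Option (Fin d)) :
    netCoord τ p q = (if q.2 = none then 1 else 0) * p.1
      + 1 / (m : ℝ) * ∑ k, p.2.1 k * neuronCoord τ (p.2.2.1 k) (p.2.2.2 k) q := by
  obtain ⟨x, _ | j⟩ := q
  · simp [netCoord, neuronCoord, net]
  · simp [netCoord, neuronCoord, netGrad, mul_assoc]

/-- The product is telescoped, one factor changing at a time. Softplus is bounded by `3` and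
1-Lipschitz; the sigmoid is bounded by `1` and its argument is scaled by `τ`. The common constant `3
* τ` covers all of these because `τ ≥ 1`. -/
lemma abs_sign_mul_neuronCoord_sub_le {w w' : EuclideanSpace ℝ (Fin d)} {b b' s s' : ℝ}
    (hτ : 1 ≤ τ) (hw : l1Norm w = 1) (hw' : l1Norm w' = 1) (hb' : |b'| ≤ 1)
    (hs : |s| = 1) (q : EuclideanSpace ℝ (Fin d) × Option (Fin d)) (hx : ∀ i, |q.1 i| ≤ 1) :
    |s * neuronCoord τ w b q - s' * neuronCoord τ w' b' q|
      ≤ 3 * τ * |s - s'| + 3 * τ * |(inner ℝ w q.1 + b) - (inner ℝ w' q.1 + b')|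
        + 3 * τ * |(q.2.elim 0 fun j => w j) - q.2.elim 0 fun j => w' j| := by
  have hτ' : 0 < τ := by linarith
  obtain ⟨x, _ | j⟩ := q
  · simp only [neuronCoord, Option.elim_none, sub_self, abs_zero, mul_zero, add_zero]
    set z := inner ℝ w x + b
    set z' := inner ℝ w' x + b'
    have h1 : |softplus τ z'| ≤ 3 := abs_softplus_le_three hτ (abs_preactivation_le hw' hb' hx)
    have h2 := abs_softplus_sub_le hτ' z z'
    calc |s * softplus τ z - s' * softplus τ z'|
        = |s * (softplus τ z - softplus τ z') + (s - s') * softplus τ z'| := by ring_nf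
      _ ≤ |s| * |softplus τ z - softplus τ z'| + |s - s'| * |softplus τ z'| := by
          rw [← abs_mul, ← abs_mul]; exact abs_add_le _ _
      _ ≤ 1 * |z - z'| + |s - s'| * 3 := by rw [hs]; gcongr
      _ ≤ _ := by
          have := abs_nonneg (z - z')
          have := abs_nonneg (s - s')
          nlinarith
  · simp only [neuronCoord, Option.elim_some]
    set z := inner ℝ w x + b
    set z' := inner ℝ w' x + b'
    have h1 : |w j| ≤ 1 := hw ▸ abs_apply_le_l1Norm w j
    have h1' : |w' j| ≤ 1 := hw' ▸ abs_apply_le_l1Norm w' j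
    have h2 := abs_sigmoid_sub_le (τ * z) (τ * z')
    rw [← mul_sub, abs_mul, abs_of_pos hτ'] at h2
    calc |s * (Real.sigmoid (τ * z) * w j) - s' * (Real.sigmoid (τ * z') * w' j)|
        = |s * (Real.sigmoid (τ * z) * (w j - w' j))
          + s * ((Real.sigmoid (τ * z) - Real.sigmoid (τ * z')) * w' j)
          + (s - s') * (Real.sigmoid (τ * z') * w' j)| := by ring_nf
      _ ≤ |s| * (|Real.sigmoid (τ * z)| * |w j - w' j|)
          + |s| * (|Real.sigmoid (τ * z) - Real.sigmoid (τ * z')| * |w' j|)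
          + |s - s'| * (|Real.sigmoid (τ * z')| * |w' j|) := by
          simp only [← abs_mul]
          exact (abs_add_le _ _).trans (by gcongr; exact abs_add_le _ _)
      _ ≤ 1 * (1 * |w j - w' j|) + 1 * (τ * |z - z'| * 1) + |s - s'| * (1 * 1) := by
          rw [hs]
          gcongr <;> exact abs_sigmoid_le_one _
      _ ≤ _ := by
          have := abs_nonneg (z - z')
          have := abs_nonneg (s - s')
          have := abs_nonneg (w j - w' j)
          nlinarith [mul_nonneg hτ'.le (abs_nonneg (z - z'))]

end Nets

lemma List.exists_eq_map_of_forall {α β : Type*} {F : α → β} {P : α → Prop} (l : List β)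
    (h : ∀ b ∈ l, ∃ a, P a ∧ b = F a) : ∃ l' : List α, l = l'.map F ∧ ∀ a ∈ l', P a := by
  induction l with
  | nil => exact ⟨[], rfl, by simp⟩
  | cons b l ih =>
    obtain ⟨a, ha, rfl⟩ := h b (by simp)
    obtain ⟨l', rfl, hl'⟩ := ih fun b hb => h b (by simp [hb])
    exact ⟨a :: l', rfl, by simpa using ⟨ha, hl'⟩⟩

/-! ### Random sign averages of neurons, networks and losses -/

section Rademacher

variable {d m : ℕ} {τ B Y : ℝ}

lemma norm_coe_bool (s : Bool) : |if s then (1 : ℝ) else -1| = 1 := by cases s <;> simp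

/-- The random signs average for the coordinates of single neurons. -/
lemma signAvg_neuronCoord_le {ι : Type*} [Fintype ι] [Nonempty ι] (hτ : 1 ≤ τ)
    {w : ι → EuclideanSpace ℝ (Fin d)} {b : ι → ℝ} (hw : ∀ t, l1Norm (w t) = 1)
    (hb : ∀ t, |b t| ≤ 1) {Γ : ℝ} (hΓ : 0 ≤ Γ)
    (l : List (EuclideanSpace ℝ (Fin d) × Option (Fin d))) (hl : ∀ q ∈ l, ∀ i, |q.1 i| ≤ 1) :
    signAvg (vecSup (ι := ι × Bool))
      (l.map fun q t => (if t.2 then 1 else -1) * (Γ * neuronCoord τ (w t.1) (b t.1) q)) 0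
      ≤ (d + 2) * (9 * τ * Γ * √l.length) := by
  have hτ' : 0 < τ := by linarith
  -- The `d + 2` linear coordinates of a signed neuron: its sign, its bias and its `d` inner
  -- weights, each of modulus at most one.
  let z : ι × Bool → Option (Option (Fin d)) → ℝ := fun t i =>
    i.elim (if t.2 then 1 else -1) fun i => i.elim (b t.1) fun j => w t.1 j
  have hz : ∀ t i, |z t i| ≤ 1 := by
    rintro t (_ | _ | j)
    · exact (norm_coe_bool _).le
    · exact hb _
    · exact (abs_apply_le_l1Norm _ _).trans (hw _).le
  have hR : 0 ≤ 9 * τ * Γ := by positivity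
  let G : Set (ι × Bool → ℝ) :=
    {h | ∃ v : Option (Option (Fin d)) → ℝ, (∀ i, |v i| ≤ 9 * τ * Γ) ∧
      h = fun t => ∑ i, v i * z t i}
  let H : Set (ι × Bool → ℝ) :=
    {h | ∃ q : EuclideanSpace ℝ (Fin d) × Option (Fin d), (∀ i, |q.1 i| ≤ 1) ∧
      h = fun t => (if t.2 then 1 else -1) * (Γ * neuronCoord τ (w t.1) (b t.1) q)}
  refine signAvg_vecSup_le_of_lipschitz (Fin 3) (H := H) (G := G) (n := l.length) ?_ ?_ _
    (by simp) ?_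
  · rintro h ⟨q, hq, rfl⟩
    -- The Lipschitz coordinates are the sign, the preactivation and one inner weight, each linear
    -- in `z`. Contraction over three coordinates turns the constant `3 * τ * Γ` into `9 * τ * Γ`.
    refine ⟨![fun t => 3 * τ * Γ * (if t.2 then 1 else -1),
      fun t => 3 * τ * Γ * (inner ℝ (w t.1) q.1 + b t.1),
      fun t => 3 * τ * Γ * q.2.elim 0 fun j => w t.1 j], ?_, ?_⟩
    · intro j
      fin_cases j
      · refine ⟨fun i => i.elim (9 * τ * Γ) fun _ => 0, ?_, ?_⟩
        · rintro (_ | _)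
          · exact (abs_of_nonneg hR).le
          · simpa using hR
        · ext t
          simp [Fintype.sum_option, z]
          ring_nf
      -- The preactivation has coefficient one on the bias and `q.1 j` on the weights, so the
      -- coefficients are bounded because the point lies in the cube.
      · refine ⟨fun i => i.elim 0 fun i => i.elim (9 * τ * Γ) fun j => 9 * τ * Γ * q.1 j, ?_, ?_⟩
        · rintro (_ | _ | j)
          · simpa using hR
          · exact (abs_of_nonneg hR).le
          · simp only [Option.elim_some, abs_mul (9 * τ * Γ), abs_of_nonneg hR]
            exact mul_le_of_le_one_right hR (hq j)
        · ext t
          simp only [Fintype.card_fin, Nat.cast_ofNat, Fin.mk_one, Fin.isValue, Matrix.cons_val_one,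
            Matrix.cons_val_zero, Pi.smul_apply, smul_eq_mul, Fintype.sum_option, Option.elim_none,
            zero_mul, Option.elim_some, zero_add, z, PiLp.inner_apply, RCLike.inner_apply,
            conj_trivial, mul_assoc, ← Finset.mul_sum]
          ring
      · rcases q with ⟨x, _ | j⟩
        · refine ⟨fun _ => 0, by simpa using hR, ?_⟩
          ext t
          simp
        · refine ⟨fun i => i.elim 0 fun i => i.elim 0 fun k => if k = j then 9 * τ * Γ else 0,
            ?_, ?_⟩
          · rintro (_ | _ | k)
            · simpa using hR
            · simpa using hR
            · simp only [Option.elim_some]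
              split_ifs
              · exact (abs_of_nonneg hR).le
              · simpa using hR
          · ext t
            simp [Fintype.sum_option, z]
            ring
    · intro t s
      rw [Fin.sum_univ_three]
      simp only [Matrix.cons_val_zero, Matrix.cons_val_one, Matrix.cons_val_two, Matrix.head_cons,
        Matrix.tail_cons]
      have h := abs_sign_mul_neuronCoord_sub_le (τ := τ) (s' := if s.2 then (1 : ℝ) else -1)
        (b := b t.1) hτ (hw t.1) (hw s.1) (hb s.1) (norm_coe_bool t.2) q hq
      have e : ∀ u v : ℝ, |3 * τ * Γ * u - 3 * τ * Γ * v| = Γ * (3 * τ * |u - v|) := fun u v => by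
        rw [← mul_sub, abs_mul, abs_of_nonneg (by positivity)]; ring
      rw [e, e, e, ← mul_add, ← mul_add, mul_left_comm, mul_left_comm _ Γ, ← mul_sub, abs_mul,
        abs_of_nonneg hΓ]
      gcongr
  · intro l' hl' hG
    obtain ⟨l'', rfl, hv⟩ := List.exists_eq_map_of_forall l' hG
    have := signAvg_linear_zero_le hz hR l'' hv
    simp only [List.length_map] at hl'
    rw [hl'] at this
    refine this.trans (le_of_eq ?_)
    simp only [Fintype.card_option, Fintype.card_fin]
    push_cast
    ring
  · intro h hh
    obtain ⟨q, hq, rfl⟩ := List.mem_map.1 hh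
    exact ⟨q, hl q hq, rfl⟩

/-- The random signs average for the coordinates of networks. -/
lemma signAvg_netCoord_le {ι : Type*} [Fintype ι] [Nonempty ι] (hm : 0 < m) (hτ : 1 ≤ τ)
    {θ : ι → NetParam d m} (hθ : ∀ t, θ t ∈ netParams d m B) {Γ : ℝ} (hΓ : 0 ≤ Γ)
    (l : List (EuclideanSpace ℝ (Fin d) × Option (Fin d))) (hl : ∀ q ∈ l, ∀ i, |q.1 i| ≤ 1) :
    signAvg vecSup (l.map fun q t => Γ * netCoord τ (θ t) q) 0
      ≤ (2 * B + 144 * B * (d + 2)) * Γ * (τ * √l.length) := by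
  have : Nonempty (Fin m) := ⟨⟨0, hm⟩⟩
  have hB : 0 ≤ B := by linarith [(abs_nonneg _).trans (hθ (Classical.arbitrary ι)).1]
  -- The offset of a network enters its value but not its gradient, hence the case distinction in
  -- the first component.
  let F : EuclideanSpace ℝ (Fin d) × Option (Fin d) → ℝ × (ι → Fin m → ℝ) := fun q =>
    (if q.2 = none then Γ else 0,
      fun t k => Γ * neuronCoord τ ((θ t).2.2.1 k) ((θ t).2.2.2 k) q)
  have h := signAvg_combination_le hm (fun t => (hθ t).1) (fun t k => ((hθ t).2 k).1) (l.map F) 0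
  have h2 := signAvg_neuronCoord_le (ι := ι × Fin m) (w := fun t => (θ t.1).2.2.1 t.2)
    (b := fun t => (θ t.1).2.2.2 t.2) hτ (fun t => ((hθ _).2 _).2.1) (fun t => ((hθ _).2 _).2.2)
    hΓ l hl
  rw [List.map_map, List.map_map, List.map_map] at h
  have e1 : (fun t => (0 : ℝ × (ι → Fin m → ℝ)).1 * (θ t).1
      + 1 / (m : ℝ) * ∑ k, (θ t).2.1 k * (0 : ℝ × (ι → Fin m → ℝ)).2 t k) = 0 := by
    ext; simp
  have e2 : (fun t : (ι × Fin m) × Bool => (if t.2 then (1 : ℝ) else -1)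
      * (0 : ℝ × (ι → Fin m → ℝ)).2 t.1.1 t.1.2) = 0 := by
    ext; simp
  rw [e1, e2] at h
  have e3 : (fun q t => Γ * netCoord τ (θ t) q) = (fun (q : ℝ × (ι → Fin m → ℝ)) t =>
      q.1 * (θ t).1 + 1 / (m : ℝ) * ∑ k, (θ t).2.1 k * q.2 t k) ∘ F := by
    ext q t
    simp only [Function.comp, F, netCoord_eq]
    rw [mul_add, Finset.mul_sum, Finset.mul_sum, Finset.mul_sum]
    congr 1
    · split_ifs <;> ring
    · exact Finset.sum_congr rfl fun k _ => by ring
  rw [e3]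
  refine h.trans ?_
  have h3 : √((0 : ℝ × (ι → Fin m → ℝ)).1 ^ 2 + (l.map ((fun q => q.1 ^ 2) ∘ F)).sum)
      ≤ Γ * √l.length := by
    rw [← Real.sqrt_sq hΓ, ← Real.sqrt_mul (by positivity)]
    apply Real.sqrt_le_sqrt
    have : (l.map ((fun q => q.1 ^ 2) ∘ F)).sum
        ≤ (l.map ((fun q => q.1 ^ 2) ∘ F)).length • Γ ^ 2 := by
      refine List.sum_le_card_nsmul _ _ ?_
      simp only [List.mem_map]
      rintro _ ⟨q, _, rfl⟩
      simp only [Function.comp, F]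
      split_ifs
      · exact le_rfl
      · simp; positivity
    simp only [List.length_map, nsmul_eq_mul] at this
    simp
    linarith
  have h4 : 2 * B * (Γ * √l.length) ≤ 2 * B * (Γ * (τ * √l.length)) := by
    gcongr
    exact le_mul_of_one_le_left (Real.sqrt_nonneg _) hτ
  calc _ ≤ 2 * B * (Γ * √l.length) + 16 * B * ((d + 2) * (9 * τ * Γ * √l.length)) := by
        gcongr
        exact h2
    _ ≤ 2 * B * (Γ * (τ * √l.length)) + 16 * B * ((d + 2) * (9 * τ * Γ * √l.length)) := by
        gcongr
    _ = _ := by ring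

/-- The constant in the bound for the random signs average of the loss. -/
def lossComplexity (B : ℝ) (d : ℕ) (Y : ℝ) : ℝ :=
  (2 * B + 144 * B * (d + 2)) * (2 * (d + 1) * (100 * B + 2 * Y + 1))

/-- The random signs average for differences of the losses at two points. -/
lemma signAvg_netLoss_le {ι : Type*} [Fintype ι] [Nonempty ι] (hm : 0 < m) (hτ : 1 ≤ τ)
    {θ : ι → NetParam d m} (hθ : ∀ t, θ t ∈ netParams d m B)
    {y : EuclideanSpace ℝ (Fin d) → ℝ} {S : Set (EuclideanSpace ℝ (Fin d))} (hS : S.Nonempty)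
    (hcube : ∀ x ∈ S, ∀ i, |x i| ≤ 1) (hy : ∀ x ∈ S, |y x| ≤ Y) {s : ℝ} (hs : |s| = 1)
    (l : List (ι → ℝ))
    (hl : ∀ h ∈ l, ∃ x ∈ S, ∃ x' ∈ S,
      h = fun t => s * netLoss τ y (θ t) x - s * netLoss τ y (θ t) x') :
    signAvg vecSup l 0 ≤ lossComplexity B d Y * (τ * √l.length) := by
  have hB : 0 ≤ B := by linarith [(abs_nonneg _).trans (hθ (Classical.arbitrary ι)).1]
  have hY : 0 ≤ Y := (abs_nonneg _).trans (hy _ hS.some_mem)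
  have hΓ : 0 ≤ 2 * (d + 1) * (100 * B + 2 * Y + 1) := by positivity
  let G : Set (ι → ℝ) :=
    {h | ∃ q : EuclideanSpace ℝ (Fin d) × Option (Fin d), (∀ i, |q.1 i| ≤ 1) ∧
      h = fun t => 2 * (d + 1) * (100 * B + 2 * Y + 1) * netCoord τ (θ t) q}
  -- The difference depends on the value and the `d` partial derivatives of the network at each of
  -- two points. These `2 * (d + 1)` coordinates give the factor of that size in `lossComplexity`.
  refine signAvg_vecSup_le_of_lipschitz (Option (Fin d) × Bool)
    (H := {h | ∃ x ∈ S, ∃ x' ∈ S,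
      h = fun t => s * netLoss τ y (θ t) x - s * netLoss τ y (θ t) x'})
    (G := G) (n := l.length) ?_ ?_ l rfl hl
  · rintro h ⟨x, hx, x', hx', rfl⟩
    refine ⟨fun j t => (100 * B + 2 * Y + 1) * netCoord τ (θ t) (if j.2 then x else x', j.1),
      fun j => ⟨(if j.2 then x else x', j.1), ?_, ?_⟩, fun t t' => ?_⟩
    · by_cases hj : j.2
      · simpa [hj] using hcube x hx
      · simpa [hj] using hcube x' hx'
    · ext t
      simp
      ring
    · have h1 := abs_netLoss_sub_le hm hτ (hθ t) (hθ t') (hcube x hx) (hy x hx)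
      have h2 := abs_netLoss_sub_le hm hτ (hθ t) (hθ t') (hcube x' hx') (hy x' hx')
      rw [Fintype.sum_prod_type]
      simp only [Fintype.sum_bool, if_true, Bool.false_eq_true, if_false]
      rw [Finset.sum_add_distrib]
      calc _ = |s * ((netLoss τ y (θ t) x - netLoss τ y (θ t') x)
            - (netLoss τ y (θ t) x' - netLoss τ y (θ t') x'))| := by ring_nf
        _ ≤ |netLoss τ y (θ t) x - netLoss τ y (θ t') x|
            + |netLoss τ y (θ t) x' - netLoss τ y (θ t') x'| := by
            rw [abs_mul, hs, one_mul]; exact abs_sub _ _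
        _ ≤ _ := add_le_add h1 h2
  · intro l' hl' hG
    obtain ⟨l'', rfl, hq⟩ := List.exists_eq_map_of_forall l' hG
    have := signAvg_netCoord_le hm hτ hθ hΓ l'' hq
    simp only [List.length_map] at hl'
    rw [hl'] at this
    exact this

end Rademacher

/-! ### Uniform deviations over all networks -/

section Deviation

variable {d m : ℕ} {τ B Y : ℝ}

lemma continuous_netLoss_param (hτ : 0 < τ) (y : EuclideanSpace ℝ (Fin d) → ℝ)
    (x : EuclideanSpace ℝ (Fin d)) : Continuous fun p : NetParam d m => netLoss τ y p x := by
  have h1 : Continuous fun p : NetParam d m => net τ p x :=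
    (continuous_net hτ).comp (continuous_id.prodMk continuous_const)
  have h2 : Continuous fun p : NetParam d m => netGrad τ p x := by
    have := continuous_sigmoid
    unfold netGrad
    fun_prop
  unfold netLoss
  fun_prop

lemma continuous_net_apply (hτ : 0 < τ) (p : NetParam d m) : Continuous (net τ p) :=
  (continuous_net hτ).comp (continuous_const.prodMk continuous_id)

lemma continuous_netGrad_apply (τ : ℝ) (p : NetParam d m) : Continuous (netGrad τ p) := by
  have := continuous_sigmoid
  unfold netGrad
  fun_prop

lemma measurable_netLoss (hτ : 0 < τ) {y : EuclideanSpace ℝ (Fin d) → ℝ} (hy : Measurable y)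
    (p : NetParam d m) : Measurable (netLoss τ y p) := by
  have h1 := (continuous_net_apply hτ p).measurable
  have h2 := (continuous_netGrad_apply τ p).measurable
  unfold netLoss
  fun_prop

lemma aestronglyMeasurable_netLoss (hτ : 0 < τ) {y : EuclideanSpace ℝ (Fin d) → ℝ}
    {ρ : Measure (EuclideanSpace ℝ (Fin d))} (hy : AEMeasurable y ρ)
    (p : NetParam d m) : AEStronglyMeasurable (netLoss τ y p) ρ := by
  have h1 := (continuous_net_apply hτ p).measurable
  have h2 := (continuous_netGrad_apply τ p).measurable
  unfold netLoss
  exact (((h1.pow_const 2).aemeasurable.sub (((h1.const_mul 2).aemeasurable).mul hy)).add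
    h2.norm.aemeasurable).aestronglyMeasurable

/-- Dominated convergence, with the uniform bound of the loss as majorant. Continuity in the
parameters extends the deviation bound from a dense sequence to the whole class. -/
lemma continuous_integral_netLoss (hm : 0 < m) (hτ : 1 ≤ τ)
    {y : EuclideanSpace ℝ (Fin d) → ℝ} {ρ : Measure (EuclideanSpace ℝ (Fin d))}
    [IsProbabilityMeasure ρ] (hy : AEMeasurable y ρ)
    (hρ : ∀ᵐ x ∂ρ, (∀ i, |x i| ≤ 1) ∧ |y x| ≤ Y) :
    Continuous fun p : netParams d m B => ∫ x, netLoss τ y p.1 x ∂ρ := by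
  have hτ' : 0 < τ := by linarith
  refine continuous_of_dominated (bound := fun _ => lossBound B Y)
    (fun p => aestronglyMeasurable_netLoss hτ' hy p.1) (fun p => ?_) (integrable_const _)
    (Filter.Eventually.of_forall fun x =>
      (continuous_netLoss_param hτ' y x).comp continuous_subtype_val)
  filter_upwards [hρ] with x hx
  exact abs_netLoss_le hm hτ p.2 hx.1 hx.2

/-- One-sided deviation inequality for a sequence of networks. -/
lemma measure_seq_deviation_le (hm : 0 < m) (hτ : 1 ≤ τ) (hB : 0 < B)
    {ρ : Measure (EuclideanSpace ℝ (Fin d))} [IsProbabilityMeasure ρ]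
    {y : EuclideanSpace ℝ (Fin d) → ℝ} (hym : Measurable y)
    {S : Set (EuclideanSpace ℝ (Fin d))} (hS : S.Nonempty)
    (hcube : ∀ x ∈ S, ∀ i, |x i| ≤ 1) (hy : ∀ x ∈ S, |y x| ≤ Y)
    {π : EuclideanSpace ℝ (Fin d) → EuclideanSpace ℝ (Fin d)} (hπ : Measurable π)
    (hπS : ∀ x, π x ∈ S) {s : ℝ} (hs : |s| = 1) {N : ℕ} (hN : 0 < N) {ε : ℝ} (hε : 0 < ε)
    (hε1 : ε < 1) (θ : ℕ → netParams d m B) :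
    (Measure.pi fun _ : Fin N => ρ)
        {x | ∃ n, lossComplexity B d Y * (τ * √N)
          + lossBound B Y * (√(2 * Real.log 2) + √(-2 * Real.log ε)) * √N
            ≤ ∑ i, ((∫ x', s * netLoss τ y (θ n).1 (π x') ∂ρ)
              - s * netLoss τ y (θ n).1 (π (x i)))}
      ≤ ENNReal.ofReal (ε / 2) := by
  have hτ' : 0 < τ := by linarith
  have hY : 0 ≤ Y := (abs_nonneg _).trans (hy _ hS.some_mem)
  have hM : 0 < lossBound B Y := by unfold lossBound; positivity
  have hN' : (0 : ℝ) < N := by exact_mod_cast hN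
  set C := lossComplexity B d Y * (τ * √N)
  set r := lossBound B Y * (√(2 * Real.log 2) + √(-2 * Real.log ε)) * √N
  -- The events for the first `n + 1` networks increase with `n`. Their probabilities are bounded
  -- uniformly, since neither the complexity nor the concentration bound depends on the number of
  -- networks, so continuity from below applies.
  let E : ℕ → Set (Fin N → EuclideanSpace ℝ (Fin d)) := fun n =>
    {x | ∃ t : Fin (n + 1), C + r ≤ ∑ i, ((∫ x', s * netLoss τ y (θ t).1 (π x') ∂ρ)
              - s * netLoss τ y (θ t).1 (π (x i)))}
  have hE : {x | ∃ n, C + r ≤ ∑ i, ((∫ x', s * netLoss τ y (θ n).1 (π x') ∂ρ)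
              - s * netLoss τ y (θ n).1 (π (x i)))} = ⋃ n, E n := by
    ext x
    simp only [Set.mem_iUnion, E, Set.mem_ofPred_eq]
    exact ⟨fun ⟨n, hn⟩ => ⟨n, ⟨n, Nat.lt_succ_self n⟩, hn⟩, fun ⟨_, t, ht⟩ => ⟨t, ht⟩⟩
  have hmono : Monotone E := by
    rintro n n' hnn x ⟨t, ht⟩
    exact ⟨⟨t, by omega⟩, ht⟩
  rw [hE, hmono.measure_iUnion]
  refine iSup_le fun n => ?_
  have h := measure_finite_deviation_le (ρ := ρ) (ι := Fin (n + 1)) (n := N) (C := C) (s := r)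
    (M := lossBound B Y) (f := fun x t => s * netLoss τ y (θ t).1 (π x))
    (measurable_pi_lambda _ fun t =>
      ((measurable_netLoss hτ' hym (θ t).1).comp hπ).const_mul s)
    (fun x t => by
      rw [abs_mul, hs, one_mul]
      exact abs_netLoss_le hm hτ (θ t).2 (hcube _ (hπS x)) (hy _ (hπS x)))
    (by positivity) (fun l hl hh => by
      have := signAvg_netLoss_le (θ := fun t : Fin (n + 1) => (θ t).1) hm hτ (fun t => (θ t).2)
        hS hcube hy hs l (fun h hm => by
          obtain ⟨x, x', rfl⟩ := hh h hm
          exact ⟨π x, hπS x, π x', hπS x', rfl⟩)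
      rw [hl] at this
      exact this)
  rw [← ENNReal.ofReal_toReal (measure_ne_top (Measure.pi fun _ : Fin N => ρ) (E n))]
  apply ENNReal.ofReal_le_ofReal
  refine h.trans ?_
  have h2 : 0 < Real.log 2 := Real.log_pos (by norm_num)
  have h3 : 0 < -Real.log ε := by linarith [Real.log_neg hε hε1]
  -- The deviation `r` is a sum of two square roots rather than the root of a sum, so that the
  -- dependence on `ε` separates in the final bound; the cross term in the square is nonnegative.
  have h4 : ε / 2 = Real.exp (-(Real.log 2 + -Real.log ε)) := by
    rw [neg_add, neg_neg, Real.exp_add, Real.exp_neg, Real.exp_log hε, Real.exp_log (by norm_num)]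
    ring
  rw [h4]
  apply Real.exp_le_exp.2
  have h5 : r ^ 2 / (2 * (N * lossBound B Y ^ 2))
      = (√(2 * Real.log 2) + √(-2 * Real.log ε)) ^ 2 / 2 := by
    simp only [r, mul_pow]
    rw [Real.sq_sqrt hN'.le]
    field_simp
  rw [neg_div, h5, neg_le_neg_iff]
  have h6 := Real.sq_sqrt (show 0 ≤ 2 * Real.log 2 by positivity)
  have h7 := Real.sq_sqrt (show 0 ≤ -2 * Real.log ε by linarith)
  have h8 := Real.sqrt_nonneg (2 * Real.log 2)
  have h9 := Real.sqrt_nonneg (-2 * Real.log ε)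
  nlinarith [mul_nonneg h8 h9]

/-- Uniform deviation inequality for the losses of networks. -/
lemma exists_deviation_event (hm : 0 < m) (hτ : 1 ≤ τ) (hB : 0 < B)
    {ρ : Measure (EuclideanSpace ℝ (Fin d))} [IsProbabilityMeasure ρ]
    {y : EuclideanSpace ℝ (Fin d) → ℝ} (hym : AEMeasurable y ρ)
    (hρ : ∀ᵐ x ∂ρ, (∀ i, |x i| ≤ 1) ∧ |y x| ≤ Y) {N : ℕ} (hN : 0 < N) {ε : ℝ} (hε : 0 < ε)
    (hε1 : ε < 1) :
    ∃ G : Set (Fin N → EuclideanSpace ℝ (Fin d)), MeasurableSet G ∧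
      ENNReal.ofReal (1 - ε) ≤ Measure.pi (fun _ : Fin N => ρ) G ∧
      ∀ x ∈ G, ∀ p ∈ netParams d m B,
        |(∫ x', netLoss τ y p x' ∂ρ) - 1 / (N : ℝ) * ∑ i, netLoss τ y p (x i)|
          ≤ (lossComplexity B d Y * τ
            + lossBound B Y * (√(2 * Real.log 2) + √(-2 * Real.log ε))) / √N := by
  have hτ' : 0 < τ := by linarith
  have hN' : (0 : ℝ) < N := by exact_mod_cast hN
  rcases (netParams d m B).eq_empty_or_nonempty with hemp | hne
  · refine ⟨Set.univ, MeasurableSet.univ, ?_, fun x _ p hp => by simp [hemp] at hp⟩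
    rw [measure_univ]
    exact ENNReal.ofReal_le_one.2 (by linarith)
  -- a conull set on which everything holds
  let T : Set (EuclideanSpace ℝ (Fin d)) :=
    {x | ((∀ i, |x i| ≤ 1) ∧ |y x| ≤ Y) ∧ y x = hym.mk y x}
  have hT : ∀ᵐ x ∂ρ, x ∈ T := by
    filter_upwards [hρ, hym.ae_eq_mk] with x h1 h2 using ⟨h1, h2⟩
  let S : Set (EuclideanSpace ℝ (Fin d)) := (toMeasurable ρ Tᶜ)ᶜ
  have hSm : MeasurableSet S := (measurableSet_toMeasurable _ _).compl
  have hST : S ⊆ T := Set.compl_subset_comm.1 (subset_toMeasurable _ _)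
  have hSae : ∀ᵐ x ∂ρ, x ∈ S := by
    rw [ae_iff]
    have : {x | x ∉ S} = toMeasurable ρ Tᶜ := by ext x; simp [S]
    rw [this, measure_toMeasurable]
    exact hT
  have hSne : S.Nonempty := by
    obtain ⟨x, hx⟩ := hSae.exists
    exact ⟨x, hx⟩
  obtain ⟨x₀, hx₀⟩ := hSne
  classical
  -- Exceptional points are sent to `x₀`. Composed with `π`, and with the measurable version of `y`,
  -- the loss is measurable and bounded everywhere, as the deviation inequality demands, while
  -- nothing changes on the conull set `S`.
  let π : EuclideanSpace ℝ (Fin d) → EuclideanSpace ℝ (Fin d) := fun x => if x ∈ S then x else x₀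
  have hπ : Measurable π := Measurable.ite hSm measurable_id measurable_const
  have hπS : ∀ x, π x ∈ S := fun x => by
    by_cases hx : x ∈ S
    · simp [π, hx]
    · simp [π, hx, hx₀]
  have hπid : ∀ x ∈ S, π x = x := fun x hx => by simp [π, hx]
  have hyS : ∀ x ∈ S, |hym.mk y x| ≤ Y := fun x hx => (hST hx).2 ▸ (hST hx).1.2
  have hloss : ∀ (p : NetParam d m), ∀ x ∈ S,
      netLoss τ (hym.mk y) p x = netLoss τ y p x := fun p x hx => by
    simp only [netLoss, (hST hx).2]
  have : Nonempty (netParams d m B) := hne.to_subtype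
  let θ : ℕ → netParams d m B := TopologicalSpace.denseSeq (netParams d m B)
  let R : ℝ := lossComplexity B d Y * (τ * √N)
    + lossBound B Y * (√(2 * Real.log 2) + √(-2 * Real.log ε)) * √N
  -- The values `s = 1` and `s = -1` give the two one-sided deviations, each of probability at most
  -- `ε / 2`.
  let Bad : ℝ → Set (Fin N → EuclideanSpace ℝ (Fin d)) := fun s =>
    {x | ∃ n, R ≤ ∑ i, ((∫ x', s * netLoss τ (hym.mk y) (θ n).1 (π x') ∂ρ)
              - s * netLoss τ (hym.mk y) (θ n).1 (π (x i)))}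
  have hBad : ∀ s : ℝ, |s| = 1 →
      (Measure.pi fun _ : Fin N => ρ) (Bad s) ≤ ENNReal.ofReal (ε / 2) := fun s hs =>
    measure_seq_deviation_le hm hτ hB hym.measurable_mk ⟨x₀, hx₀⟩ (fun x hx => (hST hx).1.1) hyS
      hπ hπS hs hN hε hε1 θ
  have hBadm : ∀ s : ℝ, MeasurableSet (Bad s) := fun s => by
    have : Bad s = ⋃ n, {x | R ≤ ∑ i, ((∫ x', s * netLoss τ (hym.mk y) (θ n).1 (π x') ∂ρ)
              - s * netLoss τ (hym.mk y) (θ n).1 (π (x i)))} := by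
      ext x; simp [Bad]
    rw [this]
    refine MeasurableSet.iUnion fun n => measurableSet_le measurable_const ?_
    refine Finset.measurable_sum _ fun i _ => measurable_const.sub ?_
    exact (((measurable_netLoss hτ' hym.measurable_mk (θ n).1).comp hπ).comp
      (measurable_pi_apply i)).const_mul s
  let U : Set (Fin N → EuclideanSpace ℝ (Fin d)) := {x | ∀ i, x i ∈ S}
  have hU : MeasurableSet U := by
    have : U = ⋂ i, (fun x : Fin N → EuclideanSpace ℝ (Fin d) => x i) ⁻¹' S := by ext x; simp [U]
    rw [this]
    exact MeasurableSet.iInter fun i => measurable_pi_apply i hSm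
  have hUae : (Measure.pi fun _ : Fin N => ρ) Uᶜ = 0 := by
    have : ∀ᵐ x ∂(Measure.pi fun _ : Fin N => ρ), ∀ i, x i ∈ S :=
      Filter.eventually_all.2 fun i => Measure.tendsto_eval_ae_ae.eventually hSae
    exact this
  refine ⟨(Bad 1 ∪ Bad (-1) ∪ Uᶜ)ᶜ,
    (((hBadm 1).union (hBadm (-1))).union hU.compl).compl, ?_, ?_⟩
  · rw [prob_compl_eq_one_sub (((hBadm 1).union (hBadm (-1))).union hU.compl),
      ENNReal.ofReal_sub _ hε.le, ENNReal.ofReal_one]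
    refine tsub_le_tsub_left ?_ _
    calc _ ≤ (Measure.pi fun _ : Fin N => ρ) (Bad 1) + (Measure.pi fun _ : Fin N => ρ) (Bad (-1))
          + (Measure.pi fun _ : Fin N => ρ) Uᶜ :=
          (measure_union_le _ _).trans (by gcongr; exact measure_union_le _ _)
      _ ≤ ENNReal.ofReal (ε / 2) + ENNReal.ofReal (ε / 2) + 0 := by
          gcongr
          · exact hBad 1 (by simp)
          · exact hBad (-1) (by simp)
          · exact hUae.le
      _ = ENNReal.ofReal ε := by
          rw [add_zero, ← ENNReal.ofReal_add (by positivity) (by positivity), add_halves]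
  · intro x hx p hp
    simp only [Set.compl_union, compl_compl, Set.mem_inter_iff, Set.mem_compl_iff] at hx
    obtain ⟨⟨hx1, hx2⟩, hxU⟩ := hx
    have hden : ∀ q : netParams d m B,
        |(∫ x', netLoss τ y q.1 x' ∂ρ) - 1 / (N : ℝ) * ∑ i, netLoss τ y q.1 (x i)| ≤ R / N := by
      intro q
      -- The inequality is a closed condition on the parameters, so the dense sequence suffices. The
      -- sample is fixed, and its points lie in `S`, where `y` agrees with its measurable version.
      refine (TopologicalSpace.denseRange_denseSeq (netParams d m B)).induction_on
        (p := fun q : netParams d m B => |(∫ x', netLoss τ y q.1 x' ∂ρ)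
          - 1 / (N : ℝ) * ∑ i, netLoss τ y q.1 (x i)| ≤ R / N) q ?_ fun n => ?_
      · refine isClosed_le (Continuous.abs ((continuous_integral_netLoss hm hτ hym hρ).sub
          (continuous_const.mul (continuous_finsetSum _ fun i _ =>
            (continuous_netLoss_param hτ' y (x i)).comp continuous_subtype_val))))
          continuous_const
      · change |(∫ x', netLoss τ y (θ n).1 x' ∂ρ) - _| ≤ _
        have hint : ∀ s : ℝ, ∫ x', s * netLoss τ (hym.mk y) (θ n).1 (π x') ∂ρ
            = s * ∫ x', netLoss τ y (θ n).1 x' ∂ρ := fun s => by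
          rw [integral_const_mul]
          congr 1
          refine integral_congr_ae ?_
          filter_upwards [hSae] with x' hx'
          rw [hπid x' hx', hloss _ x' hx']
        have hpt : ∀ i, netLoss τ (hym.mk y) (θ n).1 (π (x i)) = netLoss τ y (θ n).1 (x i) :=
          fun i => by rw [hπid _ (hxU i), hloss _ _ (hxU i)]
        have hs : ∀ s : ℝ, x ∉ Bad s →
            s * (N * (∫ x', netLoss τ y (θ n).1 x' ∂ρ) - ∑ i, netLoss τ y (θ n).1 (x i)) ≤ R := by
          intro s hxs
          have : ¬ R ≤ ∑ i, ((∫ x', s * netLoss τ (hym.mk y) (θ n).1 (π x') ∂ρ)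
              - s * netLoss τ (hym.mk y) (θ n).1 (π (x i))) := fun h => hxs ⟨n, h⟩
          simp only [hint, hpt, Finset.sum_sub_distrib, Finset.sum_const, Finset.card_univ,
            Fintype.card_fin, nsmul_eq_mul, ← Finset.mul_sum] at this
          linarith
        have h1 := hs 1 hx1
        have h2 := hs (-1) hx2
        have e : (∫ x', netLoss τ y (θ n).1 x' ∂ρ) - 1 / (N : ℝ) * ∑ i, netLoss τ y (θ n).1 (x i)
          = (N * (∫ x', netLoss τ y (θ n).1 x' ∂ρ) - ∑ i, netLoss τ y (θ n).1 (x i)) / N := by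
          field_simp
        rw [e, abs_div, abs_of_pos hN']
        gcongr
        rw [abs_le]
        constructor <;> linarith
    refine (hden ⟨p, hp⟩).trans (le_of_eq ?_)
    have hsq : √(N : ℝ) ≠ 0 := by positivity
    have e2 : (N : ℝ) = √N * √N := (Real.mul_self_sqrt hN'.le).symm
    simp only [R]
    rw [div_eq_div_iff hN'.ne' hsq]
    linear_combination (-(lossComplexity B d Y * τ)
      - lossBound B Y * (√(2 * Real.log 2) + √(-2 * Real.log ε))) * e2

end Deviation

/-! ### Total variation of smooth functions -/

section TotalVariation

variable {d : ℕ} {Ω : Set (EuclideanSpace ℝ (Fin d))}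

/-- The field vanishes outside `Ω` together with its derivative, so both integrals extend to the
whole space. There integration by parts in each coordinate has no boundary term. -/
lemma IsTVTestField.setIntegral_mul_divergence
    {p : EuclideanSpace ℝ (Fin d) → EuclideanSpace ℝ (Fin d)} (hp : IsTVTestField Ω p)
    {f : EuclideanSpace ℝ (Fin d) → ℝ} (hf : ContDiff ℝ 1 f) :
    ∫ x in Ω, f x * divergence p x = - ∫ x in Ω, inner ℝ (gradient f x) (p x) := by
  have hsupp : ∀ x, x ∉ Ω → p x = 0 ∧ fderiv ℝ p x = 0 := by
    intro x hx
    have hx' : x ∉ tsupport p := fun h => hx (hp.tsupport_subset h)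
    refine ⟨image_eq_zero_of_notMem_tsupport hx', ?_⟩
    by_contra h
    exact hx' (support_fderiv_subset ℝ h)
  rw [setIntegral_eq_integral_of_forall_compl_eq_zero (fun x hx => by
      simp [divergence, (hsupp x hx).2]),
    setIntegral_eq_integral_of_forall_compl_eq_zero (fun x hx => by simp [(hsupp x hx).1])]
  have hpd : Differentiable ℝ p := hp.contDiff.differentiable one_ne_zero
  have hfd : Differentiable ℝ f := hf.differentiable one_ne_zero
  have hpc : ∀ i, ContDiff ℝ 1 fun x => p x i := fun i => by
    have := hp.contDiff
    fun_prop
  have hps : ∀ i, HasCompactSupport fun x => p x i := fun i =>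
    hp.hasCompactSupport.comp_left (g := fun v : EuclideanSpace ℝ (Fin d) => v i) rfl
  have hpf : ∀ i x v, fderiv ℝ (fun x => p x i) x v = (fderiv ℝ p x v) i := fun i x v => by
    have h := ((EuclideanSpace.proj (𝕜 := ℝ) i).hasFDerivAt (x := p x)).comp x
      (hpd x).hasFDerivAt
    have h2 : HasFDerivAt (fun x => p x i) ((EuclideanSpace.proj (𝕜 := ℝ) i).comp (fderiv ℝ p x)) x :=
      h
    rw [h2.fderiv]
    rfl
  have hfc : Continuous (fderiv ℝ f) := hf.continuous_fderiv one_ne_zero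
  have hpfc : ∀ i, Continuous (fderiv ℝ fun x => p x i) := fun i =>
    (hpc i).continuous_fderiv one_ne_zero
  have hint1 : ∀ i, Integrable fun x => f x * fderiv ℝ (fun x => p x i) x
      (EuclideanSpace.single i 1) := fun i => by
    refine Continuous.integrable_of_hasCompactSupport
      (hf.continuous.mul ((hpfc i).clm_apply continuous_const)) ?_
    exact ((hps i).fderiv_apply (𝕜 := ℝ) _).mul_left
  have hint2 : ∀ i, Integrable fun x => fderiv ℝ f x (EuclideanSpace.single i 1) * p x i :=
    fun i => Continuous.integrable_of_hasCompactSupport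
      ((hfc.clm_apply continuous_const).mul (hpc i).continuous) (hps i).mul_left
  have hint3 : ∀ i, Integrable fun x => f x * p x i :=
    fun i => Continuous.integrable_of_hasCompactSupport
      (hf.continuous.mul (hpc i).continuous) (hps i).mul_left
  have e1 : ∀ x, f x * divergence p x
      = ∑ i, f x * fderiv ℝ (fun x => p x i) x (EuclideanSpace.single i 1) := fun x => by
    simp only [divergence, Finset.mul_sum, hpf]
  have e2 : ∀ x, inner ℝ (gradient f x) (p x)
      = ∑ i, fderiv ℝ f x (EuclideanSpace.single i 1) * p x i := fun x => by
    rw [inner_gradient_left]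
    conv_lhs => rw [← (EuclideanSpace.basisFun (Fin d) ℝ).sum_repr (p x)]
    simp [mul_comm]
  simp_rw [e1, e2]
  rw [integral_finsetSum _ fun i _ => hint1 i, integral_finsetSum _ fun i _ => hint2 i,
    ← Finset.sum_neg_distrib]
  refine Finset.sum_congr rfl fun i _ => ?_
  exact integral_mul_fderiv_eq_neg_fderiv_mul_of_integrable (hint2 i) (hint1 i) (hint3 i)
    (fun x _ => hfd x) (fun x _ => ((hpc i).differentiable one_ne_zero) x)

lemma continuous_gradient {f : EuclideanSpace ℝ (Fin d) → ℝ} (hf : ContDiff ℝ 1 f) :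
    Continuous (gradient f) :=
  (InnerProductSpace.toDual ℝ _).symm.continuous.comp (hf.continuous_fderiv one_ne_zero)

lemma totalVariation_le {f : EuclideanSpace ℝ (Fin d) → ℝ} (hf : ContDiff ℝ 1 f)
    (hi : IntegrableOn (fun x => ‖gradient f x‖) Ω) :
    totalVariation Ω f ≤ ENNReal.ofReal (∫ x in Ω, ‖gradient f x‖) := by
  refine iSup₂_le fun p hp => ENNReal.ofReal_le_ofReal ?_
  rw [hp.setIntegral_mul_divergence hf, ← integral_neg]
  have hb : ∀ x, ‖inner ℝ (gradient f x) (p x)‖ ≤ ‖gradient f x‖ := fun x =>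
    (norm_inner_le_norm _ _).trans (mul_le_of_le_one_right (norm_nonneg _) (hp.norm_le_one x))
  refine integral_mono (Integrable.mono' hi ?_ (Filter.Eventually.of_forall fun x => ?_)) hi
    fun x => ?_
  · exact ((continuous_gradient hf).inner hp.contDiff.continuous).neg.aestronglyMeasurable
  · rw [norm_neg]; exact hb x
  · exact (neg_le_abs _).trans (hb x)

lemma exists_cutoff (hΩ : IsOpen Ω) {K : Set (EuclideanSpace ℝ (Fin d))} (hK : IsCompact K)
    (hKΩ : K ⊆ Ω) :
    ∃ χ : EuclideanSpace ℝ (Fin d) → ℝ, ContDiff ℝ 1 χ ∧ HasCompactSupport χ ∧ tsupport χ ⊆ Ω ∧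
      (∀ x ∈ K, χ x = 1) ∧ ∀ x, 0 ≤ χ x ∧ χ x ≤ 1 := by
  obtain ⟨K', hK', h1, h2⟩ := exists_compact_between hK hΩ hKΩ
  obtain ⟨χ, hχ1, hχ0, hχ⟩ := exists_contMDiffMap_one_nhds_of_subset_interior
    (modelWithCornersSelf ℝ (EuclideanSpace ℝ (Fin d))) (n := 1) hK.isClosed h1
  have hs : tsupport χ ⊆ K' := closure_minimal
    (fun x hx => by_contra fun h => hx (hχ0 x h)) hK'.isClosed
  exact ⟨χ, χ.contMDiff.contDiff, hK'.of_isClosed_subset (isClosed_tsupport _) hs, hs.trans h2,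
    fun x hx => hχ1.self_of_nhdsSet x hx, fun x => hχ x⟩

/-- The optimal field would be the negative normalized gradient. Regularizing the norm by `η` makes
it differentiable where the gradient vanishes, and a cutoff equal to one on `K` gives it compact
support in `Ω`. The loss is at most `η` per unit volume. -/
lemma setIntegral_norm_gradient_compact_le (hΩ : IsOpen Ω) (hvol : volume Ω ≠ ⊤)
    {f : EuclideanSpace ℝ (Fin d) → ℝ} (hf : ContDiff ℝ 2 f) (hTV : totalVariation Ω f ≠ ⊤)
    {K : Set (EuclideanSpace ℝ (Fin d))} (hK : IsCompact K) (hKΩ : K ⊆ Ω) {η : ℝ} (hη : 0 < η) :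
    ∫ x in K, ‖gradient f x‖ ≤ (totalVariation Ω f).toReal + η * volume.real Ω := by
  obtain ⟨χ, hχ, hχc, hχs, hχ1, hχ01⟩ := exists_cutoff hΩ hK hKΩ
  have hf1 : ContDiff ℝ 1 f := hf.of_le (by norm_num)
  have hg : ContDiff ℝ 1 (gradient f) :=
    (InnerProductSpace.toDual ℝ _).symm.toContinuousLinearEquiv.contDiff.comp
      (hf.fderiv_right (by norm_num))
  have hpos : ∀ x, 0 < ‖gradient f x‖ ^ 2 + η ^ 2 := fun x => by positivity
  have hsq : ContDiff ℝ 1 fun x => √(‖gradient f x‖ ^ 2 + η ^ 2) :=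
    ((hg.norm_sq ℝ).add contDiff_const).sqrt fun x => (hpos x).ne'
  let p : EuclideanSpace ℝ (Fin d) → EuclideanSpace ℝ (Fin d) := fun x =>
    χ x • (-(1 / √(‖gradient f x‖ ^ 2 + η ^ 2)) • gradient f x)
  have hsub : tsupport p ⊆ tsupport χ := closure_mono fun x hx h => hx (by simp [p, h])
  have hp : IsTVTestField Ω p := by
    refine ⟨hχ.smul (ContDiff.smul (contDiff_const.div hsq fun x =>
      (Real.sqrt_pos.2 (hpos x)).ne').neg hg), hχc.smul_right, hsub.trans hχs, fun x => ?_⟩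
    have h0 := Real.sqrt_pos.2 (hpos x)
    have h1 : ‖gradient f x‖ ≤ √(‖gradient f x‖ ^ 2 + η ^ 2) :=
      Real.le_sqrt_of_sq_le (by nlinarith [sq_nonneg η])
    simp only [p, norm_smul, norm_neg, Real.norm_eq_abs]
    rw [abs_of_nonneg (hχ01 x).1, abs_of_pos (by positivity), one_div, inv_mul_eq_div]
    exact mul_le_one₀ (hχ01 x).2 (by positivity) ((div_le_one h0).2 h1)
  have h1 : ∫ x in Ω, f x * divergence p x ≤ (totalVariation Ω f).toReal :=
    (ENNReal.ofReal_le_iff_le_toReal hTV).1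
      (le_iSup₂ (f := fun p (_ : IsTVTestField Ω p) =>
        ENNReal.ofReal (∫ x in Ω, f x * divergence p x)) p hp)
  rw [hp.setIntegral_mul_divergence hf1, ← integral_neg] at h1
  have hKi : IntegrableOn (fun x => ‖gradient f x‖) K :=
    (continuous_gradient hf1).norm.continuousOn.integrableOn_compact hK
  have hKi' : Integrable (K.indicator fun x => ‖gradient f x‖) (volume.restrict Ω) :=
    ((integrable_indicator_iff hK.measurableSet).2 hKi).restrict
  have : IsFiniteMeasure (volume.restrict Ω) := ⟨by simpa using hvol.lt_top⟩
  have h2 : ∫ x in Ω, ((K.indicator (fun x => ‖gradient f x‖) x) - η)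
      ≤ ∫ x in Ω, -inner ℝ (gradient f x) (p x) := by
    refine integral_mono (hKi'.sub (integrable_const η)) ?_ fun x => ?_
    · refine (Continuous.integrable_of_hasCompactSupport ?_ ?_).restrict
      · exact ((continuous_gradient hf1).inner hp.contDiff.continuous).neg
      · exact hp.hasCompactSupport.mono fun x hx h => hx (by simp [h])
    · have h0 := Real.sqrt_pos.2 (hpos x)
      have e : -inner ℝ (gradient f x) (p x)
          = χ x * (‖gradient f x‖ ^ 2 / √(‖gradient f x‖ ^ 2 + η ^ 2)) := by
        simp only [p, inner_smul_right, neg_smul, inner_neg_right, real_inner_self_eq_norm_sq]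
        ring
      have h3 : √(‖gradient f x‖ ^ 2 + η ^ 2) ≤ ‖gradient f x‖ + η :=
        Real.sqrt_le_iff.2 ⟨by positivity, by nlinarith [norm_nonneg (gradient f x)]⟩
      simp only [e]
      by_cases hx : x ∈ K
      · rw [Set.indicator_of_mem hx, hχ1 x hx, one_mul, le_div_iff₀ h0]
        -- For a nonnegative factor `‖∇f‖ - η`, the claim follows from `(‖∇f‖ - η) * (‖∇f‖ + η) ≤
        -- ‖∇f‖ ^ 2`; otherwise its left side is nonpositive.
        rcases le_total (‖gradient f x‖ - η) 0 with h | h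
        · nlinarith [sq_nonneg ‖gradient f x‖]
        · nlinarith
      · rw [Set.indicator_of_notMem hx]
        have := (hχ01 x).1
        have : 0 ≤ χ x * (‖gradient f x‖ ^ 2 / √(‖gradient f x‖ ^ 2 + η ^ 2)) := by positivity
        linarith
  rw [integral_sub hKi' (integrable_const η), setIntegral_indicator hK.measurableSet,
    Set.inter_eq_right.2 hKΩ, integral_const, smul_eq_mul, measureReal_restrict_apply_univ] at h2
  linarith

/-- The total variation of a smooth function is at least the integral of the norm of its
gradient. -/
lemma setIntegral_norm_gradient_le (hΩ : IsOpen Ω) (hbdd : Bornology.IsBounded Ω)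
    {f : EuclideanSpace ℝ (Fin d) → ℝ} (hf : ContDiff ℝ 2 f) (hTV : totalVariation Ω f ≠ ⊤)
    (hi : IntegrableOn (fun x => ‖gradient f x‖) Ω) :
    ∫ x in Ω, ‖gradient f x‖ ≤ (totalVariation Ω f).toReal := by
  have hvol : volume Ω ≠ ⊤ := hbdd.measure_lt_top.ne
  -- Exhaustion by closed sets, compact because `Ω` is bounded, reduces the claim to the compact
  -- case.
  obtain ⟨F, hFc, hFs, hFU, hFm⟩ := hΩ.exists_iUnion_isClosed
  have ht := tendsto_setIntegral_of_monotone (μ := volume) (f := fun x => ‖gradient f x‖)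
    (fun n => (hFc n).measurableSet) hFm (by rwa [hFU])
  rw [hFU] at ht
  refine le_of_tendsto' ht fun n => ?_
  refine le_of_forall_pos_le_add fun e he => ?_
  have hK : IsCompact (F n) :=
    Metric.isCompact_of_isClosed_isBounded (hFc n) (hbdd.subset (hFs n))
  have hv : 0 ≤ volume.real Ω := measureReal_nonneg
  have := setIntegral_norm_gradient_compact_le hΩ hvol hf hTV hK (hFs n)
    (η := e / (volume.real Ω + 1)) (by positivity)
  refine this.trans ?_
  gcongr
  rw [div_mul_eq_mul_div, div_le_iff₀ (by positivity)]
  nlinarith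

end TotalVariation

/-! ### Approximation of functions of one variable by softplus functions -/

section OneVariable

variable {τ : ℝ} {g g' g'' : ℝ → ℝ}

lemma softplus_zero_le {τ : ℝ} (hτ : 0 < τ) : softplus τ 0 ≤ 1 / τ := by
  rw [softplus_zero]
  gcongr
  linarith [Real.log_two_lt_d9]

lemma abs_softplus_sub_self_le (hτ : 0 < τ) {z : ℝ} (hz : 0 ≤ z) : |z - softplus τ z| ≤ 1 / τ := by
  have h1 := le_softplus hτ z
  have h2 := softplus_le hτ z
  rw [max_eq_left hz, ← softplus_zero] at h2
  have := softplus_zero_le hτ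
  rw [abs_le]
  constructor <;> linarith

lemma abs_softplus_nonpos_le (hτ : 0 < τ) {z : ℝ} (hz : z ≤ 0) : |softplus τ z| ≤ 1 / τ := by
  rw [abs_of_nonneg (softplus_nonneg hτ z)]
  exact (softplus_mono hτ hz).trans (softplus_zero_le hτ)

lemma hasDerivAt_softplus_sub (hτ : 0 < τ) (t s : ℝ) :
    HasDerivAt (fun s => softplus τ (t - s)) (-Real.sigmoid (τ * (t - s))) s := by
  have : HasDerivAt (fun s => softplus τ (t - s)) (Real.sigmoid (τ * (t - s)) * -1) s :=
    (hasDerivAt_softplus hτ (t - s)).comp s ((hasDerivAt_id s).const_sub t)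
  exact this.congr_deriv (by ring)

/-- Approximation of a function by its softplus integral. -/
lemma abs_sub_softplus_integral_le (hτ : 0 < τ) (hg : ∀ t, HasDerivAt g (g' t) t)
    (hg' : ∀ t, HasDerivAt g' (g'' t) t) (hc : Continuous g'') (hb : ∀ t, |g'' t| ≤ 1)
    {t : ℝ} (ht : |t| ≤ 1) :
    |g (-1) + g' (-1) * (t + 1) + (∫ s in (-1 : ℝ)..1, g'' s * softplus τ (t - s)) - g t|
      ≤ 2 / τ := by
  obtain ⟨ht1, ht2⟩ := abs_le.1 ht
  have hsp := continuous_softplus hτ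
  -- Taylor's formula with integral remainder. On `[-1, t]` softplus is compared with the identity
  -- and on `[t, 1]` with zero; both errors are at most `1 / τ`, over a total length of two.
  have hT : ∫ s in (-1 : ℝ)..t, g'' s * (t - s) = g t - g (-1) - g' (-1) * (t + 1) := by
    rw [intervalIntegral.integral_eq_sub_of_hasDerivAt (f := fun s => g' s * (t - s) + g s)]
    · ring
    · intro s _
      have := ((hg' s).mul ((hasDerivAt_id s).const_sub t)).add (hg s)
      refine this.congr_deriv ?_
      simp
    · exact (by fun_prop : Continuous fun s => g'' s * (t - s)).intervalIntegrable _ _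
  have hI : ∀ a b, IntervalIntegrable (fun s => g'' s * softplus τ (t - s)) volume a b := fun a b =>
    (by fun_prop : Continuous fun s => g'' s * softplus τ (t - s)).intervalIntegrable _ _
  have hI2 : ∀ a b, IntervalIntegrable (fun s => g'' s * (t - s)) volume a b := fun a b =>
    (by fun_prop : Continuous fun s => g'' s * (t - s)).intervalIntegrable _ _
  rw [← intervalIntegral.integral_add_adjacent_intervals (hI (-1) t) (hI t 1)]
  have h1 : |(∫ s in (-1 : ℝ)..t, g'' s * (t - s)) - ∫ s in (-1 : ℝ)..t, g'' s * softplus τ (t - s)|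
      ≤ 1 / τ * |t - (-1)| := by
    rw [← intervalIntegral.integral_sub (hI2 _ _) (hI _ _), ← Real.norm_eq_abs]
    refine intervalIntegral.norm_integral_le_of_norm_le_const fun s hs => ?_
    rw [Set.uIoc_of_le ht1] at hs
    rw [← mul_sub, norm_mul, Real.norm_eq_abs, Real.norm_eq_abs]
    calc _ ≤ 1 * (1 / τ) := by
          gcongr
          · exact hb s
          · exact abs_softplus_sub_self_le hτ (by linarith [hs.2])
      _ = _ := one_mul _
  have h2 : |∫ s in t..1, g'' s * softplus τ (t - s)| ≤ 1 / τ * |1 - t| := by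
    rw [← Real.norm_eq_abs]
    refine intervalIntegral.norm_integral_le_of_norm_le_const fun s hs => ?_
    rw [Set.uIoc_of_le ht2] at hs
    rw [norm_mul, Real.norm_eq_abs, Real.norm_eq_abs]
    calc _ ≤ 1 * (1 / τ) := by
          gcongr
          · exact hb s
          · exact abs_softplus_nonpos_le hτ (by linarith [hs.1])
      _ = _ := one_mul _
  rw [abs_of_nonneg (show 0 ≤ t - -1 by linarith)] at h1
  rw [abs_of_nonneg (show 0 ≤ 1 - t by linarith)] at h2
  have e : 2 / τ = 1 / τ * (t - (-1)) + 1 / τ * (1 - t) := by ring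
  rw [e]
  rw [abs_le] at *
  constructor <;> linarith

/-- Approximation of the derivative of a function by its sigmoid integral. -/
lemma abs_deriv_sub_sigmoid_integral_le (hτ : 0 < τ)
    (hg' : ∀ t, HasDerivAt g' (g'' t) t) (hc : Continuous g'') (hb : ∀ t, |g'' t| ≤ 1)
    {t : ℝ} (ht : |t| ≤ 1) :
    |g' (-1) + (∫ s in (-1 : ℝ)..1, g'' s * Real.sigmoid (τ * (t - s))) - g' t| ≤ 2 / τ := by
  obtain ⟨ht1, ht2⟩ := abs_le.1 ht
  have hsp := continuous_sigmoid
  have hT : ∫ s in (-1 : ℝ)..t, g'' s = g' t - g' (-1) :=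
    intervalIntegral.integral_eq_sub_of_hasDerivAt (fun s _ => hg' s) (hc.intervalIntegrable _ _)
  have hI : ∀ a b, IntervalIntegrable (fun s => g'' s * Real.sigmoid (τ * (t - s))) volume a b :=
    fun a b => (by fun_prop :
      Continuous fun s => g'' s * Real.sigmoid (τ * (t - s))).intervalIntegrable _ _
  have hS : ∀ a b, IntervalIntegrable (fun s => Real.sigmoid (τ * (t - s))) volume a b :=
    fun a b => (by fun_prop :
      Continuous fun s => Real.sigmoid (τ * (t - s))).intervalIntegrable _ _
  have hSint : ∀ a b, ∫ s in a..b, Real.sigmoid (τ * (t - s))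
      = softplus τ (t - a) - softplus τ (t - b) := fun a b => by
    rw [intervalIntegral.integral_eq_sub_of_hasDerivAt (f := fun s => -softplus τ (t - s)) _
      (hS a b)]
    · ring
    · intro s _
      exact (hasDerivAt_softplus_sub hτ t s).fun_neg.congr_deriv (neg_neg _)
  rw [← intervalIntegral.integral_add_adjacent_intervals (hI (-1) t) (hI t 1)]
  have h0 := softplus_zero_le hτ
  have h1 : |(∫ s in (-1 : ℝ)..t, g'' s)
      - ∫ s in (-1 : ℝ)..t, g'' s * Real.sigmoid (τ * (t - s))| ≤ 1 / τ := by
    rw [← intervalIntegral.integral_sub (hc.intervalIntegrable _ _) (hI _ _), ← Real.norm_eq_abs]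
    -- Near `s = t` the sigmoid is far from one, so no uniform bound is available. The integral of
    -- `1 - sigmoid` is explicit through softplus, however, and at most `softplus τ 0 ≤ 1 / τ`.
    refine (intervalIntegral.norm_integral_le_of_norm_le ht1
      (g := fun s => 1 - Real.sigmoid (τ * (t - s))) (Filter.Eventually.of_forall fun s _ => ?_)
      (intervalIntegrable_const.sub (hS _ _))).trans ?_
    · rw [← mul_one_sub, norm_mul, Real.norm_eq_abs, Real.norm_eq_abs]
      have := Real.sigmoid_le_one (τ * (t - s))
      rw [abs_of_nonneg (a := 1 - _) (by linarith)]
      exact mul_le_of_le_one_left (by linarith) (hb s)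
    · rw [intervalIntegral.integral_sub intervalIntegrable_const (hS _ _), hSint]
      have := le_softplus hτ (t - -1)
      simp only [intervalIntegral.integral_const, smul_eq_mul, mul_one, sub_self]
      linarith
  have h2 : |∫ s in t..1, g'' s * Real.sigmoid (τ * (t - s))| ≤ 1 / τ := by
    rw [← Real.norm_eq_abs]
    refine (intervalIntegral.norm_integral_le_of_norm_le ht2
      (g := fun s => Real.sigmoid (τ * (t - s))) (Filter.Eventually.of_forall fun s _ => ?_)
      (hS _ _)).trans ?_
    · rw [norm_mul, Real.norm_eq_abs, Real.norm_eq_abs, abs_of_nonneg (Real.sigmoid_nonneg _)]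
      exact mul_le_of_le_one_left (Real.sigmoid_nonneg _) (hb s)
    · rw [hSint, sub_self]
      have := softplus_nonneg hτ (t - 1)
      linarith
  have e : 2 / τ = 1 / τ + 1 / τ := by ring
  rw [e]
  rw [abs_le] at *
  constructor <;> linarith

end OneVariable

/-! ### Sampling of neurons -/

section Sampling

variable {Ξ : Type*} [MeasurableSpace Ξ] {P : Measure Ξ} [IsProbabilityMeasure P]

lemma integral_average_pi {m : ℕ} (hm : 0 < m) {Z : Ξ → ℝ} (hZ : Integrable Z P) :
    ∫ ξ : Fin m → Ξ, 1 / (m : ℝ) * ∑ k, Z (ξ k) ∂(Measure.pi fun _ => P) = ∫ ζ, Z ζ ∂P := by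
  have hm' : (m : ℝ) ≠ 0 := by positivity
  rw [integral_const_mul, integral_finsetSum _ fun k _ =>
    integrable_comp_eval (μ := fun _ : Fin m => P) (i := k) hZ]
  have : ∀ k : Fin m, ∫ ξ : Fin m → Ξ, Z (ξ k) ∂(Measure.pi fun _ => P) = ∫ ζ, Z ζ ∂P := fun k =>
    integral_comp_eval (μ := fun _ : Fin m => P) (i := k) hZ.aestronglyMeasurable
  simp only [this, Finset.sum_const, Finset.card_univ, Fintype.card_fin, nsmul_eq_mul]
  field_simp

/-- By independence the variance of the average is `1 / m` times that of one summand, which is at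
most its second moment. -/
lemma integral_average_sub_sq_le {m : ℕ} (hm : 0 < m) {Z : Ξ → ℝ} (hZ : MemLp Z 2 P) :
    ∫ ξ : Fin m → Ξ, (1 / (m : ℝ) * ∑ k, Z (ξ k) - ∫ ζ, Z ζ ∂P) ^ 2 ∂(Measure.pi fun _ => P)
      ≤ (∫ ζ, Z ζ ^ 2 ∂P) / m := by
  have hm' : (m : ℝ) ≠ 0 := by positivity
  have hmean := integral_average_pi hm (hZ.integrable (by norm_num))
  have hv := ProbabilityTheory.variance_sum_pi (μ := fun _ : Fin m => P)
    (X := fun _ => Z) (fun _ => hZ)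
  have hmeas : AEMeasurable (fun ξ : Fin m → Ξ => 1 / (m : ℝ) * ∑ k, Z (ξ k))
      (Measure.pi fun _ => P) := by
    refine AEMeasurable.const_mul (Finset.aemeasurable_fun_sum _ fun k _ => ?_) _
    exact hZ.aemeasurable.comp_quasiMeasurePreserving
      (Measure.quasiMeasurePreserving_eval (μ := fun _ : Fin m => P) k)
  have h1 : ProbabilityTheory.variance (fun ξ : Fin m → Ξ => 1 / (m : ℝ) * ∑ k, Z (ξ k))
      (Measure.pi fun _ => P) = ProbabilityTheory.variance Z P / m := by
    rw [ProbabilityTheory.variance_const_mul]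
    have e : (fun ξ : Fin m → Ξ => ∑ k, Z (ξ k)) = ∑ k, fun ξ : Fin m → Ξ => Z (ξ k) := by
      ext ξ; simp
    rw [e, hv]
    simp
    field_simp
  rw [ProbabilityTheory.variance_eq_integral hmeas, hmean] at h1
  rw [h1]
  gcongr
  rw [ProbabilityTheory.variance_eq_sub hZ]
  have : 0 ≤ (∫ ζ, Z ζ ∂P) ^ 2 := sq_nonneg _
  simp only [Pi.pow_apply]
  linarith

lemma memLp_two_of_abs_le {Z : Ξ → ℝ} (hZ : Measurable Z) {K : ℝ} (hK : ∀ ζ, |Z ζ| ≤ K) :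
    MemLp Z 2 P :=
  MemLp.of_bound hZ.aestronglyMeasurable K (Filter.Eventually.of_forall hK)

lemma integral_sq_le_of_abs_le {Z : Ξ → ℝ} {K : ℝ} (hK : ∀ ζ, |Z ζ| ≤ K) :
    ∫ ζ, Z ζ ^ 2 ∂P ≤ K ^ 2 := by
  refine (integral_mono_of_nonneg (Filter.Eventually.of_forall fun ζ => sq_nonneg _)
    (integrable_const (K ^ 2)) (Filter.Eventually.of_forall fun ζ => ?_)).trans (by simp)
  exact sq_le_sq' (abs_le.1 (hK ζ)).1 (abs_le.1 (hK ζ)).2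

omit [MeasurableSpace Ξ] in
lemma abs_average_le {m : ℕ} (hm : 0 < m) {Z : Ξ → ℝ} {K : ℝ} (hK : ∀ ζ, |Z ζ| ≤ K)
    (ξ : Fin m → Ξ) : |1 / (m : ℝ) * ∑ k, Z (ξ k)| ≤ K := by
  rw [abs_mul, abs_of_nonneg (by positivity : (0 : ℝ) ≤ 1 / m)]
  exact (mul_le_mul_of_nonneg_left (Finset.abs_sum_le_sum_abs _ _) (by positivity)).trans
    (one_div_mul_sum_le hm fun k => hK _)

/-- The mean square of a sample average. -/
lemma integral_average_quadratic_le {m : ℕ} (hm : 0 < m) {Z : Ξ → ℝ} (hZ : Measurable Z) {K : ℝ}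
    (hK : ∀ ζ, |Z ζ| ≤ K) (c y : ℝ) :
    ∫ ξ : Fin m → Ξ, ((c + 1 / (m : ℝ) * ∑ k, Z (ξ k)) ^ 2
        - 2 * (c + 1 / (m : ℝ) * ∑ k, Z (ξ k)) * y) ∂(Measure.pi fun _ => P)
      ≤ (c + ∫ ζ, Z ζ ∂P) ^ 2 - 2 * (c + ∫ ζ, Z ζ ∂P) * y + K ^ 2 / m := by
  have hZ2 : MemLp Z 2 P := memLp_two_of_abs_le hZ hK
  have hm' : (m : ℝ) ≠ 0 := by positivity
  set z := ∫ ζ, Z ζ ∂P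
  have hmean := integral_average_pi hm (hZ2.integrable (by norm_num))
  have hvar := (integral_average_sub_sq_le hm hZ2).trans
    (div_le_div_of_nonneg_right (integral_sq_le_of_abs_le hK) (by positivity))
  have hA : Measurable fun ξ : Fin m → Ξ => 1 / (m : ℝ) * ∑ k, Z (ξ k) := by fun_prop
  have hAb := fun ξ : Fin m → Ξ => abs_average_le hm hK ξ
  set A : (Fin m → Ξ) → ℝ := fun ξ => 1 / (m : ℝ) * ∑ k, Z (ξ k)
  have hAi : Integrable A (Measure.pi fun _ => P) :=
    Integrable.of_bound hA.aestronglyMeasurable K (Filter.Eventually.of_forall hAb)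
  have hAi2 : Integrable (fun ξ => (A ξ - z) ^ 2) (Measure.pi fun _ : Fin m => P) := by
    refine Integrable.of_bound (by fun_prop) ((K + |z|) ^ 2)
      (Filter.Eventually.of_forall fun ξ => ?_)
    rw [norm_pow, Real.norm_eq_abs]
    gcongr
    exact (abs_sub _ _).trans (by gcongr; exact hAb ξ)
  -- Expansion around the mean: apart from the square, whose integral is the variance, the
  -- expression is affine in `A ξ` and only sees the mean.
  have e : ∀ ξ, (c + A ξ) ^ 2 - 2 * (c + A ξ) * y
      = (A ξ - z) ^ 2 + ((2 * (c + z) - 2 * y) * A ξ + (c ^ 2 - z ^ 2 - 2 * c * y)) := fun ξ => by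
    ring
  change ∫ ξ, ((c + A ξ) ^ 2 - 2 * (c + A ξ) * y) ∂_ ≤ _
  change ∫ ξ, (A ξ - z) ^ 2 ∂_ ≤ _ at hvar
  change ∫ ξ, A ξ ∂_ = z at hmean
  simp_rw [e]
  have hlin : Integrable (fun ξ => (2 * (c + z) - 2 * y) * A ξ + (c ^ 2 - z ^ 2 - 2 * c * y))
      (Measure.pi fun _ : Fin m => P) := (hAi.const_mul _).add (integrable_const _)
  rw [integral_add hAi2 hlin, integral_add (hAi.const_mul _) (integrable_const _), integral_const_mul, hmean]
  simp only [integral_const, probReal_univ, one_smul]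
  linarith

/-- The mean norm of a sample average of vectors. -/
lemma integral_norm_average_le {m d : ℕ} (hm : 0 < m) {W : Ξ → EuclideanSpace ℝ (Fin d)}
    (hW : Measurable W) {K : ℝ} (hK : ∀ ζ, ‖W ζ‖ ≤ K) :
    ∫ ξ : Fin m → Ξ, ‖(1 / (m : ℝ)) • ∑ k, W (ξ k)‖ ∂(Measure.pi fun _ => P)
      ≤ ‖∫ ζ, W ζ ∂P‖ + K / √m := by
  have : Nonempty Ξ := P.nonempty_of_neZero
  have hK0 : 0 ≤ K := (norm_nonneg _).trans (hK (Classical.arbitrary Ξ))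
  have hm' : (0 : ℝ) < m := by positivity
  set v := ∫ ζ, W ζ ∂P
  have hWi : Integrable W P :=
    Integrable.of_bound hW.aestronglyMeasurable K (Filter.Eventually.of_forall hK)
  have hWj : ∀ j, Measurable fun ζ => W ζ j := fun j => by fun_prop
  have hKj : ∀ j ζ, |W ζ j| ≤ K := fun j ζ => (PiLp.norm_apply_le (W ζ) j).trans (hK ζ)
  have hvj : ∀ j, v j = ∫ ζ, W ζ j ∂P := fun j =>
    ((EuclideanSpace.proj (𝕜 := ℝ) j).integral_comp_comm hWi).symm
  set A : (Fin m → Ξ) → EuclideanSpace ℝ (Fin d) := fun ξ => (1 / (m : ℝ)) • ∑ k, W (ξ k)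
  have hA : Measurable A := by fun_prop
  have hAj : ∀ ξ j, A ξ j = 1 / (m : ℝ) * ∑ k, W (ξ k) j := fun ξ j => by
    simp [A]
  have hAb : ∀ ξ, ‖A ξ‖ ≤ K := fun ξ => by
    simp only [A]
    rw [norm_smul, Real.norm_of_nonneg (by positivity : (0 : ℝ) ≤ 1 / m)]
    exact (mul_le_mul_of_nonneg_left (norm_sum_le _ _) (by positivity)).trans
      (one_div_mul_sum_le hm fun k => hK _)
  have hdb : ∀ ξ, |‖A ξ - v‖| ≤ K + ‖v‖ := fun ξ => by
    rw [abs_norm]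
    exact (norm_sub_le _ _).trans (by gcongr; exact hAb ξ)
  have hdm : Measurable fun ξ => ‖A ξ - v‖ := by fun_prop
  have hd2 : MemLp (fun ξ => ‖A ξ - v‖) 2 (Measure.pi fun _ : Fin m => P) :=
    memLp_two_of_abs_le hdm hdb
  have hd1 := hd2.integrable (by norm_num : (1 : ENNReal) ≤ 2)
  have hcoord : ∀ j, ∫ ξ, (A ξ j - v j) ^ 2 ∂(Measure.pi fun _ : Fin m => P)
      ≤ (∫ ζ, W ζ j ^ 2 ∂P) / m := fun j => by
    simp_rw [hAj, hvj]
    exact integral_average_sub_sq_le hm (memLp_two_of_abs_le (hWj j) (hKj j))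
  have hcint : ∀ j, Integrable (fun ξ => (A ξ j - v j) ^ 2) (Measure.pi fun _ : Fin m => P) :=
    fun j => by
      refine Integrable.of_bound (by fun_prop) ((K + ‖v‖) ^ 2)
        (Filter.Eventually.of_forall fun ξ => ?_)
      rw [norm_pow]
      gcongr
      have h := PiLp.norm_apply_le (A ξ - v) j
      have h2 := hdb ξ
      rw [abs_norm] at h2
      exact h.trans h2
  have hWint : ∀ j, Integrable (fun ζ => W ζ j ^ 2) P := fun j =>
    (memLp_two_of_abs_le (hWj j) (hKj j)).integrable_sq
  have hsq : ∫ ξ, ‖A ξ - v‖ ^ 2 ∂(Measure.pi fun _ : Fin m => P) ≤ K ^ 2 / m := by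
    simp_rw [EuclideanSpace.norm_sq_eq, Real.norm_eq_abs, sq_abs, PiLp.sub_apply]
    rw [integral_finsetSum _ fun j _ => hcint j]
    refine (Finset.sum_le_sum fun j _ => hcoord j).trans ?_
    rw [← Finset.sum_div, ← integral_finsetSum _ fun j _ => hWint j]
    gcongr
    have e : ∀ ζ, ∑ j, W ζ j ^ 2 = ‖W ζ‖ ^ 2 := fun ζ => by
      simp [EuclideanSpace.norm_sq_eq]
    simp_rw [e]
    exact integral_sq_le_of_abs_le fun ζ => by rw [abs_norm]; exact hK ζ
  -- Nonnegativity of the variance of `‖A ξ - v‖` bounds the square of its mean by its mean square.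
  have hd : ∫ ξ, ‖A ξ - v‖ ∂(Measure.pi fun _ : Fin m => P) ≤ K / √m := by
    have h1 := ProbabilityTheory.variance_nonneg (fun ξ => ‖A ξ - v‖)
      (Measure.pi fun _ : Fin m => P)
    rw [ProbabilityTheory.variance_eq_sub hd2] at h1
    simp only [Pi.pow_apply] at h1
    have h2 : (∫ ξ, ‖A ξ - v‖ ∂(Measure.pi fun _ : Fin m => P)) ^ 2 ≤ (K / √m) ^ 2 := by
      rw [div_pow, Real.sq_sqrt hm'.le]
      linarith
    exact le_of_sq_le_sq h2 (by positivity)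
  calc _ ≤ ∫ ξ, (‖v‖ + ‖A ξ - v‖) ∂(Measure.pi fun _ : Fin m => P) := by
        refine integral_mono (Integrable.of_bound hA.norm.aestronglyMeasurable K
          (Filter.Eventually.of_forall fun ξ => by rw [norm_norm]; exact hAb ξ))
          ((integrable_const _).add hd1) fun ξ => ?_
        have := norm_add_le v (A ξ - v)
        rwa [add_sub_cancel] at this
    _ = ‖v‖ + ∫ ξ, ‖A ξ - v‖ ∂(Measure.pi fun _ : Fin m => P) := by
        rw [integral_add (integrable_const _) hd1]
        simp
    _ ≤ _ := by gcongr

end Sampling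

/-! ### Networks formed from independently sampled neurons -/

section SampledNets

variable {d m : ℕ} {τ B Y : ℝ} {Ξ : Type*} [MeasurableSpace Ξ] {P : Measure Ξ}
  [IsProbabilityMeasure P]

/-- The parameters of the network formed from sampled neurons. -/
def sampledParam (c : ℝ) (a b : Ξ → ℝ) (w : Ξ → EuclideanSpace ℝ (Fin d)) (ξ : Fin m → Ξ) :
    NetParam d m :=
  (c, fun k => a (ξ k), fun k => w (ξ k), fun k => b (ξ k))

/-- The mean loss of a sampled network at a point. -/
lemma integral_netLoss_sampledParam_le (hm : 0 < m) (hτ : 1 ≤ τ)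
    {a b : Ξ → ℝ} {w : Ξ → EuclideanSpace ℝ (Fin d)} (ha : Measurable a) (hb : Measurable b)
    (hw : Measurable w) {A c : ℝ} (haA : ∀ ζ, |a ζ| ≤ A) (hw1 : ∀ ζ, l1Norm (w ζ) = 1)
    (hb1 : ∀ ζ, |b ζ| ≤ 1) (hcB : |c| ≤ 2 * B) (hAB : A ≤ 16 * B)
    {y : EuclideanSpace ℝ (Fin d) → ℝ} {x : EuclideanSpace ℝ (Fin d)} (hx : ∀ i, |x i| ≤ 1) :
    ∫ ξ : Fin m → Ξ, netLoss τ y (sampledParam c a b w ξ) x ∂(Measure.pi fun _ => P)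
      ≤ (c + ∫ ζ, a ζ * softplus τ (inner ℝ (w ζ) x + b ζ) ∂P) ^ 2
        - 2 * (c + ∫ ζ, a ζ * softplus τ (inner ℝ (w ζ) x + b ζ) ∂P) * y x
        + ‖∫ ζ, (a ζ * Real.sigmoid (τ * (inner ℝ (w ζ) x + b ζ))) • w ζ ∂P‖
        + ((3 * A) ^ 2 / m + A / √m) := by
  have hτ' : 0 < τ := by linarith
  have hsp := (continuous_softplus hτ').measurable
  have hsg := continuous_sigmoid.measurable
  have hA0 : 0 ≤ A := by
    have : Nonempty Ξ := P.nonempty_of_neZero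
    exact (abs_nonneg _).trans (haA (Classical.arbitrary Ξ))
  have hpar : ∀ ξ : Fin m → Ξ, sampledParam c a b w ξ ∈ netParams d m B := fun ξ =>
    ⟨hcB, fun k => ⟨(haA _).trans hAB, hw1 _, hb1 _⟩⟩
  have hZ : Measurable fun ζ => a ζ * softplus τ (inner ℝ (w ζ) x + b ζ) :=
    ha.mul (hsp.comp ((hw.inner measurable_const).add hb))
  have hZb : ∀ ζ, |a ζ * softplus τ (inner ℝ (w ζ) x + b ζ)| ≤ 3 * A := fun ζ => by
    rw [abs_mul, mul_comm]
    gcongr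
    · exact abs_softplus_le_three hτ (abs_preactivation_le (hw1 ζ) (hb1 ζ) hx)
    · exact haA ζ
  have hW : Measurable fun ζ => (a ζ * Real.sigmoid (τ * (inner ℝ (w ζ) x + b ζ))) • w ζ :=
    (ha.mul (hsg.comp (((hw.inner measurable_const).add hb).const_mul τ))).smul hw
  have hWb : ∀ ζ, ‖(a ζ * Real.sigmoid (τ * (inner ℝ (w ζ) x + b ζ))) • w ζ‖ ≤ A := fun ζ => by
    rw [norm_smul, norm_mul, Real.norm_eq_abs, Real.norm_eq_abs]
    have := (norm_le_l1Norm (w ζ)).trans (hw1 ζ).le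
    calc _ ≤ A * 1 * 1 := by
          gcongr
          · exact haA ζ
          · exact abs_sigmoid_le_one _
      _ = A := by ring
  have h1 := integral_average_quadratic_le (P := P) hm hZ hZb c (y x)
  have h2 := integral_norm_average_le (P := P) hm hW hWb
  have hi2 : Integrable (fun ξ : Fin m → Ξ => ‖netGrad τ (sampledParam c a b w ξ) x‖)
      (Measure.pi fun _ => P) := by
    refine Integrable.of_bound ?_ (16 * B) (Filter.Eventually.of_forall fun ξ => ?_)
    · have hsum : Measurable fun ξ : Fin m → Ξ =>
          ∑ k, (a (ξ k) * Real.sigmoid (τ * (inner ℝ (w (ξ k)) x + b (ξ k)))) • w (ξ k) :=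
        Finset.measurable_fun_sum _ fun k _ => hW.comp (measurable_pi_apply k)
      exact (hsum.const_smul (1 / (m : ℝ))).norm.aestronglyMeasurable
    · rw [norm_norm]
      exact norm_netGrad_le hm (hpar ξ)
  have hi1 : Integrable (fun ξ : Fin m → Ξ => net τ (sampledParam c a b w ξ) x ^ 2
      - 2 * net τ (sampledParam c a b w ξ) x * y x) (Measure.pi fun _ => P) := by
    have hmeas : Measurable fun ξ : Fin m → Ξ => net τ (sampledParam c a b w ξ) x := by
      have : Measurable fun ξ : Fin m → Ξ => c + 1 / (m : ℝ) *
          ∑ k, a (ξ k) * softplus τ (inner ℝ (w (ξ k)) x + b (ξ k)) :=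
        ((Finset.measurable_fun_sum _ fun k _ =>
          hZ.comp (measurable_pi_apply k)).const_mul _).const_add _
      exact this
    have hnb := fun ξ : Fin m → Ξ => abs_net_le (x := x) hm hτ (hpar ξ) hx
    refine Integrable.of_bound ((hmeas.pow_const 2).sub
      ((hmeas.const_mul 2).mul_const _)).aestronglyMeasurable
      ((50 * B) ^ 2 + 2 * (50 * B) * |y x|) (Filter.Eventually.of_forall fun ξ => ?_)
    refine (norm_sub_le _ _).trans ?_
    rw [norm_pow, norm_mul, norm_mul, Real.norm_eq_abs, Real.norm_eq_abs, Real.norm_eq_abs,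
      abs_two]
    gcongr <;> exact hnb ξ
  have e : ∀ ξ : Fin m → Ξ, netLoss τ y (sampledParam c a b w ξ) x
      = (net τ (sampledParam c a b w ξ) x ^ 2 - 2 * net τ (sampledParam c a b w ξ) x * y x)
        + ‖netGrad τ (sampledParam c a b w ξ) x‖ := fun ξ => rfl
  simp_rw [e]
  rw [integral_add hi1 hi2]
  have h1' : ∫ ξ : Fin m → Ξ, (net τ (sampledParam c a b w ξ) x ^ 2
      - 2 * net τ (sampledParam c a b w ξ) x * y x) ∂(Measure.pi fun _ => P) ≤ _ := h1
  have h2' : ∫ ξ : Fin m → Ξ, ‖netGrad τ (sampledParam c a b w ξ) x‖ ∂(Measure.pi fun _ => P)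
      ≤ _ := h2
  linarith

/-- Existence of a network whose expected loss is not much larger than that of an average of
neurons. -/
lemma exists_net_integral_le (hm : 0 < m) (hτ : 1 ≤ τ)
    {ρ : Measure (EuclideanSpace ℝ (Fin d))} [IsProbabilityMeasure ρ]
    {y : EuclideanSpace ℝ (Fin d) → ℝ} (hym : AEMeasurable y ρ)
    (hρ : ∀ᵐ x ∂ρ, (∀ i, |x i| ≤ 1) ∧ |y x| ≤ Y)
    {a b : Ξ → ℝ} {w : Ξ → EuclideanSpace ℝ (Fin d)} (ha : Measurable a) (hb : Measurable b)
    (hw : Measurable w) {A c : ℝ} (haA : ∀ ζ, |a ζ| ≤ A) (hw1 : ∀ ζ, l1Norm (w ζ) = 1)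
    (hb1 : ∀ ζ, |b ζ| ≤ 1) (hcB : |c| ≤ 2 * B) (hAB : A ≤ 16 * B)
    {g : EuclideanSpace ℝ (Fin d) → ℝ} (hg : Integrable g ρ)
    (hgle : ∀ᵐ x ∂ρ, (c + ∫ ζ, a ζ * softplus τ (inner ℝ (w ζ) x + b ζ) ∂P) ^ 2
        - 2 * (c + ∫ ζ, a ζ * softplus τ (inner ℝ (w ζ) x + b ζ) ∂P) * y x
        + ‖∫ ζ, (a ζ * Real.sigmoid (τ * (inner ℝ (w ζ) x + b ζ))) • w ζ ∂P‖ ≤ g x) :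
    ∃ p ∈ netParams d m B,
      ∫ x, netLoss τ y p x ∂ρ ≤ (∫ x, g x ∂ρ) + ((3 * A) ^ 2 / m + A / √m) := by
  have hτ' : 0 < τ := by linarith
  have hpar : ∀ ξ : Fin m → Ξ, sampledParam c a b w ξ ∈ netParams d m B := fun ξ =>
    ⟨hcB, fun k => ⟨(haA _).trans hAB, hw1 _, hb1 _⟩⟩
  have hpm : Measurable fun ξ : Fin m → Ξ => sampledParam c a b w ξ := by
    unfold sampledParam
    fun_prop
  have hJ : Integrable (fun q : EuclideanSpace ℝ (Fin d) × (Fin m → Ξ) =>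
      netLoss τ y (sampledParam c a b w q.2) q.1) (ρ.prod (Measure.pi fun _ => P)) := by
    have hpq : Measurable fun q : EuclideanSpace ℝ (Fin d) × (Fin m → Ξ) =>
        (sampledParam c a b w q.2, q.1) := (hpm.comp measurable_snd).prodMk measurable_fst
    have h1 : Measurable fun q : EuclideanSpace ℝ (Fin d) × (Fin m → Ξ) =>
        net τ (sampledParam c a b w q.2) q.1 := by
      have := (continuous_net (d := d) (m := m) hτ').measurable.comp hpq
      exact this
    have h2 : Measurable fun q : EuclideanSpace ℝ (Fin d) × (Fin m → Ξ) =>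
        netGrad τ (sampledParam c a b w q.2) q.1 := by
      have := (continuous_netGrad (d := d) (m := m) τ).measurable.comp hpq
      exact this
    have h3 : AEMeasurable (fun q : EuclideanSpace ℝ (Fin d) × (Fin m → Ξ) => y q.1)
        (ρ.prod (Measure.pi fun _ => P)) :=
      hym.comp_quasiMeasurePreserving Measure.quasiMeasurePreserving_fst
    have h4 : ∀ᵐ q ∂(ρ.prod (Measure.pi fun _ : Fin m => P)),
        (∀ i, |q.1 i| ≤ 1) ∧ |y q.1| ≤ Y := Measure.quasiMeasurePreserving_fst.ae hρ
    refine Integrable.of_bound ?_ (lossBound B Y) ?_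
    · unfold netLoss
      exact (((h1.pow_const 2).aemeasurable.sub (((h1.const_mul 2).aemeasurable).mul h3)).add
        h2.norm.aemeasurable).aestronglyMeasurable
    · filter_upwards [h4] with q hq
      exact abs_netLoss_le hm hτ (hpar _) hq.1 hq.2
  -- Some draw has an expected loss no larger than the average over draws. Exchanging the integrals
  -- then allows the pointwise estimate in `x` to be used.
  obtain ⟨ξ, hξ⟩ := exists_le_integral hJ.integral_prod_right
  refine ⟨_, hpar ξ, hξ.trans ?_⟩
  rw [← integral_prod_symm _ hJ, integral_prod _ hJ]
  calc _ ≤ ∫ x, (g x + ((3 * A) ^ 2 / m + A / √m)) ∂ρ := by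
        refine integral_mono_ae hJ.integral_prod_left (hg.add (integrable_const _)) ?_
        filter_upwards [hρ, hgle] with x hx hgx
        exact (integral_netLoss_sampledParam_le hm hτ ha hb hw haA hw1 hb1 hcB hAB hx.1).trans
          (by gcongr)
    _ = _ := by
        rw [integral_add hg (integrable_const _)]
        simp

end SampledNets

/-! ### Barron functions -/

section Barron

variable {d : ℕ}

/-- The value at frequency `w` of the profile of a ridge function, as a function of the projection
of the argument. -/
def ridge (θ : EuclideanSpace ℝ (Fin d) → ℝ) (w : EuclideanSpace ℝ (Fin d)) (t : ℝ) : ℝ :=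
  Real.cos (l1Norm w * t + θ w) / (1 + l1Norm w) ^ 2

/-- The derivative of `ridge`. -/
def ridge' (θ : EuclideanSpace ℝ (Fin d) → ℝ) (w : EuclideanSpace ℝ (Fin d)) (t : ℝ) : ℝ :=
  -(l1Norm w * Real.sin (l1Norm w * t + θ w)) / (1 + l1Norm w) ^ 2

/-- The second derivative of `ridge`. -/
def ridge'' (θ : EuclideanSpace ℝ (Fin d) → ℝ) (w : EuclideanSpace ℝ (Fin d)) (t : ℝ) : ℝ :=
  -(l1Norm w ^ 2 * Real.cos (l1Norm w * t + θ w)) / (1 + l1Norm w) ^ 2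

variable {θ : EuclideanSpace ℝ (Fin d) → ℝ}

lemma hasDerivAt_ridge (w : EuclideanSpace ℝ (Fin d)) (t : ℝ) :
    HasDerivAt (ridge θ w) (ridge' θ w t) t := by
  have h : HasDerivAt (fun t => l1Norm w * t + θ w) (l1Norm w) t := by
    simpa using ((hasDerivAt_id t).const_mul (l1Norm w)).add_const (θ w)
  exact (h.cos.div_const _).congr_deriv (by unfold ridge'; ring)

lemma hasDerivAt_ridge' (w : EuclideanSpace ℝ (Fin d)) (t : ℝ) :
    HasDerivAt (ridge' θ w) (ridge'' θ w t) t := by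
  have h : HasDerivAt (fun t => l1Norm w * t + θ w) (l1Norm w) t := by
    simpa using ((hasDerivAt_id t).const_mul (l1Norm w)).add_const (θ w)
  exact ((h.sin.const_mul (l1Norm w)).fun_neg.div_const _).congr_deriv (by unfold ridge''; ring)

lemma continuous_ridge'' (w : EuclideanSpace ℝ (Fin d)) : Continuous (ridge'' θ w) := by
  unfold ridge''
  fun_prop

lemma abs_ridge_le (w : EuclideanSpace ℝ (Fin d)) (t : ℝ) : |ridge θ w t| ≤ 1 := by
  have h := l1Norm_nonneg w
  rw [ridge, abs_div, abs_of_nonneg (a := (1 + l1Norm w) ^ 2) (by positivity),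
    div_le_one (by positivity)]
  exact (Real.abs_cos_le_one _).trans (by nlinarith)

lemma abs_ridge'_le (w : EuclideanSpace ℝ (Fin d)) (t : ℝ) : |ridge' θ w t| ≤ 1 := by
  have h := l1Norm_nonneg w
  rw [ridge', abs_div, abs_neg, abs_mul, abs_of_nonneg h,
    abs_of_nonneg (a := (1 + l1Norm w) ^ 2) (by positivity), div_le_one (by positivity)]
  have := Real.abs_sin_le_one (l1Norm w * t + θ w)
  nlinarith

/-- Two derivatives bring down `|w|₁ ^ 2`, which the denominator absorbs; this is where the exponent
`2` of the Barron weight is needed. -/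
lemma abs_ridge''_le (w : EuclideanSpace ℝ (Fin d)) (t : ℝ) : |ridge'' θ w t| ≤ 1 := by
  have h := l1Norm_nonneg w
  rw [ridge'', abs_div, abs_neg, abs_mul, abs_of_nonneg (a := l1Norm w ^ 2) (by positivity),
    abs_of_nonneg (a := (1 + l1Norm w) ^ 2) (by positivity), div_le_one (by positivity)]
  have := Real.abs_cos_le_one (l1Norm w * t + θ w)
  nlinarith [sq_nonneg (l1Norm w)]

lemma measurable_ridge (hθ : Measurable θ) :
    Measurable fun q : EuclideanSpace ℝ (Fin d) × ℝ => ridge θ q.1 q.2 := by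
  have := (continuous_l1Norm (d := d)).measurable
  unfold ridge
  fun_prop

lemma measurable_ridge' (hθ : Measurable θ) :
    Measurable fun q : EuclideanSpace ℝ (Fin d) × ℝ => ridge' θ q.1 q.2 := by
  have := (continuous_l1Norm (d := d)).measurable
  unfold ridge'
  fun_prop

lemma measurable_ridge'' (hθ : Measurable θ) :
    Measurable fun q : EuclideanSpace ℝ (Fin d) × ℝ => ridge'' θ q.1 q.2 := by
  have := (continuous_l1Norm (d := d)).measurable
  unfold ridge''
  fun_prop

open Classical in
/-- The `ℓ¹`-normalization of a vector; a coordinate vector for the zero vector. -/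
def l1Dir (i₀ : Fin d) (w : EuclideanSpace ℝ (Fin d)) : EuclideanSpace ℝ (Fin d) :=
  if l1Norm w = 0 then EuclideanSpace.single i₀ 1 else (l1Norm w)⁻¹ • w

lemma measurable_l1Dir (i₀ : Fin d) : Measurable (l1Dir i₀) := by
  have h := (continuous_l1Norm (d := d)).measurable
  exact Measurable.ite (h (measurableSet_singleton 0)) measurable_const (by fun_prop)

lemma l1Norm_l1Dir (i₀ : Fin d) (w : EuclideanSpace ℝ (Fin d)) : l1Norm (l1Dir i₀ w) = 1 := by
  unfold l1Dir
  split_ifs with h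
  · simp only [l1Norm, PiLp.single_apply]
    rw [Finset.sum_eq_single i₀] <;> simp +contextual
  · have h0 := l1Norm_nonneg w
    have : l1Norm ((l1Norm w)⁻¹ • w) = (l1Norm w)⁻¹ * l1Norm w := by
      conv_lhs => rw [l1Norm]
      simp only [PiLp.smul_apply, smul_eq_mul, abs_mul, ← Finset.mul_sum]
      rw [abs_of_nonneg (by positivity)]
      rfl
    rw [this, inv_mul_cancel₀ h]

lemma l1Norm_smul_l1Dir (i₀ : Fin d) (w : EuclideanSpace ℝ (Fin d)) :
    l1Norm w • l1Dir i₀ w = w := by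
  unfold l1Dir
  split_ifs with h
  · have : w = 0 := norm_le_zero_iff.1 ((norm_le_l1Norm w).trans h.le)
    rw [h, zero_smul, this]
  · rw [smul_inv_smul₀ h]

end Barron

/-! ### Barron functions as averages of ridge functions -/

section BarronExt

variable {d : ℕ} {θ : EuclideanSpace ℝ (Fin d) → ℝ} {Λ : Measure (EuclideanSpace ℝ (Fin d))}
  [IsProbabilityMeasure Λ]

/-- The average of ridge functions over random frequencies. -/
def barronExt (θ : EuclideanSpace ℝ (Fin d) → ℝ) (Λ : Measure (EuclideanSpace ℝ (Fin d)))
    (r : ℝ) (x : EuclideanSpace ℝ (Fin d)) : ℝ :=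
  r * ∫ w, Real.cos (inner ℝ w x + θ w) / (1 + l1Norm w) ^ 2 ∂Λ

lemma l1Norm_mul_inner_l1Dir (i₀ : Fin d) (w x : EuclideanSpace ℝ (Fin d)) :
    l1Norm w * inner ℝ (l1Dir i₀ w) x = inner ℝ w x := by
  conv_rhs => rw [← l1Norm_smul_l1Dir i₀ w]
  rw [real_inner_smul_left]

omit [IsProbabilityMeasure Λ] in
lemma barronExt_eq (i₀ : Fin d) (r : ℝ) (x : EuclideanSpace ℝ (Fin d)) :
    barronExt θ Λ r x = r * ∫ w, ridge θ w (inner ℝ (l1Dir i₀ w) x) ∂Λ := by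
  simp only [barronExt, ridge, l1Norm_mul_inner_l1Dir]

lemma abs_barronExt_le {r : ℝ} (hr : 0 ≤ r) (x : EuclideanSpace ℝ (Fin d)) :
    |barronExt θ Λ r x| ≤ r := by
  rw [barronExt, abs_mul, abs_of_nonneg hr]
  refine mul_le_of_le_one_right hr ?_
  rw [← Real.norm_eq_abs]
  refine (norm_integral_le_of_norm_le_const (C := 1)
    (Filter.Eventually.of_forall fun w => ?_)).trans (by simp)
  have h := l1Norm_nonneg w
  rw [Real.norm_eq_abs, abs_div, abs_of_nonneg (a := (1 + l1Norm w) ^ 2) (by positivity),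
    div_le_one (by positivity)]
  exact (Real.abs_cos_le_one _).trans (by nlinarith)

/-- The function is, up to the factor `r`, the real part of a Fourier integral against `Λ`. Its
amplitude decays like `(1 + |w|₁)⁻²`, so its first two moments are finite. -/
lemma contDiff_barronExt (hθ : Measurable θ) (r : ℝ) : ContDiff ℝ 2 (barronExt θ Λ r) := by
  -- The scaling cancels the `2π` and the sign in the convention for the Fourier character.
  let L : EuclideanSpace ℝ (Fin d) →L[ℝ] EuclideanSpace ℝ (Fin d) →L[ℝ] ℝ :=
    (-(1 / (2 * Real.pi))) • innerSL ℝ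
  let f : EuclideanSpace ℝ (Fin d) → ℂ := fun w =>
    Complex.exp (θ w * Complex.I) * (((1 + l1Norm w) ^ 2)⁻¹ : ℝ)
  have hl1 := (continuous_l1Norm (d := d)).measurable
  have hf : Measurable f := by fun_prop
  have hfn : ∀ w, ‖f w‖ = ((1 + l1Norm w) ^ 2)⁻¹ := fun w => by
    simp only [f, norm_mul, Complex.norm_exp_ofReal_mul_I, one_mul, Complex.norm_real]
    exact Real.norm_of_nonneg (by positivity)
  have hfint : ∀ n : ℕ, n ≤ (2 : ℕ∞) → Integrable (fun w => ‖w‖ ^ n * ‖f w‖) Λ := by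
    intro n hn
    refine Integrable.of_bound ((measurable_norm.pow_const n).mul hf.norm).aestronglyMeasurable 1
      (Filter.Eventually.of_forall fun w => ?_)
    have hn2 : n ≤ 2 := by exact_mod_cast hn
    have h := l1Norm_nonneg w
    rw [Real.norm_of_nonneg (by positivity), hfn, mul_inv_le_iff₀ (by positivity), one_mul]
    calc ‖w‖ ^ n ≤ (1 + l1Norm w) ^ n := by
          gcongr
          exact (norm_le_l1Norm w).trans (by linarith)
      _ ≤ (1 + l1Norm w) ^ 2 := pow_le_pow_right₀ (by linarith) hn2
  have hC := VectorFourier.contDiff_fourierIntegral (μ := Λ) (f := f) L (N := 2) hfint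
  have hfi : Integrable f Λ := by
    have := hfint 0 (by simp)
    simp only [pow_zero, one_mul] at this
    exact (integrable_norm_iff hf.aestronglyMeasurable).1 this
  have e : barronExt θ Λ r = fun x => r *
      Complex.reCLM (VectorFourier.fourierIntegral Real.fourierChar Λ L.toLinearMap₁₂ f x) := by
    ext x
    rw [barronExt, VectorFourier.fourierIntegral, ← ContinuousLinearMap.integral_comp_comm]
    · congr 1
      refine integral_congr_ae (Filter.Eventually.of_forall fun w => ?_)
      simp only [Complex.reCLM_apply, f, Circle.smul_def, Real.fourierChar_apply, smul_eq_mul]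
      rw [← mul_assoc, ← Complex.exp_add]
      have : (2 * Real.pi * (-(L.toLinearMap₁₂ w x) : ℝ) : ℝ) = inner ℝ w x := by
        have hpi := Real.pi_ne_zero
        simp [L]
        field_simp
        exact innerSL_apply_apply ℝ w x
      rw [this, ← add_mul, ← Complex.ofReal_add, Complex.re_mul_ofReal, Complex.exp_ofReal_mul_I_re]
      rfl
    · refine Integrable.mono hfi ?_ (Filter.Eventually.of_forall fun w => by simp)
      have hc : Continuous fun w => ((Real.fourierChar (-(L w x)) : Circle) : ℂ) :=
        continuous_subtype_val.comp (Real.continuous_fourierChar.comp (by fun_prop))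
      exact (hc.measurable.mul hf).aestronglyMeasurable
  rw [e]
  exact contDiff_const.mul (Complex.reCLM.contDiff.comp hC)

lemma integrable_ridge'_smul (i₀ : Fin d) (hθ : Measurable θ) (x : EuclideanSpace ℝ (Fin d)) :
    Integrable (fun w => ridge' θ w (inner ℝ (l1Dir i₀ w) x) • l1Dir i₀ w) Λ := by
  have hd := measurable_l1Dir i₀
  refine Integrable.of_bound (((measurable_ridge' hθ).comp
    (measurable_id.prodMk (hd.inner measurable_const))).smul hd).aestronglyMeasurable 1
    (Filter.Eventually.of_forall fun w => ?_)
  rw [norm_smul]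
  exact mul_le_one₀ (abs_ridge'_le _ _) (norm_nonneg _)
    ((norm_le_l1Norm _).trans (l1Norm_l1Dir i₀ w).le)

/-- Differentiation under the integral sign, with majorant one. The result is expressed through the
derivative of the profile and the normalized direction, to be compared with gradients of neurons. -/
lemma gradient_barronExt (i₀ : Fin d) (hθ : Measurable θ) (r : ℝ)
    (x : EuclideanSpace ℝ (Fin d)) :
    gradient (barronExt θ Λ r) x
      = r • ∫ w, ridge' θ w (inner ℝ (l1Dir i₀ w) x) • l1Dir i₀ w ∂Λ := by
  have hl1 := (continuous_l1Norm (d := d)).measurable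
  have hcos : ∀ x, Measurable fun w : EuclideanSpace ℝ (Fin d) =>
      Real.cos (inner ℝ w x + θ w) / (1 + l1Norm w) ^ 2 := fun x => by fun_prop
  have hb : ∀ x : EuclideanSpace ℝ (Fin d), ∀ w : EuclideanSpace ℝ (Fin d),
      ‖(-Real.sin (inner ℝ w x + θ w) / (1 + l1Norm w) ^ 2) • innerSL ℝ w‖ ≤ 1 := by
    intro x w
    have h := l1Norm_nonneg w
    rw [norm_smul, innerSL_apply_norm, Real.norm_eq_abs, abs_div, abs_neg,
      abs_of_nonneg (a := (1 + l1Norm w) ^ 2) (by positivity), div_mul_eq_mul_div,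
      div_le_one (by positivity)]
    have h1 := Real.abs_sin_le_one (inner ℝ w x + θ w)
    have h2 := norm_le_l1Norm w
    have h3 := norm_nonneg w
    nlinarith [abs_nonneg (Real.sin (inner ℝ w x + θ w))]
  have hF' : Measurable fun w : EuclideanSpace ℝ (Fin d) =>
      (-Real.sin (inner ℝ w x + θ w) / (1 + l1Norm w) ^ 2) • innerSL ℝ w := by
    have h1 : Measurable fun w : EuclideanSpace ℝ (Fin d) => innerSL ℝ w :=
      (innerSL ℝ).continuous.measurable
    have h2 : Measurable fun w : EuclideanSpace ℝ (Fin d) =>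
      -Real.sin (inner ℝ w x + θ w) / (1 + l1Norm w) ^ 2 := by fun_prop
    exact h2.smul h1
  have hFi : Integrable (fun w : EuclideanSpace ℝ (Fin d) =>
      (-Real.sin (inner ℝ w x + θ w) / (1 + l1Norm w) ^ 2) • innerSL ℝ w) Λ :=
    Integrable.of_bound hF'.aestronglyMeasurable 1 (Filter.Eventually.of_forall fun w => hb x w)
  have hder := hasFDerivAt_integral_of_dominated_of_fderiv_le (μ := Λ) (𝕜 := ℝ)
    (F := fun x w => Real.cos (inner ℝ w x + θ w) / (1 + l1Norm w) ^ 2)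
    (F' := fun x w => (-Real.sin (inner ℝ w x + θ w) / (1 + l1Norm w) ^ 2) • innerSL ℝ w)
    (x₀ := x) (s := Set.univ) (bound := fun _ => 1) Filter.univ_mem
    (Filter.Eventually.of_forall fun x => (hcos x).aestronglyMeasurable)
    (Integrable.of_bound (hcos x).aestronglyMeasurable 1
      (Filter.Eventually.of_forall fun w => by
        have h := l1Norm_nonneg w
        rw [Real.norm_eq_abs, abs_div, abs_of_nonneg (a := (1 + l1Norm w) ^ 2) (by positivity),
          div_le_one (by positivity)]
        exact (Real.abs_cos_le_one _).trans (by nlinarith)))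
    hF'.aestronglyMeasurable
    (Filter.Eventually.of_forall fun w x _ => hb x w) (integrable_const _)
    (Filter.Eventually.of_forall fun w x _ => by
      have h1 : HasFDerivAt (fun x => inner ℝ w x + θ w) (innerSL ℝ w) x :=
        ((innerSL ℝ w).hasFDerivAt (x := x)).add_const _
      have h2 : HasFDerivAt (fun x => Real.cos (inner ℝ w x + θ w) / (1 + l1Norm w) ^ 2)
          ((-Real.sin (inner ℝ w x + θ w) * 1 / (1 + l1Norm w) ^ 2) • innerSL ℝ w) x :=
        HasDerivAt.comp_hasFDerivAt (h₂ := fun z => Real.cos z / (1 + l1Norm w) ^ 2) x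
          (((hasDerivAt_id _).cos).div_const _) h1
      rwa [mul_one] at h2)
  refine HasGradientAt.gradient ?_
  rw [hasGradientAt_iff_hasFDerivAt]
  refine (hder.const_mul r).congr_fderiv ?_
  ext v
  simp only [smul_apply, InnerProductSpace.toDual_apply_apply,
    real_inner_smul_left, smul_eq_mul]
  rw [ContinuousLinearMap.integral_apply hFi, real_inner_comm,
    ← integral_inner (integrable_ridge'_smul i₀ hθ x)]
  congr 1
  refine integral_congr_ae (Filter.Eventually.of_forall fun w => ?_)
  simp only [smul_apply, innerSL_apply_apply, smul_eq_mul, ridge',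
    real_inner_smul_right, l1Norm_mul_inner_l1Dir]
  rw [← l1Norm_mul_inner_l1Dir i₀ w v, real_inner_comm v]
  ring

/-- A Barron function is an average of ridge functions. -/
lemma IsBarronRep.exists_eq_barronExt {Ω : Set (EuclideanSpace ℝ (Fin d))}
    {u : EuclideanSpace ℝ (Fin d) → ℝ} {F : EuclideanSpace ℝ (Fin d) → ℂ}
    (h : IsBarronRep 2 Ω u F) :
    ∃ (θ : EuclideanSpace ℝ (Fin d) → ℝ) (Λ : Measure (EuclideanSpace ℝ (Fin d))),
      Measurable θ ∧ IsProbabilityMeasure Λ ∧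
      ∀ x ∈ Ω, u x = barronExt θ Λ (∫ w, (1 + l1Norm w) ^ (2 : ℝ) * ‖F w‖) x := by
  have hl1 := (continuous_l1Norm (d := d)).measurable
  have hint := h.integrable
  have heq := h.eq_integral
  have hFm := h.aestronglyMeasurable
  simp only [Real.rpow_two] at hint ⊢
  set r := ∫ w : EuclideanSpace ℝ (Fin d), (1 + l1Norm w) ^ 2 * ‖F w‖
  have hnn : ∀ w, 0 ≤ (1 + l1Norm w) ^ 2 * ‖F w‖ := fun w => by positivity
  have hr : 0 ≤ r := integral_nonneg hnn
  set G := hFm.mk F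
  have hG : StronglyMeasurable G := hFm.stronglyMeasurable_mk
  have hFG : F =ᵐ[volume] G := hFm.ae_eq_mk
  have hFi : Integrable F := by
    refine Integrable.mono hint hFm (Filter.Eventually.of_forall fun w => ?_)
    rw [Real.norm_of_nonneg (hnn w)]
    have := l1Norm_nonneg w
    exact le_mul_of_one_le_left (norm_nonneg _) (by nlinarith)
  have hu : ∀ x ∈ Ω, u x = ∫ w, ‖G w‖ * Real.cos (inner ℝ w x + (G w).arg) := by
    intro x hx
    have hI : Integrable fun w : EuclideanSpace ℝ (Fin d) =>
        Complex.exp (Complex.I * ((inner ℝ w x : ℝ) : ℂ)) * F w := by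
      refine Integrable.mono hFi (AEStronglyMeasurable.mul ?_ hFm)
        (Filter.Eventually.of_forall fun w => ?_)
      · exact (by fun_prop : Continuous fun w : EuclideanSpace ℝ (Fin d) =>
          Complex.exp (Complex.I * ((inner ℝ w x : ℝ) : ℂ))).aestronglyMeasurable
      · rw [norm_mul, mul_comm Complex.I, Complex.norm_exp_ofReal_mul_I, one_mul]
    have e := congrArg Complex.reCLM (heq x hx)
    rw [← ContinuousLinearMap.integral_comp_comm _ hI] at e
    simp only [Complex.reCLM_apply, Complex.ofReal_re] at e
    rw [e]
    refine integral_congr_ae ?_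
    filter_upwards [hFG] with w hw
    rw [hw]
    conv_lhs => rw [← Complex.norm_mul_exp_arg_mul_I (G w)]
    rw [mul_left_comm, mul_comm Complex.I, ← Complex.exp_add, ← add_mul, ← Complex.ofReal_add,
      Complex.re_ofReal_mul, Complex.exp_ofReal_mul_I_re]
  -- For `r = 0` the density cannot be normalized. Then `F` vanishes almost everywhere and so does
  -- `u` on `Ω`, and any probability measure serves.
  rcases hr.eq_or_lt with hr0 | hr0
  · refine ⟨0, Measure.dirac 0, measurable_const, inferInstance, fun x hx => ?_⟩
    rw [← hr0, barronExt, zero_mul, hu x hx]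
    have h0 := (integral_eq_zero_iff_of_nonneg hnn hint).1 hr0.symm
    refine integral_eq_zero_of_ae ?_
    filter_upwards [h0, hFG] with w hw hw2
    have := l1Norm_nonneg w
    have h3 : ‖F w‖ = 0 := (mul_eq_zero.1 hw).resolve_left (by positivity)
    rw [← hw2, h3]
    simp
  · have hint2 : Integrable fun w : EuclideanSpace ℝ (Fin d) => (1 + l1Norm w) ^ 2 * ‖G w‖ / r := by
      refine (hint.div_const r).congr ?_
      filter_upwards [hFG] with w hw
      rw [hw]
    have hone : ∫ w : EuclideanSpace ℝ (Fin d), (1 + l1Norm w) ^ 2 * ‖G w‖ / r = 1 := by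
      rw [integral_div]
      have : ∫ w : EuclideanSpace ℝ (Fin d), (1 + l1Norm w) ^ 2 * ‖G w‖ = r := by
        refine integral_congr_ae ?_
        filter_upwards [hFG] with w hw
        rw [hw]
      rw [this, div_self hr0.ne']
    have hnn2 : ∀ w, 0 ≤ (1 + l1Norm w) ^ 2 * ‖G w‖ / r := fun w => by positivity
    have hGm := hG.measurable
    have hdm : Measurable fun w : EuclideanSpace ℝ (Fin d) => (1 + l1Norm w) ^ 2 * ‖G w‖ / r := by
      fun_prop
    -- The phase of the ridge function is the argument of the Fourier coefficient. Its modulus,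
    -- times the Barron weight and divided by `r`, is the density.
    refine ⟨fun w => (G w).arg, volume.withDensity fun w =>
      ENNReal.ofReal ((1 + l1Norm w) ^ 2 * ‖G w‖ / r), Complex.measurable_arg.comp hGm, ?_,
      fun x hx => ?_⟩
    · refine ⟨?_⟩
      rw [withDensity_apply _ MeasurableSet.univ, Measure.restrict_univ,
        ← ofReal_integral_eq_lintegral_ofReal hint2 (Filter.Eventually.of_forall hnn2), hone,
        ENNReal.ofReal_one]
    · rw [hu x hx, barronExt, integral_withDensity_eq_integral_toReal_smul hdm.ennreal_ofReal
        (Filter.Eventually.of_forall fun w => ENNReal.ofReal_lt_top), ← integral_const_mul]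
      refine integral_congr_ae (Filter.Eventually.of_forall fun w => ?_)
      have := l1Norm_nonneg w
      have h1 : (1 + l1Norm w) ^ 2 ≠ 0 := by positivity
      simp only [ENNReal.toReal_ofReal (hnn2 w), smul_eq_mul]
      field_simp

end BarronExt

/-! ### The random neuron whose mean approximates a Barron function -/

section NeuronLaw

variable {d : ℕ} {θ : EuclideanSpace ℝ (Fin d) → ℝ} {Λ : Measure (EuclideanSpace ℝ (Fin d))}
  [IsProbabilityMeasure Λ]

/-- The uniform distribution on `[-1, 1]`. -/
def unitIntervalLaw : Measure ℝ := (2⁻¹ : ENNReal) • volume.restrict (Set.Ioc (-1) 1)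

instance : IsProbabilityMeasure unitIntervalLaw := by
  refine ⟨?_⟩
  simp only [unitIntervalLaw, Measure.smul_apply, Measure.restrict_apply_univ, Real.volume_Ioc,
    smul_eq_mul]
  norm_num
  exact ENNReal.inv_mul_cancel (by norm_num) (by norm_num)

/-- The uniform distribution on three points. -/
def threeLaw : Measure (Fin 3) := (3⁻¹ : ENNReal) • Measure.count

instance : IsProbabilityMeasure threeLaw := by
  refine ⟨?_⟩
  simp only [threeLaw, Measure.smul_apply, smul_eq_mul, Measure.count_univ]
  simp
  exact ENNReal.inv_mul_cancel (by norm_num) (by norm_num)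

/-- The distribution of the neurons: the kind of neuron, the frequency, and the threshold. -/
def neuronLaw (Λ : Measure (EuclideanSpace ℝ (Fin d))) :
    Measure (Fin 3 × (EuclideanSpace ℝ (Fin d) × ℝ)) :=
  threeLaw.prod (Λ.prod unitIntervalLaw)

instance : IsProbabilityMeasure (neuronLaw Λ) := by
  unfold neuronLaw
  infer_instance

section

variable {G : Type*} [NormedAddCommGroup G] [NormedSpace ℝ G] [CompleteSpace G]

omit [CompleteSpace G] in
lemma integral_unitIntervalLaw (f : ℝ → G) :
    ∫ s, f s ∂unitIntervalLaw = (1 / 2 : ℝ) • ∫ s in (-1 : ℝ)..1, f s := by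
  rw [unitIntervalLaw, integral_smul_measure, intervalIntegral.integral_of_le (by norm_num)]
  congr 1
  simp

lemma integral_threeLaw (f : Fin 3 → G) : ∫ j, f j ∂threeLaw = (1 / 3 : ℝ) • ∑ j, f j := by
  rw [threeLaw, integral_smul_measure, integral_count]
  congr 1
  simp

lemma integral_neuronLaw {F : Fin 3 × (EuclideanSpace ℝ (Fin d) × ℝ) → G}
    (hF : Integrable F (neuronLaw Λ)) :
    Integrable (fun w => (1 / 3 : ℝ) • ∑ j, (1 / 2 : ℝ) • ∫ s in (-1 : ℝ)..1, F (j, (w, s))) Λ ∧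
    ∫ ζ, F ζ ∂neuronLaw Λ
      = ∫ w, ((1 / 3 : ℝ) • ∑ j, (1 / 2 : ℝ) • ∫ s in (-1 : ℝ)..1, F (j, (w, s))) ∂Λ := by
  -- Every point of `Fin 3` has positive mass, so almost everywhere means everywhere in the first
  -- variable.
  have hj : ∀ j, Integrable (fun q => F (j, q)) (Λ.prod unitIntervalLaw) := by
    have h := hF.prod_right_ae
    have h3 : ∀ᵐ j ∂(Measure.count : Measure (Fin 3)),
        Integrable (fun q => F (j, q)) (Λ.prod unitIntervalLaw) :=
      (Measure.ae_ennreal_smul_measure_iff (c := (3⁻¹ : ENNReal)) (by simp)).1 h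
    exact fun j => Measure.ae_count_iff.1 h3 j
  have hjw : ∀ j, Integrable (fun w => (1 / 2 : ℝ) • ∫ s in (-1 : ℝ)..1, F (j, (w, s))) Λ :=
    fun j => by
      have := (hj j).integral_prod_left
      simpa only [integral_unitIntervalLaw] using this
  refine ⟨(integrable_finsetSum _ fun j _ => hjw j).smul _, ?_⟩
  rw [neuronLaw, integral_prod _ hF, integral_threeLaw, integral_smul,
    integral_finsetSum _ fun j _ => hjw j]
  congr 1
  refine Finset.sum_congr rfl fun j _ => ?_
  rw [integral_prod _ (hj j)]
  simp only [integral_unitIntervalLaw]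

end

/-- Truncation of a real number to `[-1, 1]`. -/
def clampUnit (s : ℝ) : ℝ := max (-1) (min s 1)

lemma abs_clampUnit_le (s : ℝ) : |clampUnit s| ≤ 1 :=
  abs_le.2 ⟨le_max_left _ _, max_le (by norm_num) (min_le_right _ _)⟩

lemma clampUnit_of_mem {s : ℝ} (hs : s ∈ Set.uIcc (-1 : ℝ) 1) : clampUnit s = s := by
  rw [Set.uIcc_of_le (by norm_num)] at hs
  rw [clampUnit, min_eq_left hs.2, max_eq_right hs.1]

/-- The outer weights of the random neurons. -/
def neuronWeight (θ : EuclideanSpace ℝ (Fin d) → ℝ) (r : ℝ)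
    (ζ : Fin 3 × (EuclideanSpace ℝ (Fin d) × ℝ)) : ℝ :=
  ![3 * r * ridge' θ ζ.2.1 (-1), -(3 * r * ridge' θ ζ.2.1 (-1)),
    6 * r * ridge'' θ ζ.2.1 (clampUnit ζ.2.2)] ζ.1

/-- The inner weights of the random neurons. -/
def neuronDir (i₀ : Fin d) (ζ : Fin 3 × (EuclideanSpace ℝ (Fin d) × ℝ)) :
    EuclideanSpace ℝ (Fin d) :=
  ![l1Dir i₀ ζ.2.1, -l1Dir i₀ ζ.2.1, l1Dir i₀ ζ.2.1] ζ.1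

/-- The biases of the random neurons. -/
def neuronBias (ζ : Fin 3 × (EuclideanSpace ℝ (Fin d) × ℝ)) : ℝ :=
  ![1, -1, -clampUnit ζ.2.2] ζ.1

lemma measurable_clampUnit : Measurable clampUnit :=
  measurable_const.max (measurable_id.min measurable_const)

lemma measurable_neuronWeight (hθ : Measurable θ) (r : ℝ) : Measurable (neuronWeight θ r) := by
  have h1 : Measurable fun q : EuclideanSpace ℝ (Fin d) × ℝ => ridge' θ q.1 (-1) :=
    (measurable_ridge' hθ).comp (measurable_fst.prodMk measurable_const)
  have h2 : Measurable fun q : EuclideanSpace ℝ (Fin d) × ℝ => ridge'' θ q.1 (clampUnit q.2) :=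
    (measurable_ridge'' hθ).comp (measurable_fst.prodMk (measurable_clampUnit.comp measurable_snd))
  refine measurable_from_prod_countable_right fun j => ?_
  fin_cases j
  · exact h1.const_mul _
  · exact (h1.const_mul _).neg
  · exact h2.const_mul _

lemma measurable_neuronDir (i₀ : Fin d) : Measurable (neuronDir i₀) := by
  have h := (measurable_l1Dir i₀).comp
    (measurable_fst : Measurable (Prod.fst : EuclideanSpace ℝ (Fin d) × ℝ → _))
  refine measurable_from_prod_countable_right fun j => ?_
  fin_cases j
  · exact h
  · exact h.neg
  · exact h

lemma measurable_neuronBias : Measurable (neuronBias (d := d)) := by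
  refine measurable_from_prod_countable_right fun j => ?_
  fin_cases j
  · exact measurable_const
  · exact measurable_const
  · exact (measurable_clampUnit.comp measurable_snd).neg

lemma abs_neuronWeight_le {r : ℝ} (hr : 0 ≤ r) (ζ : Fin 3 × (EuclideanSpace ℝ (Fin d) × ℝ)) :
    |neuronWeight θ r ζ| ≤ 6 * r := by
  obtain ⟨j, w, s⟩ := ζ
  have h1 := abs_ridge'_le (θ := θ) w (-1)
  have h2 := abs_ridge''_le (θ := θ) w (clampUnit s)
  fin_cases j
  · change |3 * r * ridge' θ w (-1)| ≤ 6 * r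
    rw [abs_mul, abs_of_nonneg (by positivity : 0 ≤ 3 * r)]
    nlinarith
  · change |-(3 * r * ridge' θ w (-1))| ≤ 6 * r
    rw [abs_neg, abs_mul, abs_of_nonneg (by positivity : 0 ≤ 3 * r)]
    nlinarith
  · change |6 * r * ridge'' θ w (clampUnit s)| ≤ 6 * r
    rw [abs_mul, abs_of_nonneg (by positivity : 0 ≤ 6 * r)]
    nlinarith

lemma l1Norm_neuronDir (i₀ : Fin d) (ζ : Fin 3 × (EuclideanSpace ℝ (Fin d) × ℝ)) :
    l1Norm (neuronDir i₀ ζ) = 1 := by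
  obtain ⟨j, w, s⟩ := ζ
  have h := l1Norm_l1Dir i₀ w
  have h2 : l1Norm (-l1Dir i₀ w) = 1 := by rw [← h]; simp [l1Norm]
  fin_cases j
  · exact h
  · exact h2
  · exact h

lemma abs_neuronBias_le (ζ : Fin 3 × (EuclideanSpace ℝ (Fin d) × ℝ)) : |neuronBias ζ| ≤ 1 := by
  obtain ⟨j, w, s⟩ := ζ
  fin_cases j
  · change |(1 : ℝ)| ≤ 1
    simp
  · change |(-1 : ℝ)| ≤ 1
    simp
  · change |-clampUnit s| ≤ 1
    rw [abs_neg]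
    exact abs_clampUnit_le s

variable {τ r : ℝ} {x : EuclideanSpace ℝ (Fin d)}

lemma abs_inner_l1Dir_le (i₀ : Fin d) (w : EuclideanSpace ℝ (Fin d)) (hx : ∀ i, |x i| ≤ 1) :
    |inner ℝ (l1Dir i₀ w) x| ≤ 1 :=
  (abs_inner_le_l1Norm _ hx).trans (l1Norm_l1Dir i₀ w).le

/-- The average of the random neurons approximates the Barron function. -/
lemma abs_neuron_average_sub_le (i₀ : Fin d) (hθ : Measurable θ) (hr : 0 ≤ r) (hτ : 1 ≤ τ)
    (hx : ∀ i, |x i| ≤ 1) :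
    |r * (∫ w, ridge θ w (-1) ∂Λ) + (∫ ζ, neuronWeight θ r ζ *
        softplus τ (inner ℝ (neuronDir i₀ ζ) x + neuronBias ζ) ∂neuronLaw Λ)
      - barronExt θ Λ r x| ≤ 2 * r / τ := by
  have hτ' : 0 < τ := by linarith
  have hF : Integrable (fun ζ => neuronWeight θ r ζ *
      softplus τ (inner ℝ (neuronDir i₀ ζ) x + neuronBias ζ)) (neuronLaw Λ) := by
    refine Integrable.of_bound ((measurable_neuronWeight hθ r).mul
      ((continuous_softplus hτ').measurable.comp (((measurable_neuronDir i₀).inner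
        measurable_const).add measurable_neuronBias))).aestronglyMeasurable (6 * r * 3)
      (Filter.Eventually.of_forall fun ζ => ?_)
    rw [norm_mul]
    exact mul_le_mul (abs_neuronWeight_le hr ζ) (abs_softplus_le_three hτ
      (abs_preactivation_le (l1Norm_neuronDir i₀ ζ) (abs_neuronBias_le ζ) hx)) (norm_nonneg _)
      (by positivity)
  obtain ⟨hH, hE⟩ := integral_neuronLaw hF
  have hR1 : Integrable (fun w => r * ridge θ w (-1)) Λ :=
    (Integrable.of_bound ((measurable_ridge hθ).comp
      (measurable_id.prodMk measurable_const)).aestronglyMeasurable 1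
      (Filter.Eventually.of_forall fun w => abs_ridge_le w _)).const_mul r
  have hR2 : Integrable (fun w => r * ridge θ w (inner ℝ (l1Dir i₀ w) x)) Λ :=
    (Integrable.of_bound ((measurable_ridge hθ).comp
      (measurable_id.prodMk ((measurable_l1Dir i₀).inner measurable_const))).aestronglyMeasurable 1
      (Filter.Eventually.of_forall fun w => abs_ridge_le w _)).const_mul r
  rw [hE, barronExt_eq i₀, ← integral_const_mul, ← integral_const_mul,
    ← integral_add hR1 hH, ← integral_sub (hR1.fun_add hH) hR2, ← Real.norm_eq_abs]
  refine (norm_integral_le_of_norm_le_const (C := 2 * r / τ)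
    (Filter.Eventually.of_forall fun w => ?_)).trans (by simp)
  have h := abs_sub_softplus_integral_le hτ' (hasDerivAt_ridge (θ := θ) w) (hasDerivAt_ridge' w)
    (continuous_ridge'' w) (abs_ridge''_le w) (abs_inner_l1Dir_le i₀ w hx)
  set t := inner ℝ (l1Dir i₀ w) x
  have e0 : ∀ s, neuronWeight θ r (0, (w, s)) *
      softplus τ (inner ℝ (neuronDir i₀ (0, (w, s))) x + neuronBias (0, (w, s)))
      = 3 * r * ridge' θ w (-1) * softplus τ (t + 1) := fun s => rfl
  have e1 : ∀ s, neuronWeight θ r (1, (w, s)) *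
      softplus τ (inner ℝ (neuronDir i₀ (1, (w, s))) x + neuronBias (1, (w, s)))
      = -(3 * r * ridge' θ w (-1)) * softplus τ (-(t + 1)) := fun s => by
    change -(3 * r * ridge' θ w (-1)) * softplus τ (inner ℝ (-l1Dir i₀ w) x + -1) = _
    rw [inner_neg_left, neg_add]
  have e2 : ∫ s in (-1 : ℝ)..1, neuronWeight θ r (2, (w, s)) *
      softplus τ (inner ℝ (neuronDir i₀ (2, (w, s))) x + neuronBias (2, (w, s)))
      = 6 * r * ∫ s in (-1 : ℝ)..1, ridge'' θ w s * softplus τ (t - s) := by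
    rw [← intervalIntegral.integral_const_mul]
    refine intervalIntegral.integral_congr fun s hs => ?_
    -- The truncation is the identity on the range of integration. It serves to make the bounds on
    -- weights and biases hold for every neuron, not just almost every one.
    change 6 * r * ridge'' θ w (clampUnit s) * softplus τ (t + -clampUnit s) = _
    rw [clampUnit_of_mem hs, ← sub_eq_add_neg, mul_assoc]
  simp only [Fin.sum_univ_three, e0, e1, e2, intervalIntegral.integral_const, smul_eq_mul]
  have hs := softplus_sub_softplus_neg hτ' (t + 1)
  rw [Real.norm_eq_abs]
  -- The outer weights `3 * r` and `6 * r` undo the probability `1 / 3` of each kind and, for the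
  -- third kind, also the density `1 / 2` of the threshold. The first two kinds add up to the exact
  -- linear term.
  have e : r * ridge θ w (-1) + 1 / 3 * (1 / 2 * ((1 - -1) * (3 * r * ridge' θ w (-1) *
      softplus τ (t + 1))) + 1 / 2 * ((1 - -1) * (-(3 * r * ridge' θ w (-1)) *
      softplus τ (-(t + 1)))) + 1 / 2 * (6 * r * ∫ s in (-1 : ℝ)..1,
        ridge'' θ w s * softplus τ (t - s))) - r * ridge θ w t
      = r * (ridge θ w (-1) + ridge' θ w (-1) * (t + 1)
        + (∫ s in (-1 : ℝ)..1, ridge'' θ w s * softplus τ (t - s)) - ridge θ w t) := by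
    linear_combination r * ridge' θ w (-1) * hs
  rw [e, abs_mul, abs_of_nonneg hr, show 2 * r / τ = r * (2 / τ) by ring]
  gcongr

/-- The average of the gradients of the random neurons approximates the gradient of the Barron
function. -/
lemma norm_neuron_gradient_average_sub_le (i₀ : Fin d) (hθ : Measurable θ) (hr : 0 ≤ r)
    (hτ : 1 ≤ τ) (hx : ∀ i, |x i| ≤ 1) :
    ‖(∫ ζ, (neuronWeight θ r ζ * Real.sigmoid (τ * (inner ℝ (neuronDir i₀ ζ) x + neuronBias ζ))) •
        neuronDir i₀ ζ ∂neuronLaw Λ) - gradient (barronExt θ Λ r) x‖ ≤ 2 * r / τ := by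
  have hτ' : 0 < τ := by linarith
  have hF : Integrable (fun ζ => (neuronWeight θ r ζ *
      Real.sigmoid (τ * (inner ℝ (neuronDir i₀ ζ) x + neuronBias ζ))) • neuronDir i₀ ζ)
      (neuronLaw Λ) := by
    refine Integrable.of_bound (((measurable_neuronWeight hθ r).mul
      (continuous_sigmoid.measurable.comp ((((measurable_neuronDir i₀).inner
        measurable_const).add measurable_neuronBias).const_mul τ))).smul
        (measurable_neuronDir i₀)).aestronglyMeasurable (6 * r * 1 * 1)
      (Filter.Eventually.of_forall fun ζ => ?_)
    rw [norm_smul, norm_mul]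
    exact mul_le_mul (mul_le_mul (abs_neuronWeight_le hr ζ) (abs_sigmoid_le_one _) (norm_nonneg _)
      (by positivity)) ((norm_le_l1Norm _).trans (l1Norm_neuronDir i₀ ζ).le) (norm_nonneg _)
      (by positivity)
  obtain ⟨hH, hE⟩ := integral_neuronLaw hF
  have hR := integrable_ridge'_smul (Λ := Λ) i₀ hθ x
  rw [hE, gradient_barronExt i₀ hθ, ← integral_smul, ← integral_sub hH (hR.fun_smul r)]
  refine (norm_integral_le_of_norm_le_const (C := 2 * r / τ)
    (Filter.Eventually.of_forall fun w => ?_)).trans (by simp)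
  have h := abs_deriv_sub_sigmoid_integral_le hτ' (hasDerivAt_ridge' (θ := θ) w)
    (continuous_ridge'' w) (abs_ridge''_le w) (abs_inner_l1Dir_le i₀ w hx)
  set t := inner ℝ (l1Dir i₀ w) x
  have e0 : ∀ s, (neuronWeight θ r (0, (w, s)) * Real.sigmoid
      (τ * (inner ℝ (neuronDir i₀ (0, (w, s))) x + neuronBias (0, (w, s))))) •
        neuronDir i₀ (0, (w, s))
      = (3 * r * ridge' θ w (-1) * Real.sigmoid (τ * (t + 1))) • l1Dir i₀ w := fun s => rfl
  have e1 : ∀ s, (neuronWeight θ r (1, (w, s)) * Real.sigmoid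
      (τ * (inner ℝ (neuronDir i₀ (1, (w, s))) x + neuronBias (1, (w, s))))) •
        neuronDir i₀ (1, (w, s))
      = (3 * r * ridge' θ w (-1) * (1 - Real.sigmoid (τ * (t + 1)))) • l1Dir i₀ w := fun s => by
    change (-(3 * r * ridge' θ w (-1)) *
      Real.sigmoid (τ * (inner ℝ (-l1Dir i₀ w) x + -1))) • -l1Dir i₀ w = _
    -- Since the sigmoid at `-z` is one minus its value at `z`, the gradients of the two opposite
    -- neurons combine to a constant vector: the gradient of the exact linear term.
    rw [inner_neg_left, ← neg_add, mul_neg, Real.sigmoid_neg, smul_neg, ← neg_smul]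
    congr 1
    ring
  have e2 : ∫ s in (-1 : ℝ)..1, (neuronWeight θ r (2, (w, s)) * Real.sigmoid
      (τ * (inner ℝ (neuronDir i₀ (2, (w, s))) x + neuronBias (2, (w, s))))) •
        neuronDir i₀ (2, (w, s))
      = (6 * r * ∫ s in (-1 : ℝ)..1, ridge'' θ w s * Real.sigmoid (τ * (t - s))) •
        l1Dir i₀ w := by
    rw [← intervalIntegral.integral_const_mul, ← intervalIntegral.integral_smul_const]
    refine intervalIntegral.integral_congr fun s hs => ?_
    change (6 * r * ridge'' θ w (clampUnit s) *
      Real.sigmoid (τ * (t + -clampUnit s))) • l1Dir i₀ w = _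
    simp only [clampUnit_of_mem hs, ← sub_eq_add_neg, mul_assoc]
  simp only [Fin.sum_univ_three, e0, e1, e2, intervalIntegral.integral_const, smul_smul,
    ← add_smul, ← sub_smul]
  rw [norm_smul, Real.norm_eq_abs]
  have e : ∀ I : ℝ, 1 / 3 * (1 / 2 * ((1 - -1) * (3 * r * ridge' θ w (-1) *
      Real.sigmoid (τ * (t + 1)))) + 1 / 2 * ((1 - -1) * (3 * r * ridge' θ w (-1) *
      (1 - Real.sigmoid (τ * (t + 1))))) + 1 / 2 * (6 * r * I)) - r * ridge' θ w t
      = r * (ridge' θ w (-1) + I - ridge' θ w t) := fun I => by ring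
  rw [e, abs_mul, abs_of_nonneg hr, show 2 * r / τ = r * (2 / τ) * 1 by ring]
  gcongr
  exact (norm_le_l1Norm _).trans (l1Norm_l1Dir i₀ w).le

end NeuronLaw

/-! ### The uniform distribution on the domain -/

section UniformMeasure

variable {d : ℕ} {Ω : Set (EuclideanSpace ℝ (Fin d))}

lemma isBounded_of_abs_le_one (hcube : ∀ x ∈ Ω, ∀ i, |x i| ≤ 1) : Bornology.IsBounded Ω := by
  refine (Metric.isBounded_closedBall (x := 0) (r := d)).subset fun x hx => ?_
  rw [mem_closedBall_zero_iff]
  refine (norm_le_l1Norm x).trans ((Finset.sum_le_sum fun i _ => hcube x hx i).trans ?_)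
  simp

lemma isProbabilityMeasure_uniformMeasure (hΩ : IsOpen Ω) (hne : Ω.Nonempty)
    (hb : Bornology.IsBounded Ω) : IsProbabilityMeasure (uniformMeasure Ω) :=
  ProbabilityTheory.cond_isProbabilityMeasure_of_finite (hΩ.measure_pos volume hne).ne'
    hb.measure_lt_top.ne

lemma integral_uniformMeasure (f : EuclideanSpace ℝ (Fin d) → ℝ) :
    ∫ x, f x ∂uniformMeasure Ω = (∫ x in Ω, f x) / (volume Ω).toReal := by
  rw [uniformMeasure, ProbabilityTheory.cond, integral_smul_measure, ENNReal.toReal_inv,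
    smul_eq_mul, inv_mul_eq_div]

lemma ae_uniformMeasure (hΩ : IsOpen Ω) : ∀ᵐ x ∂uniformMeasure Ω, x ∈ Ω :=
  Measure.ae_smul_measure (ae_restrict_mem hΩ.measurableSet) _

lemma aemeasurable_uniformMeasure {y : EuclideanSpace ℝ (Fin d) → ℝ}
    (hy : AEMeasurable y (volume.restrict Ω)) : AEMeasurable y (uniformMeasure Ω) :=
  hy.smul_measure _

lemma totalVariation_congr (hΩ : IsOpen Ω) {u v : EuclideanSpace ℝ (Fin d) → ℝ}
    (h : ∀ x ∈ Ω, u x = v x) : totalVariation Ω u = totalVariation Ω v := by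
  unfold totalVariation
  refine iSup_congr fun p => iSup_congr fun _ => congrArg ENNReal.ofReal ?_
  exact setIntegral_congr_fun hΩ.measurableSet fun x hx => by simp only [h x hx]

end UniformMeasure

/-! ### Comparison of the pointwise loss of a network with its total variation loss -/

section Losses

variable {d m N : ℕ} {Ω : Set (EuclideanSpace ℝ (Fin d))} {τ B Y : ℝ}
  {y : EuclideanSpace ℝ (Fin d) → ℝ}

lemma tvEmpLoss_net (hτ : 0 < τ) (p : NetParam d m) (x : Fin N → EuclideanSpace ℝ (Fin d)) :
    tvEmpLoss y x (net τ p) = 1 / (N : ℝ) * ∑ i, netLoss τ y p (x i) := by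
  simp only [tvEmpLoss, gradient_net hτ, netLoss]

lemma contDiff_net (hτ : 0 < τ) (p : NetParam d m) : ContDiff ℝ 1 (net τ p) := by
  rw [contDiff_one_iff_fderiv]
  refine ⟨fun x => (hasGradientAt_net hτ p x).hasFDerivAt.differentiableAt, ?_⟩
  have : fderiv ℝ (net τ p) = fun x => innerSL ℝ (netGrad τ p x) :=
    funext fun x => (hasGradientAt_net hτ p x).hasFDerivAt.fderiv
  rw [this]
  have h : Continuous fun x => netGrad τ p x := continuous_netGrad_apply τ p
  exact (innerSL ℝ).continuous.comp h

lemma integrableOn_of_continuous (hb : Bornology.IsBounded Ω)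
    {f : EuclideanSpace ℝ (Fin d) → ℝ} (hf : Continuous f) : IntegrableOn f Ω :=
  ((hf.continuousOn.integrableOn_compact hb.isCompact_closure)).mono_set subset_closure

lemma integrable_uniformMeasure (hΩ : IsOpen Ω) (hne : Ω.Nonempty)
    {f : EuclideanSpace ℝ (Fin d) → ℝ} (hf : IntegrableOn f Ω) :
    Integrable f (uniformMeasure Ω) :=
  Integrable.smul_measure hf (by simpa using (hΩ.measure_pos volume hne).ne')

lemma aemeasurable_sq_sub {ρ : Measure (EuclideanSpace ℝ (Fin d))}
    {v : EuclideanSpace ℝ (Fin d) → ℝ} (hv : AEMeasurable v ρ) (hy : AEMeasurable y ρ) :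
    AEMeasurable (fun x => v x ^ 2 - 2 * v x * y x) ρ :=
  (hv.pow_const 2).sub ((hv.const_mul 2).mul hy)

lemma integrable_sq_sub {ρ : Measure (EuclideanSpace ℝ (Fin d))} [IsProbabilityMeasure ρ]
    {v : EuclideanSpace ℝ (Fin d) → ℝ} {K : ℝ} (hv : AEMeasurable v ρ) (hy : AEMeasurable y ρ)
    (hvK : ∀ᵐ x ∂ρ, |v x| ≤ K) (hyY : ∀ᵐ x ∂ρ, |y x| ≤ Y) :
    Integrable (fun x => v x ^ 2 - 2 * v x * y x) ρ := by
  refine Integrable.of_bound (aemeasurable_sq_sub hv hy).aestronglyMeasurable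
    (K ^ 2 + 2 * K * Y) ?_
  filter_upwards [hvK, hyY] with x h1 h2
  have h0 := abs_nonneg (v x)
  rw [Real.norm_eq_abs]
  refine (abs_sub _ _).trans (add_le_add ?_ ?_)
  · rw [abs_pow]
    gcongr
  · rw [abs_mul, abs_mul, abs_two]
    gcongr
    linarith

/-- The loss of a network is at most the expectation of its pointwise loss. -/
lemma tvLoss_net_le (hΩ : IsOpen Ω) (hne : Ω.Nonempty) (hcube : ∀ x ∈ Ω, ∀ i, |x i| ≤ 1)
    (hy : AEMeasurable y (volume.restrict Ω)) (hyY : ∀ x ∈ Ω, |y x| ≤ Y) (hm : 0 < m) (hτ : 1 ≤ τ)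
    {p : NetParam d m} (hp : p ∈ netParams d m B) :
    tvLoss Ω y (net τ p) ≤ ∫ x, netLoss τ y p x ∂uniformMeasure Ω := by
  have hτ' : 0 < τ := by linarith
  have hb := isBounded_of_abs_le_one hcube
  have := isProbabilityMeasure_uniformMeasure hΩ hne hb
  have hg : Continuous fun x => ‖netGrad τ p x‖ :=
    ((continuous_netGrad τ).comp (continuous_const.prodMk continuous_id)).norm
  have hgi := integrableOn_of_continuous hb hg
  have hae := ae_uniformMeasure hΩ
  have h1 : Integrable (fun x => net τ p x ^ 2 - 2 * net τ p x * y x) (uniformMeasure Ω) :=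
    integrable_sq_sub (contDiff_net hτ' p).continuous.aemeasurable (aemeasurable_uniformMeasure hy)
      (hae.mono fun x hx => abs_net_le hm hτ hp (hcube x hx)) (hae.mono hyY)
  have hT := totalVariation_le (contDiff_net hτ' p) (by simpa only [gradient_net hτ'] using hgi)
  simp only [gradient_net hτ'] at hT
  have hT' := ENNReal.toReal_le_of_le_ofReal (integral_nonneg fun x => norm_nonneg _) hT
  simp only [netLoss]
  rw [integral_add h1 (integrable_uniformMeasure hΩ hne hgi), tvLoss,
    integral_uniformMeasure fun x => ‖netGrad τ p x‖]
  gcongr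

end Losses

/-! ### Approximation of a Barron function by a network -/

section Approximation

variable {d m : ℕ} {Ω : Set (EuclideanSpace ℝ (Fin d))} {B Y : ℝ}
  {y u : EuclideanSpace ℝ (Fin d) → ℝ}

/-- Some network has an expected loss close to the loss of a given Barron function. -/
lemma exists_net_integral_le_tvLoss (i₀ : Fin d) (hΩ : IsOpen Ω) (hne : Ω.Nonempty)
    (hcube : ∀ x ∈ Ω, ∀ i, |x i| ≤ 1) (hy : AEMeasurable y (volume.restrict Ω))
    (hyY : ∀ x ∈ Ω, |y x| ≤ Y) (hTV : totalVariation Ω u ≠ ⊤) (hm : 0 < m)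
    {θ : EuclideanSpace ℝ (Fin d) → ℝ} {Λ : Measure (EuclideanSpace ℝ (Fin d))}
    [IsProbabilityMeasure Λ] (hθ : Measurable θ) {r : ℝ} (hr : 0 ≤ r) (hrB : r ≤ B)
    (hu : ∀ x ∈ Ω, u x = barronExt θ Λ r x) :
    ∃ p ∈ netParams d m B, ∫ x, netLoss (Real.sqrt m) y p x ∂uniformMeasure Ω
      ≤ tvLoss Ω y u + r / Real.sqrt m * (332 * r + 4 * Y + 8) := by
  have hm1 : (1 : ℝ) ≤ m := by exact_mod_cast hm
  set τ := Real.sqrt m with hτdef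
  have hτ : 1 ≤ τ := Real.one_le_sqrt.2 hm1
  have hτ' : 0 < τ := by linarith
  have hτ2 : τ ^ 2 = m := Real.sq_sqrt (by linarith)
  have hb := isBounded_of_abs_le_one hcube
  have := isProbabilityMeasure_uniformMeasure hΩ hne hb
  have hae := ae_uniformMeasure hΩ
  have hy' := aemeasurable_uniformMeasure hy
  have hC := contDiff_barronExt (Λ := Λ) hθ r
  have hG : Continuous fun x => ‖gradient (barronExt θ Λ r) x‖ :=
    (continuous_gradient (hC.of_le (by norm_num))).norm
  have hGi := integrableOn_of_continuous hb hG
  have hTVe := totalVariation_congr hΩ hu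
  have hTV' := setIntegral_norm_gradient_le hΩ hb hC (hTVe ▸ hTV) hGi
  rw [← hTVe] at hTV'
  have h1 : Integrable (fun x => barronExt θ Λ r x ^ 2 - 2 * barronExt θ Λ r x * y x)
      (uniformMeasure Ω) :=
    integrable_sq_sub hC.continuous.aemeasurable hy'
      (Filter.Eventually.of_forall fun x => abs_barronExt_le hr x) (hae.mono hyY)
  have h2 := integrable_uniformMeasure hΩ hne hGi
  have hgle : ∫ x, (barronExt θ Λ r x ^ 2 - 2 * barronExt θ Λ r x * y x
      + ‖gradient (barronExt θ Λ r) x‖) ∂uniformMeasure Ω ≤ tvLoss Ω y u := by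
    rw [integral_add h1 h2, tvLoss, integral_uniformMeasure fun x => ‖gradient (barronExt θ Λ r) x‖]
    have hI : ∫ x, (barronExt θ Λ r x ^ 2 - 2 * barronExt θ Λ r x * y x) ∂uniformMeasure Ω
        = ∫ x, (u x ^ 2 - 2 * u x * y x) ∂uniformMeasure Ω :=
      integral_congr_ae (hae.mono fun x hx => by simp only [hu x hx])
    rw [hI]
    gcongr
  -- The error of passing from `u` to the mean neuron: the first term for the quadratic part, by
  -- factoring the difference of squares, the second for the norm of the gradient.
  set e := 2 * r / τ * (4 * r + 2 * Y) + 2 * r / τ with he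
  have h12 := h1.fun_add h2
  have hη0 : 2 * r / τ ≤ 2 * r := div_le_self (by positivity) hτ
  have hη1 : 0 ≤ 2 * r / τ := by positivity
  obtain ⟨p, hp, hle⟩ := exists_net_integral_le (P := neuronLaw Λ) (B := B) (Y := Y) hm hτ hy'
    (hae.mono fun x hx => ⟨hcube x hx, hyY x hx⟩) (measurable_neuronWeight hθ r)
    measurable_neuronBias (measurable_neuronDir i₀) (A := 6 * r)
    (c := r * ∫ w, ridge θ w (-1) ∂Λ) (abs_neuronWeight_le hr) (l1Norm_neuronDir i₀)
    abs_neuronBias_le (by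
      rw [abs_mul, abs_of_nonneg hr, ← Real.norm_eq_abs]
      have := norm_integral_le_of_norm_le_const (μ := Λ) (f := fun w => ridge θ w (-1)) (C := 1)
        (Filter.Eventually.of_forall fun w => abs_ridge_le w (-1))
      simp only [probReal_univ, mul_one] at this
      nlinarith) (by linarith)
    (g := fun x => barronExt θ Λ r x ^ 2 - 2 * barronExt θ Λ r x * y x
      + ‖gradient (barronExt θ Λ r) x‖ + e) (h12.add (integrable_const e)) (by
      filter_upwards [hae] with x hx
      have hη := abs_neuron_average_sub_le (Λ := Λ) i₀ hθ hr hτ (hcube x hx)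
      have hg := norm_neuron_gradient_average_sub_le (Λ := Λ) i₀ hθ hr hτ (hcube x hx)
      have hg' := (norm_sub_norm_le _ _).trans hg
      have hB := abs_barronExt_le (θ := θ) (Λ := Λ) hr x
      have hYx := hyY x hx
      set v := r * (∫ w, ridge θ w (-1) ∂Λ) + (∫ ζ, neuronWeight θ r ζ *
        softplus τ (inner ℝ (neuronDir i₀ ζ) x + neuronBias ζ) ∂neuronLaw Λ)
      set U := barronExt θ Λ r x
      have hq : (v - U) * (2 * U + (v - U) - 2 * y x) ≤ 2 * r / τ * (4 * r + 2 * Y) := by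
        refine (le_abs_self _).trans ?_
        rw [abs_mul]
        refine mul_le_mul hη ?_ (abs_nonneg _) hη1
        rw [abs_le] at hη hB hYx ⊢
        constructor <;> linarith [hη.1, hη.2, hB.1, hB.2, hYx.1, hYx.2]
      linarith)
  refine ⟨p, hp, hle.trans ?_⟩
  rw [integral_add h12 (integrable_const e), integral_const, probReal_univ, one_smul]
  -- In units of `r / τ`, the coefficients are `332 = 8 + 18 ^ 2` and `8 = 2 + 6`. The variance term
  -- is of order `1 / m` and is weakened to `1 / √m`.
  have h3 : e + ((3 * (6 * r)) ^ 2 / (m : ℝ) + 6 * r / Real.sqrt m)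
      ≤ r / τ * (332 * r + 4 * Y + 8) := by
    rw [← hτdef, ← hτ2]
    have h4 : (3 * (6 * r)) ^ 2 / τ ^ 2 ≤ (3 * (6 * r)) ^ 2 / τ := by
      gcongr
      nlinarith
    calc _ ≤ e + ((3 * (6 * r)) ^ 2 / τ + 6 * r / τ) := by gcongr
      _ = _ := by rw [he]; ring
  linarith

end Approximation

end

/-! ### The main estimate -/

theorem theorem4 :
    ∃ (Z₁ : ℝ → ℕ → ℝ → ℝ) (Z₂ : ℝ → ℕ → ℝ) (M₁ : ℝ → ℝ → ℝ),
      ∀ (d : ℕ) (Ω : Set (EuclideanSpace ℝ (Fin d))),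
        IsOpen Ω → Ω.Nonempty → (∀ x ∈ Ω, ∀ i, |x i| ≤ 1) →
      ∀ (Y : ℝ) (y : EuclideanSpace ℝ (Fin d) → ℝ),
        0 < Y → AEMeasurable y (volume.restrict Ω) → (∀ x ∈ Ω, |y x| ≤ Y) →
      ∀ (u : EuclideanSpace ℝ (Fin d) → ℝ) (B : ℝ),
        IsTVMinimizer Ω y u → IsBarron 2 Ω u → barronNorm 2 Ω u < B →
      ∀ (m N : ℕ) (ε : ℝ), 0 < m → 0 < N → 0 < ε → ε < 1 →
        ∃ G : Set (Fin N → EuclideanSpace ℝ (Fin d)), MeasurableSet G ∧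
          ENNReal.ofReal (1 - ε) ≤ Measure.pi (fun _ : Fin N => uniformMeasure Ω) G ∧
          ∀ x ∈ G, ∀ (δ : ℝ) (φ : EuclideanSpace ℝ (Fin d) → ℝ),
            IsDeltaMinimizer (twoLayerNets d (softplus (Real.sqrt m)) m B)
              (tvEmpLoss y x) δ φ →
            tvLoss Ω y φ - tvLoss Ω y u ≤
              (2 * Y + 49 * B + l2Norm Ω u + 1) * (barronNorm 2 Ω u / Real.sqrt m)
                  * (24 * Real.log m + 65)
                + 4 * (Real.sqrt m / Real.sqrt N)
                  * (Z₁ B d Y + Z₂ B d * Real.sqrt (Real.log m))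
                + 2 * M₁ B Y * (Real.sqrt (-2 * Real.log ε) / Real.sqrt N)
                + 2 * δ := by
  -- The half comes from the factor `4` in the statement against the two deviations used. The term
  -- with `log 2`, due to the union of the two one-sided events, is absorbed into `Z₁` by `√m ≥ 1`.
  refine ⟨fun B d Y => (lossComplexity B d Y + lossBound B Y * Real.sqrt (2 * Real.log 2)) / 2,
    fun _ _ => 0, fun B Y => lossBound B Y, fun d Ω hΩ hne hcube Y y hY hy hyY u B hu hBar hlt
      m N ε hm hN hε hε1 => ?_⟩
  have hb := isBounded_of_abs_le_one hcube
  have := isProbabilityMeasure_uniformMeasure hΩ hne hb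
  have hm1 : (1 : ℝ) ≤ m := by exact_mod_cast hm
  have hτ : 1 ≤ Real.sqrt m := Real.one_le_sqrt.2 hm1
  have hτ' : 0 < Real.sqrt m := by linarith
  have hnn : ∀ F : EuclideanSpace ℝ (Fin d) → ℂ,
      0 ≤ ∫ w, (1 + l1Norm w) ^ (2 : ℝ) * ‖F w‖ := fun F => integral_nonneg fun w => by
    have := l1Norm_nonneg w
    positivity
  have hb0 : 0 ≤ barronNorm 2 Ω u := by
    refine Real.sInf_nonneg ?_
    rintro r ⟨F, -, rfl⟩
    exact hnn F
  have hB : 0 < B := hb0.trans_lt hlt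
  have hae := ae_uniformMeasure hΩ
  obtain ⟨G, hGm, hGp, hG⟩ := exists_deviation_event (B := B) (Y := Y) hm hτ hB
    (aemeasurable_uniformMeasure hy) (hae.mono fun x hx => ⟨hcube x hx, hyY x hx⟩) hN hε hε1
  refine ⟨G, hGm, hGp, fun x hx δ φ hφ => ?_⟩
  obtain ⟨p, hp, rfl⟩ := mem_twoLayerNets_iff.1 hφ.1
  -- In dimension zero no vector has `ℓ¹` norm one, so a network of positive width cannot exist.
  have hd : 0 < d := by
    rcases Nat.eq_zero_or_pos d with rfl | hd
    · exact absurd (hp.2 ⟨0, hm⟩).2.1 (by simp [l1Norm])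
    · exact hd
  have i₀ : Fin d := ⟨0, hd⟩
  -- Comparing the minimizer with itself. This allows `δ` to be weakened to `2 * δ` at the end.
  have hδ : 0 ≤ δ := by linarith [hφ.2 _ hφ.1]
  set D := (lossComplexity B d Y * Real.sqrt m + lossBound B Y *
    (Real.sqrt (2 * Real.log 2) + Real.sqrt (-2 * Real.log ε))) / Real.sqrt N with hD
  -- The event `G` is fixed before the representation is chosen, so the estimate holds for all
  -- representations of moment `r < B` at once. The two deviations are those of the given network
  -- and of the approximating one.
  have key : ∀ r ∈ {r : ℝ | ∃ F : EuclideanSpace ℝ (Fin d) → ℂ, IsBarronRep 2 Ω u F ∧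
      r = ∫ w, (1 + l1Norm w) ^ (2 : ℝ) * ‖F w‖}, r < B →
      tvLoss Ω y (net (Real.sqrt m) p) ≤ tvLoss Ω y u
        + r / Real.sqrt m * (332 * r + 4 * Y + 8) + δ + 2 * D := by
    rintro r ⟨F, hF, rfl⟩ hrB
    obtain ⟨θ, Λ, hθ, hΛ, huF⟩ := hF.exists_eq_barronExt
    obtain ⟨q, hq, hqle⟩ := exists_net_integral_le_tvLoss (m := m) i₀ hΩ hne hcube hy hyY
      hu.isBV.2 hm hθ (hnn F) hrB.le huF
    have h1 := tvLoss_net_le hΩ hne hcube hy hyY hm hτ hp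
    have h2 := abs_le.1 (hG x hx p hp)
    have h3 := abs_le.1 (hG x hx q hq)
    have h4 := hφ.2 _ (mem_twoLayerNets_iff.2 ⟨q, hq, rfl⟩)
    rw [tvEmpLoss_net hτ', tvEmpLoss_net hτ'] at h4
    linarith [h2.1, h2.2, h3.1, h3.2]
  have hlog : 0 ≤ Real.log m := Real.log_nonneg hm1
  have hl2 : 0 ≤ l2Norm Ω u := Real.sqrt_nonneg _
  have hlB : 0 ≤ lossBound B Y := by
    unfold lossBound
    positivity
  set K := (2 * Y + 49 * B + l2Norm Ω u + 1) * (24 * Real.log m + 65) with hK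
  have hK0 : 0 < K := by positivity
  have hKle : ∀ r, r < B → 332 * r + 4 * Y + 8 ≤ K := fun r hr => by
    have h1 : (2 * Y + 49 * B + l2Norm Ω u + 1) * 65 ≤ K := by
      rw [hK]
      gcongr
      linarith
    linarith
  -- Solved for `r`, the estimate is a lower bound independent of the representation, hence a lower
  -- bound for the infimum as well. No optimal representation is needed.
  have key' : ∀ r, 0 ≤ r → r < B → tvLoss Ω y (net (Real.sqrt m) p) ≤ tvLoss Ω y u
        + r / Real.sqrt m * (332 * r + 4 * Y + 8) + δ + 2 * D →
      (tvLoss Ω y (net (Real.sqrt m) p) - tvLoss Ω y u - δ - 2 * D) * (Real.sqrt m / K) ≤ r := by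
    intro r hr hrB h
    have h1 := mul_le_mul_of_nonneg_left (hKle r hrB) (by positivity : 0 ≤ r / Real.sqrt m)
    rw [← le_div_iff₀ (by positivity), div_div_eq_mul_div, ← div_mul_eq_mul_div]
    linarith
  have hinf : (tvLoss Ω y (net (Real.sqrt m) p) - tvLoss Ω y u - δ - 2 * D) * (Real.sqrt m / K)
      ≤ barronNorm 2 Ω u := by
    have hSne : {r : ℝ | ∃ F : EuclideanSpace ℝ (Fin d) → ℂ, IsBarronRep 2 Ω u F ∧
        r = ∫ w, (1 + l1Norm w) ^ (2 : ℝ) * ‖F w‖}.Nonempty := by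
      obtain ⟨F₀, hF₀⟩ := hBar
      exact ⟨_, F₀, hF₀, rfl⟩
    refine le_csInf hSne fun r hr => ?_
    obtain ⟨r₁, hr₁, hr₁B⟩ := exists_lt_of_csInf_lt hSne hlt
    have hpos : ∀ s ∈ {r : ℝ | ∃ F : EuclideanSpace ℝ (Fin d) → ℂ, IsBarronRep 2 Ω u F ∧
        r = ∫ w, (1 + l1Norm w) ^ (2 : ℝ) * ‖F w‖}, 0 ≤ s := by
      rintro s ⟨F, -, rfl⟩
      exact hnn F
    -- Representations with `r ≥ B` are outside the reach of the network class, but some `r₁ < B`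
    -- exists and its bound is stronger.
    rcases lt_or_ge r B with hrB | hrB
    · exact key' r (hpos r hr) hrB (key r hr hrB)
    · exact (key' r₁ (hpos r₁ hr₁) hr₁B (key r₁ hr₁ hr₁B)).trans (hr₁B.le.trans hrB)
  rw [← le_div_iff₀ (by positivity), div_div_eq_mul_div, ← div_mul_eq_mul_div] at hinf
  have hD2 : 2 * D ≤ 4 * (Real.sqrt m / Real.sqrt N) * ((lossComplexity B d Y +
      lossBound B Y * Real.sqrt (2 * Real.log 2)) / 2 + 0 * Real.sqrt (Real.log m))
      + 2 * lossBound B Y * (Real.sqrt (-2 * Real.log ε) / Real.sqrt N) := by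
    have h1 : lossBound B Y * Real.sqrt (2 * Real.log 2) / Real.sqrt N
        ≤ lossBound B Y * Real.sqrt (2 * Real.log 2) / Real.sqrt N * Real.sqrt m :=
      le_mul_of_one_le_right (by positivity) hτ
    calc 2 * D = 2 * (lossComplexity B d Y * Real.sqrt m / Real.sqrt N) + 2 * (lossBound B Y *
          Real.sqrt (2 * Real.log 2) / Real.sqrt N)
          + 2 * lossBound B Y * (Real.sqrt (-2 * Real.log ε) / Real.sqrt N) := by rw [hD]; ring
      _ ≤ 2 * (lossComplexity B d Y * Real.sqrt m / Real.sqrt N) + 2 * (lossBound B Y *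
          Real.sqrt (2 * Real.log 2) / Real.sqrt N * Real.sqrt m)
          + 2 * lossBound B Y * (Real.sqrt (-2 * Real.log ε) / Real.sqrt N) := by gcongr
      _ = _ := by ring
  have hKe : (2 * Y + 49 * B + l2Norm Ω u + 1) * (barronNorm 2 Ω u / Real.sqrt m)
      * (24 * Real.log m + 65) = barronNorm 2 Ω u / Real.sqrt m * K := by
    rw [hK]
    ring
  rw [hKe]
  linarith
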